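/- **Setup.** $\mathrm{QSym}$ is the ring of quasi-symmetric functions over $\mathbb{Z}$ in $t_1,t_2,\ldots$ (formal power series of bounded degree in which $t_{k_1}^{\gamma_1}\cdots t_{k_n}^{\gamma_n}$ and $t_{h_1}^{\gamma_1}\cdots t_{h_n}^{\gamma_n}$, with positive exponents, have the same coefficient whenever $k_1<\cdots<k_n$ and $h_1<\cdots<h_n$). For a finite sequence $\gamma=(\gamma_1,\ldots,\gamma_n)$ of positive integers put $$M_\gamma=\sum_{m_1<\cdots<m_n}t_{m_1}^{\gamma_1}\cdots t_{m_n}^{\gamma_n},\qquad E_\gamma=\sum_{m_1\le\cdots\le m_n}t_{m_1}^{\gamma_1}\cdots t_{m_n}^{\gamma_n},\qquad M_\emptyset=E_\emptyset=1 .$$ $\mathrm{QSym}$ is a Hopf algebra with coproduct $\Delta(M_\gamma)=\sum_{i=0}^{n}M_{(\gamma_1,\ldots,\gamma_i)}\otimes M_{(\gamma_{i+1},\ldots,\gamma_n)}$ and with the constant term as counit; let $S$ be its antipode. Let $\nu=\lambda/\mu$ be a skew Young diagram ($\mu\subset\lambda$ partitions, boxes $(i,j)$ with $\mu_i<j\le\lambda_i$)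 with $|\nu|$ boxes, and let $\gamma=(\gamma_{ij})$ be a filling of its boxes by positive integers. Put $S_\nu(\gamma)=\sum_{(m_{ij})}\prod_{(i,j)\in\nu}t_{m_{ij}}^{\gamma_{ij}}$, the sum running over the semi-standard tableaux of shape $\nu$ (rows weakly increasing, columns strictly increasing, entries positive integers). If $\lambda$ has $r$ rows and $s$ columns, the anti-diagonal transpose $\nu^{\#}$ is the skew diagram of the boxes $(s+1-j,\,r+1-i)$ with $(i,j)\in\nu$, presented as (outer)/(inner) where outer and inner consist of the boxes $(a,b)\in[1,s]\times[1,r]$ with $(r+1-b,s+1-a)\notin\mu$ and $(r+1-b,s+1-a)\notin\lambda$ respectively; $\gamma^{\#}$ is the filling of $\nu^{\#}$ with $\gamma^{\#}_{s+1-j,\,r+1-i}=\gamma_{ij}$. A ribbon is a non-empty connected skew diagram without $2\times2$ block. For a skew diagram $\kappa=\lambda/\mu$ such that $\lambda$ has $r$ rows and $s$ columns, a rim decomposition of $\kappa$ is a sequence $\Theta=(\theta_1,\ldots,\theta_t)$ of pairwise disjoint sets of boxes with union $\kappa$, each of them empty or a ribbon, such that $\mu\cup\theta_1\cup\cdots\cup\theta_k$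 is the diagram of a partition for every $k$. It is an $H$-rim decomposition if $t=r$ and every non-empty $\theta_i$ has bottom left box $(i,\mu_i+1)$, and an $E$-rim decomposition if $t=s$ and every non-empty $\theta_i$ has top right box $(\mu'_i+1,i)$, where $'$ is conjugation. Write $\mathrm{Rim}_H^{\kappa}$ and $\mathrm{Rim}_E^{\kappa}$ for the sets of these. The sign $\varepsilon_H(\Theta)$ (resp. $\varepsilon_E(\Theta)$) is the signature of the unique permutation $\sigma$ of $\{1,\ldots,r\}$ (resp. $\{1,\ldots,s\}$) with $|\theta_i|=(\lambda_{\sigma(i)}-\sigma(i))-(\mu_i-i)$ (resp. $|\theta_i|=(\lambda'_{\sigma(i)}-\sigma(i))-(\mu'_i-i)$) for all $i$. For a filling $\delta$ of $\kappa$, let $\theta_i(\delta)$ be the sequence of the entries of $\delta$ in $\theta_i$, read from the bottom left to the top right for $H$-rim decompositions and from the top right to the bottom left for $E$-rim decompositions. **Theorem.** For every skew Young diagram $\nu$ and every filling $\gamma$ of $\nu$ by positive integers, $$S(S_\nu(\gamma))=(-1)^{|\nu|}\,S_{\nu^{\#}}(\gamma^{\#}).$$ If moreover $\gamma$ is constant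 on diagonals ($\gamma_{ij}=\gamma_{kl}$ whenever $j-i=l-k$), then $$S(S_\nu(\gamma))=(-1)^{|\nu|}\sum_{\Theta=(\theta_1,\theta_2,\ldots)\in\mathrm{Rim}_H^{\nu^{\#}}}\varepsilon_H(\Theta)\prod_{i}E_{\theta_i(\gamma^{\#})},$$ $$S(S_\nu(\gamma))=(-1)^{|\nu|}\sum_{\Theta=(\theta_1,\theta_2,\ldots)\in\mathrm{Rim}_E^{\nu^{\#}}}\varepsilon_E(\Theta)\prod_{i}M_{\theta_i(\gamma^{\#})}.$$ -/

import Mathlib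

open scoped TensorProduct

noncomputable section

namespace SchurQSym

/-! Quasi-symmetric functions are set up over a commutative ring `R`; the integral ones are `QSym ℤ`.
The variables are `t_0, t_1, t_2, …`, indexed by `ℕ`. -/

variable (R : Type*) [CommRing R]

/-- The formal power series `∑_f ∏_i t_{f i} ^ (w i)`, summed over all `f : ι → ℕ` with `P f`. Its
coefficient at `t^d` is the number of such `f` with `∏_i t_{f i} ^ (w i) = t^d`; this number is finite
as all the exponents `w i` are positive. -/
def genFun {ι : Type*} [Fintype ι] (P : (ι → ℕ) → Prop) (w : ι → ℕ+) :
    MvPowerSeries ℕ R :=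
  fun d => (Nat.card {f : ι → ℕ // P f ∧ ∑ i, Finsupp.single (f i) (w i : ℕ) = d} : R)

/-- The coefficients of `t_{k_1}^{γ_1} ⋯ t_{k_n}^{γ_n}` and `t_{h_1}^{γ_1} ⋯ t_{h_n}^{γ_n}` agree
whenever `k_1 < ⋯ < k_n` and `h_1 < ⋯ < h_n`. -/
def IsQuasiSymmetric {R : Type*} [CommRing R] (p : MvPowerSeries ℕ R) : Prop :=
  ∀ (n : ℕ) (γ : Fin n → ℕ+) (k h : Fin n → ℕ), StrictMono k → StrictMono h →
    MvPowerSeries.coeff (∑ i, Finsupp.single (k i) (γ i : ℕ)) p =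
      MvPowerSeries.coeff (∑ i, Finsupp.single (h i) (γ i : ℕ)) p

/-- The monomials that occur have bounded total degree. -/
def HasBoundedDegree {R : Type*} [CommRing R] (p : MvPowerSeries ℕ R) : Prop :=
  ∃ N : ℕ, ∀ d : ℕ →₀ ℕ, N < d.degree → MvPowerSeries.coeff d p = 0

theorem exists_sum_single (d : ℕ →₀ ℕ) : ∃ (n : ℕ) (γ : Fin n → ℕ+) (s : Fin n → ℕ),
    StrictMono s ∧ d = ∑ i, Finsupp.single (s i) (γ i : ℕ) := by
  refine ⟨d.support.card, fun i => ⟨d (d.support.orderEmbOfFin rfl i), ?_⟩,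
    d.support.orderEmbOfFin rfl, OrderEmbedding.strictMono _, ?_⟩
  · exact Nat.pos_of_ne_zero (Finsupp.mem_support_iff.1 (Finset.orderEmbOfFin_mem _ _ _))
  · simp only [PNat.mk_coe]
    conv_lhs => rw [← Finsupp.sum_single d]
    rw [Finsupp.sum, ← Finset.sum_coe_sort d.support]
    exact (Fintype.sum_equiv (d.support.orderIsoOfFin rfl).toEquiv _ _ (fun i => rfl)).symm

theorem exists_extend {n : ℕ} (k : Fin n → ℕ) (hk : StrictMono k) :
    ∃ K : ℕ → ℕ, StrictMono K ∧ ∀ i : Fin n, K i = k i := by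
  refine ⟨fun j => if h : j < n then k ⟨j, h⟩ else (∑ i, k i) + j, ?_, fun i => by simp⟩
  intro a b hab
  dsimp only
  by_cases hb : b < n
  · rw [dif_pos (hab.trans hb), dif_pos hb]
    exact hk hab
  · rw [dif_neg hb]
    split_ifs with ha
    · have := Finset.single_le_sum (f := k) (fun i _ => Nat.zero_le _) (Finset.mem_univ ⟨a, ha⟩)
      omega
    · omega

/-- Reformulation through strictly increasing relabellings of all the variables. -/
theorem isQuasiSymmetric_iff (p : MvPowerSeries ℕ R) : IsQuasiSymmetric p ↔
    ∀ (K : ℕ → ℕ), StrictMono K → ∀ d : ℕ →₀ ℕ,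
      MvPowerSeries.coeff (d.mapDomain K) p = MvPowerSeries.coeff d p := by
  constructor
  · intro h K hK d
    obtain ⟨n, γ, s, hs, rfl⟩ := exists_sum_single d
    rw [Finsupp.mapDomain_finsetSum]
    simp only [Finsupp.mapDomain_single]
    exact h n γ (fun i => K (s i)) s (hK.comp hs) hs
  · intro h n γ k k' hk hk'
    obtain ⟨K, hK, e⟩ := exists_extend k hk
    obtain ⟨K', hK', e'⟩ := exists_extend k' hk'
    have h1 := h K hK (∑ i : Fin n, Finsupp.single (i : ℕ) (γ i : ℕ))
    have h2 := h K' hK' (∑ i : Fin n, Finsupp.single (i : ℕ) (γ i : ℕ))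
    rw [Finsupp.mapDomain_finsetSum] at h1 h2
    simp only [Finsupp.mapDomain_single, e, e'] at h1 h2
    rw [h1, h2]

theorem antidiagonal_mapDomain (K : ℕ → ℕ) (hK : Function.Injective K) (d : ℕ →₀ ℕ) :
    Finset.HasAntidiagonal.antidiagonal (d.mapDomain K) = (Finset.HasAntidiagonal.antidiagonal d).map
      ⟨Prod.map (Finsupp.mapDomain K) (Finsupp.mapDomain K),
        (Finsupp.mapDomain_injective hK).prodMap (Finsupp.mapDomain_injective hK)⟩ := by
  ext ⟨a, b⟩
  simp only [Finset.HasAntidiagonal.mem_antidiagonal, Finset.mem_map, Function.Embedding.coeFn_mk, Prod.exists,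
    Prod.map_apply, Prod.mk.injEq]
  constructor
  · intro h
    refine ⟨a.comapDomain K hK.injOn, b.comapDomain K hK.injOn, ?_, ?_, ?_⟩
    · ext i
      have := DFunLike.congr_fun h (K i)
      rw [Finsupp.mapDomain_apply hK] at this
      simpa using this
    · refine Finsupp.mapDomain_comapDomain K hK a ?_
      intro x hx
      by_contra hn
      have := DFunLike.congr_fun h x
      rw [Finsupp.mapDomain_of_notMem_range _ _ hn] at this
      simp at this hx
      omega
    · refine Finsupp.mapDomain_comapDomain K hK b ?_
      intro x hx
      by_contra hn
      have := DFunLike.congr_fun h x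
      rw [Finsupp.mapDomain_of_notMem_range _ _ hn] at this
      simp at this hx
      omega
  · rintro ⟨a, b, rfl, rfl, rfl⟩
    rw [Finsupp.mapDomain_add]

/-- The algebra of quasi-symmetric functions. -/
def QSym : Subalgebra R (MvPowerSeries ℕ R) where
  carrier := {p | HasBoundedDegree p ∧ IsQuasiSymmetric p}
  mul_mem' := by
    rintro p q ⟨⟨m, hm⟩, hp⟩ ⟨⟨n, hn⟩, hq⟩
    refine ⟨⟨m + n, fun d hd => ?_⟩, ?_⟩
    · rw [MvPowerSeries.coeff_mul]
      refine Finset.sum_eq_zero fun x hx => ?_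
      rw [Finset.HasAntidiagonal.mem_antidiagonal] at hx
      rw [← hx, map_add] at hd
      by_cases h : m < x.1.degree
      · rw [hm _ h, zero_mul]
      · rw [hn _ (by omega), mul_zero]
    · rw [isQuasiSymmetric_iff] at *
      intro K hK d
      rw [MvPowerSeries.coeff_mul, MvPowerSeries.coeff_mul, antidiagonal_mapDomain K hK.injective,
        Finset.sum_map]
      refine Finset.sum_congr rfl fun x _ => ?_
      simp [hp K hK, hq K hK]
  add_mem' := by
    rintro p q ⟨⟨m, hm⟩, hp⟩ ⟨⟨n, hn⟩, hq⟩
    refine ⟨⟨m + n, fun d hd => ?_⟩, fun N γ k h hk hh => ?_⟩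
    · rw [map_add, hm d (by omega), hn d (by omega), add_zero]
    · rw [map_add, map_add, hp N γ k h hk hh, hq N γ k h hk hh]
  algebraMap_mem' := by
    intro r
    have key : ∀ d : ℕ →₀ ℕ, MvPowerSeries.coeff d (algebraMap R (MvPowerSeries ℕ R) r) =
        if d = 0 then r else 0 := by
      intro d
      rw [MvPowerSeries.algebraMap_apply, MvPowerSeries.coeff_C]
      simp
    refine ⟨⟨0, fun d hd => ?_⟩, ?_⟩
    · rw [key, if_neg]
      rintro rfl
      simp at hd
    · rw [isQuasiSymmetric_iff]
      intro K hK d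
      rw [key, key]
      have h0 : d.mapDomain K = 0 ↔ d = 0 := by
        constructor
        · intro h
          exact Finsupp.mapDomain_injective hK.injective (h.trans Finsupp.mapDomain_zero.symm)
        · rintro rfl
          exact Finsupp.mapDomain_zero
      simp only [h0]

/-- `P f` depends only on the relative order of the values of `f`. -/
def OrderInvariant {ι : Type*} (P : (ι → ℕ) → Prop) : Prop :=
  ∀ f g : ι → ℕ, (∀ i j, f i ≤ f j ↔ g i ≤ g j) → (P f ↔ P g)

theorem genFun_mem {ι : Type*} [Fintype ι] (P : (ι → ℕ) → Prop) (hP : OrderInvariant P)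
    (w : ι → ℕ+) : genFun R P w ∈ (QSym R) := by
  refine ⟨⟨∑ i, (w i : ℕ), fun d hd => ?_⟩, ?_⟩
  · change ((Nat.card _ : ℕ) : R) = 0
    refine (congrArg Nat.cast (Nat.card_eq_zero.2 ?_)).trans Nat.cast_zero
    left
    refine ⟨fun f => ?_⟩
    have := congrArg Finsupp.degree f.2.2
    rw [map_sum] at this
    simp at this
    omega
  · rw [isQuasiSymmetric_iff]
    intro K hK d
    change ((Nat.card _ : ℕ) : R) = ((Nat.card _ : ℕ) : R)
    congr 1
    symm
    have hinv : ∀ f : ι → ℕ, P f ↔ P (fun i => K (f i)) := fun f =>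
      hP _ _ fun i j => hK.le_iff_le.symm
    have hsum : ∀ f : ι → ℕ, ∑ i, Finsupp.single (K (f i)) (w i : ℕ) =
        (∑ i, Finsupp.single (f i) (w i : ℕ)).mapDomain K := by
      intro f
      rw [Finsupp.mapDomain_finsetSum]
      simp only [Finsupp.mapDomain_single]
    refine Nat.card_congr (Equiv.ofBijective (fun f => ⟨fun i => K (f.1 i), (hinv _).1 f.2.1, ?_⟩)
      ⟨?_, ?_⟩)
    · rw [hsum, f.2.2]
    · intro f g hfg
      ext i
      exact hK.injective (congrFun (congrArg Subtype.val hfg) i)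
    · rintro ⟨f, hf, hd⟩
      have : ∀ i, ∃ j, K j = f i := by
        intro i
        by_contra hn
        have h0 := DFunLike.congr_fun hd (f i)
        rw [Finsupp.mapDomain_of_notMem_range _ _ (by simpa using hn), Finsupp.finsetSum_apply,
          Finset.sum_eq_zero_iff] at h0
        simpa using h0 i (Finset.mem_univ _)
      choose g hg using this
      have hfg : f = fun i => K (g i) := funext fun i => (hg i).symm
      refine ⟨⟨g, (hinv g).2 (hfg ▸ hf), ?_⟩, Subtype.ext hfg.symm⟩
      apply Finsupp.mapDomain_injective hK.injective
      rw [← hsum, ← hd, hfg]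

theorem orderInvariant_strictMono (n : ℕ) :
    OrderInvariant (fun f : Fin n → ℕ => StrictMono f) := by
  intro f g h
  constructor <;> intro hf a b hab <;> have := hf hab <;> have := h b a <;> grind

theorem orderInvariant_monotone (n : ℕ) :
    OrderInvariant (fun f : Fin n → ℕ => Monotone f) := by
  intro f g h
  constructor <;> intro hf a b hab
  · exact (h a b).1 (hf hab)
  · exact (h a b).2 (hf hab)

/-- The monomial quasi-symmetric function
`M_γ = ∑_{m_1 < ⋯ < m_n} t_{m_1}^{γ_1} ⋯ t_{m_n}^{γ_n}`; `M_γ = 1` for the empty word. -/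
def monomialQ (γ : List ℕ+) : (QSym R) :=
  ⟨genFun R (fun m : Fin γ.length → ℕ => StrictMono m) γ.get,
    genFun_mem R _ (orderInvariant_strictMono _) _⟩

/-- The essential quasi-symmetric function
`E_γ = ∑_{m_1 ≤ ⋯ ≤ m_n} t_{m_1}^{γ_1} ⋯ t_{m_n}^{γ_n}`; `E_γ = 1` for the empty word. -/
def essentialQ (γ : List ℕ+) : (QSym R) :=
  ⟨genFun R (fun m : Fin γ.length → ℕ => Monotone m) γ.get,
    genFun_mem R _ (orderInvariant_monotone _) _⟩

/-- The composition of the non-zero exponents of the monomial `t^d`, in the order of the variables. -/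
def flat (d : ℕ →₀ ℕ) : List ℕ+ := (d.support.sort).map fun i => (d i).toPNat'

/-- The exponent of `∏ t_a^w` over the pairs `(a, w)` in a list. -/
def monoOf (l : List (ℕ × ℕ+)) : ℕ →₀ ℕ := (l.map fun x => Finsupp.single x.1 (x.2 : ℕ)).sum

theorem monoOf_apply_eq_zero (l : List (ℕ × ℕ+)) (a : ℕ) (h : ∀ x ∈ l, a ≠ x.1) :
    monoOf l a = 0 := by
  induction l with
  | nil => rfl
  | cons x l ih =>
    simp only [List.mem_cons, forall_eq_or_imp] at h
    have h1 := ih h.2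
    unfold monoOf at h1 ⊢
    rw [List.map_cons, List.sum_cons, Finsupp.add_apply, h1,
      Finsupp.single_eq_of_ne h.1]

theorem flat_monoOf (l : List (ℕ × ℕ+)) (h : l.Pairwise fun x y => x.1 < y.1) :
    flat (monoOf l) = l.map Prod.snd := by
  induction l with
  | nil => simp [monoOf, flat]
  | cons x l ih =>
    rw [List.pairwise_cons] at h
    have ih := ih h.2
    have hz : monoOf l x.1 = 0 := monoOf_apply_eq_zero l x.1 fun y hy => (h.1 y hy).ne
    have hsplit : monoOf (x :: l) = Finsupp.single x.1 (x.2 : ℕ) + monoOf l := by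
      simp [monoOf]
    have hlt : ∀ b ∈ (monoOf l).support, x.1 < b := by
      intro b hb
      by_contra hn
      refine (Finsupp.mem_support_iff.1 hb) (monoOf_apply_eq_zero l b fun y hy => ?_)
      have := h.1 y hy
      omega
    have hsupp : (monoOf (x :: l)).support = insert x.1 (monoOf l).support := by
      ext b
      rw [hsplit]
      simp only [Finsupp.mem_support_iff, Finsupp.add_apply, Finset.mem_insert]
      by_cases hb : b = x.1
      · subst hb
        simp
      · rw [Finsupp.single_eq_of_ne hb]
        simp [hb]
    rw [flat, hsupp, Finset.sort_insert (h₁ := fun b hb => (hlt b hb).le)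
      (h₂ := by simp [hz]), List.map_cons, List.map_cons]
    congr 1
    · rw [hsplit, Finsupp.add_apply, hz]
      simp
    · rw [← ih, flat]
      refine List.map_congr_left fun b hb => ?_
      rw [Finset.mem_sort] at hb
      rw [hsplit, Finsupp.add_apply, Finsupp.single_eq_of_ne (hlt b hb).ne', zero_add]

theorem monoOf_ofFn {n : ℕ} (s : Fin n → ℕ) (γ : Fin n → ℕ+) :
    monoOf (List.ofFn fun i => (s i, γ i)) = ∑ i, Finsupp.single (s i) (γ i : ℕ) := by
  rw [monoOf, List.map_ofFn, List.sum_ofFn]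
  rfl

theorem flat_sum {n : ℕ} (s : Fin n → ℕ) (hs : StrictMono s) (γ : Fin n → ℕ+) :
    flat (∑ i, Finsupp.single (s i) (γ i : ℕ)) = List.ofFn γ := by
  rw [← monoOf_ofFn, flat_monoOf]
  · rw [List.map_ofFn]
    rfl
  · rw [List.pairwise_ofFn]
    exact fun i j hij => hs hij

theorem flat_eq_nil (d : ℕ →₀ ℕ) : flat d = [] ↔ d = 0 := by
  rw [flat, List.map_eq_nil_iff, ← List.length_eq_zero_iff, Finset.length_sort,
    Finset.card_eq_zero, Finsupp.support_eq_empty]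

theorem exists_monoOf (d : ℕ →₀ ℕ) : ∃ l : List (ℕ × ℕ+),
    (l.Pairwise fun x y => x.1 < y.1) ∧ d = monoOf l := by
  obtain ⟨n, γ, s, hs, rfl⟩ := exists_sum_single d
  refine ⟨List.ofFn fun i => (s i, γ i), ?_, (monoOf_ofFn s γ).symm⟩
  rw [List.pairwise_ofFn]
  exact fun i j hij => hs hij

/-- The exponent of the monomial `t_0^{γ_1} t_1^{γ_2} ⋯`. -/
def packed (γ : List ℕ+) : ℕ →₀ ℕ := ∑ i : Fin γ.length, Finsupp.single (i : ℕ) (γ.get i : ℕ)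

@[simp] theorem flat_packed (γ : List ℕ+) : flat (packed γ) = γ := by
  rw [packed, flat_sum (fun i : Fin γ.length => (i : ℕ)) Fin.val_strictMono, List.ofFn_get]

theorem packed_apply_of_le (γ : List ℕ+) (i : ℕ) (h : γ.length ≤ i) : packed γ i = 0 := by
  rw [packed, Finsupp.finsetSum_apply]
  exact Finset.sum_eq_zero fun j _ => Finsupp.single_eq_of_ne (by omega)

theorem degree_packed (γ : List ℕ+) : (packed γ).degree = (γ.map PNat.val).sum := by
  rw [packed, map_sum]
  simp only [Finsupp.degree_single]
  rw [← List.sum_ofFn]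
  congr 1
  conv_rhs => rw [← List.ofFn_get γ, List.map_ofFn]
  rfl

/-- The coefficient at `t^d`. -/
def cf (d : ℕ →₀ ℕ) : (QSym R) →ₗ[R] R := MvPowerSeries.coeff d ∘ₗ (QSym R).val.toLinearMap

theorem ext_cf {p q : QSym R} (h : ∀ d, cf R d p = cf R d q) : p = q :=
  Subtype.ext (MvPowerSeries.ext h)

theorem cf_packed (p : QSym R) (d : ℕ →₀ ℕ) : cf R (packed (flat d)) p = cf R d p := by
  obtain ⟨n, γ, s, hs, rfl⟩ := exists_sum_single d
  rw [flat_sum s hs]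
  have h1 : packed (List.ofFn γ) = ∑ i : Fin n, Finsupp.single (i : ℕ) (γ i : ℕ) := by
    rw [packed]
    exact Fintype.sum_equiv (finCongr (by simp)) _ _ (fun i => by simp [Fin.cast])
  rw [h1]
  exact p.2.2 n γ (fun i => (i : ℕ)) s Fin.val_strictMono hs

theorem cf_monomialQ (d : ℕ →₀ ℕ) (γ : List ℕ+) :
    cf R d (monomialQ R γ) = if flat d = γ then 1 else 0 := by
  change ((Nat.card _ : ℕ) : R) = _
  split_ifs with h
  · have hone : Nat.card {f : Fin γ.length → ℕ //
        StrictMono f ∧ ∑ i, Finsupp.single (f i) (γ.get i : ℕ) = d} = 1 := by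
      rw [Nat.card_eq_one_iff_unique]
      constructor
      · constructor
        rintro ⟨f, hf, hfd⟩ ⟨g, hg, hgd⟩
        have hsupp : ∀ (f : Fin γ.length → ℕ), StrictMono f →
            ∑ i, Finsupp.single (f i) (γ.get i : ℕ) = d → Set.range f = d.support := by
          rintro f hf rfl
          ext x
          simp only [Set.mem_range, Finset.mem_coe, Finsupp.mem_support_iff,
            Finsupp.finsetSum_apply, ne_eq, Finset.sum_eq_zero_iff, Finset.mem_univ, true_imp_iff,
            not_forall]
          constructor
          · rintro ⟨i, rfl⟩
            exact ⟨i, by simp⟩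
          · rintro ⟨i, hi⟩
            refine ⟨i, ?_⟩
            by_contra hne
            exact hi (Finsupp.single_eq_of_ne (Ne.symm hne))
        ext1
        exact (hf.range_inj hg).1 ((hsupp f hf hfd).trans (hsupp g hg hgd).symm)
      · obtain ⟨n, δ, s, hs, rfl⟩ := exists_sum_single d
        rw [flat_sum s hs] at h
        subst h
        refine ⟨⟨fun i => s (Fin.cast (by simp) i), fun i j hij => hs hij, ?_⟩⟩
        exact Fintype.sum_equiv (finCongr (by simp)) _ _ (fun i => by simp [Fin.cast])
    rw [hone, Nat.cast_one]
  · refine (congrArg Nat.cast (Nat.card_eq_zero.2 ?_)).trans Nat.cast_zero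
    left
    refine ⟨fun f => h ?_⟩
    rw [← f.2.2, flat_sum f.1 f.2.1, List.ofFn_get]

theorem finite_words (N : ℕ) : {γ : List ℕ+ | (γ.map PNat.val).sum ≤ N}.Finite := by
  refine (Set.finite_range (fun x : (Σ n : Fin (N + 1), Composition (n : ℕ)) =>
    x.2.blocks.map Nat.toPNat')).subset ?_
  intro γ hγ
  refine ⟨⟨⟨(γ.map PNat.val).sum, Nat.lt_succ_of_le hγ⟩,
    ⟨γ.map PNat.val, ?_, rfl⟩⟩, ?_⟩
  · intro i hi
    obtain ⟨x, -, rfl⟩ := List.mem_map.1 hi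
    exact x.2
  · simp only [List.map_map]
    conv_rhs => rw [← List.map_id γ]
    exact List.map_congr_left fun x _ => by simp

theorem cf_linearCombination (d : ℕ →₀ ℕ) (a : List ℕ+ →₀ R) :
    cf R d (Finsupp.linearCombination R (monomialQ R) a) = a (flat d) := by
  classical
  rw [Finsupp.linearCombination_apply, Finsupp.sum, map_sum]
  simp only [map_smul, cf_monomialQ, smul_eq_mul, mul_ite, mul_one, mul_zero]
  rw [Finset.sum_ite_eq]
  simp +contextual

theorem bijective_linearCombination :
    Function.Bijective (Finsupp.linearCombination R (monomialQ R)) := by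
  constructor
  · intro a b hab
    ext γ
    rw [← flat_packed γ, ← cf_linearCombination, ← cf_linearCombination, hab]
  · intro p
    obtain ⟨N, hN⟩ := p.2.1
    have hfin : (Function.support fun γ => cf R (packed γ) p).Finite := by
      refine (finite_words N).subset fun γ hγ => ?_
      by_contra hn
      refine hγ (hN _ ?_)
      rw [degree_packed]
      simpa using hn
    refine ⟨Finsupp.ofSupportFinite _ hfin, ext_cf R fun d => ?_⟩
    rw [cf_linearCombination, Finsupp.ofSupportFinite_coe, cf_packed]

/-- The basis of the `M_γ`. -/
def monomialBasis : Module.Basis (List ℕ+) R (QSym R) :=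
  .ofRepr (LinearEquiv.ofBijective _ (bijective_linearCombination R)).symm

@[simp] theorem monomialBasis_apply (γ : List ℕ+) : monomialBasis R γ = monomialQ R γ := by
  simp [monomialBasis]

theorem monomialBasis_repr (p : QSym R) (γ : List ℕ+) :
    (monomialBasis R).repr p γ = cf R (packed γ) p := by
  conv_rhs => rw [← (monomialBasis R).linearCombination_repr p]
  have : (⇑(monomialBasis R)) = monomialQ R := funext (monomialBasis_apply R)
  rw [this, cf_linearCombination, flat_packed]

/-- The deconcatenation `∑_{γ = αβ} M_α ⊗ M_β`. -/
def splits (γ : List ℕ+) : (QSym R) ⊗[R] (QSym R) :=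
  ∑ i ∈ Finset.range (γ.length + 1), monomialQ R (γ.take i) ⊗ₜ[R] monomialQ R (γ.drop i)

/-- The coproduct `Δ(M_γ) = ∑_{γ = αβ} M_α ⊗ M_β`. -/
def comulQ : (QSym R) →ₗ[R] (QSym R) ⊗[R] (QSym R) := (monomialBasis R).constr R (splits R)

/-- The counit: the constant term. -/
def counitQ : (QSym R) →ₗ[R] R := cf R 0

theorem comulQ_monomialQ (γ : List ℕ+) : comulQ R (monomialQ R γ) = splits R γ := by
  rw [← monomialBasis_apply, comulQ, Module.Basis.constr_basis]

theorem counitQ_monomialQ (γ : List ℕ+) : counitQ R (monomialQ R γ) = if γ = [] then 1 else 0 := by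
  rw [counitQ, cf_monomialQ]
  simp [flat, eq_comm]

theorem monomialQ_nil : monomialQ R [] = 1 := by
  refine ext_cf R fun d => ?_
  rw [cf_monomialQ]
  change _ = MvPowerSeries.coeff d 1
  rw [MvPowerSeries.coeff_one]
  simp only [flat_eq_nil]

theorem linearMap_ext {N : Type*} [AddCommMonoid N] [Module R N] {f g : (QSym R) →ₗ[R] N}
    (h : ∀ γ, f (monomialQ R γ) = g (monomialQ R γ)) : f = g :=
  (monomialBasis R).ext fun γ => by rw [monomialBasis_apply, h]

theorem coassocQ : (TensorProduct.assoc R (QSym R) (QSym R) (QSym R)).toLinearMap ∘ₗ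
    (comulQ R).rTensor (QSym R) ∘ₗ comulQ R = (comulQ R).lTensor (QSym R) ∘ₗ comulQ R := by
  refine linearMap_ext R fun γ => ?_
  simp only [LinearMap.comp_apply, comulQ_monomialQ, splits, map_sum, LinearMap.rTensor_tmul,
    LinearMap.lTensor_tmul, TensorProduct.sum_tmul, TensorProduct.tmul_sum,
    LinearEquiv.coe_coe, TensorProduct.assoc_tmul]
  rw [Finset.sum_sigma', Finset.sum_sigma']
  refine Finset.sum_bij' (fun x _ => ⟨x.2, x.1 - x.2⟩) (fun x _ => ⟨x.1 + x.2, x.1⟩) ?_ ?_ ?_ ?_ ?_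
  · rintro ⟨i, j⟩ h
    simp at h ⊢
    omega
  · rintro ⟨i, j⟩ h
    simp at h ⊢
    omega
  · rintro ⟨i, j⟩ h
    simp at h ⊢
    omega
  · rintro ⟨i, j⟩ h
    simp at h ⊢
  · rintro ⟨i, j⟩ h
    simp at h
    simp only [List.take_take, List.drop_drop, List.drop_take]
    rw [min_eq_left (by omega), Nat.add_sub_cancel' (by omega)]

theorem rTensor_counitQ : (counitQ R).rTensor (QSym R) ∘ₗ comulQ R = TensorProduct.mk R R (QSym R) 1 := by
  refine linearMap_ext R fun γ => ?_
  simp only [LinearMap.comp_apply, comulQ_monomialQ, splits, map_sum, LinearMap.rTensor_tmul,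
    counitQ_monomialQ, TensorProduct.mk_apply]
  rw [Finset.sum_eq_single 0]
  · simp
  · intro i hi h0
    simp at hi
    rw [if_neg, TensorProduct.zero_tmul]
    rw [List.take_eq_nil_iff]
    rintro (h | rfl)
    · exact h0 h
    · simp at hi
      omega
  · simp

theorem lTensor_counitQ : (counitQ R).lTensor (QSym R) ∘ₗ comulQ R = (TensorProduct.mk R (QSym R) R).flip 1 := by
  refine linearMap_ext R fun γ => ?_
  simp only [LinearMap.comp_apply, comulQ_monomialQ, splits, map_sum, LinearMap.lTensor_tmul,
    counitQ_monomialQ, LinearMap.flip_apply, TensorProduct.mk_apply]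
  rw [Finset.sum_eq_single γ.length]
  · simp
  · intro i hi h0
    simp at hi
    rw [if_neg, TensorProduct.tmul_zero]
    rw [List.drop_eq_nil_iff]
    omega
  · simp

instance : Coalgebra R (QSym R) where
  comul := comulQ R
  counit := counitQ R
  coassoc := coassocQ R
  rTensor_counit_comp_comul := rTensor_counitQ R
  lTensor_counit_comp_comul := lTensor_counitQ R


/-- The exponent with entries `u` at the first `n` variables, followed by the entries of `v`. -/
def cat (n : ℕ) (u v : ℕ →₀ ℕ) : ℕ →₀ ℕ :=
  Finsupp.onFinset (Finset.range n ∪ v.support.image fun i => n + i)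
    (fun i => if i < n then u i else v (i - n)) (by
      intro i hi
      rw [Finset.mem_union, Finset.mem_range, Finset.mem_image]
      by_cases h : i < n
      · exact Or.inl h
      · rw [if_neg h] at hi
        exact Or.inr ⟨i - n, Finsupp.mem_support_iff.2 hi, by omega⟩)

theorem cat_apply (n : ℕ) (u v : ℕ →₀ ℕ) (i : ℕ) :
    cat n u v i = if i < n then u i else v (i - n) := rfl

theorem flat_cat (n : ℕ) (u v : ℕ →₀ ℕ) (hu : ∀ i, n ≤ i → u i = 0) :
    flat (cat n u v) = flat u ++ flat v := by
  obtain ⟨l, hl, rfl⟩ := exists_monoOf u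
  obtain ⟨m, hm, rfl⟩ := exists_monoOf v
  have hlt : ∀ x ∈ l, x.1 < n := by
    intro x hx
    by_contra hn
    have h0 := hu x.1 (by omega)
    have hle : ∀ l : List (ℕ × ℕ+), x ∈ l → monoOf l x.1 ≠ 0 := by
      intro l
      induction l with
      | nil => simp
      | cons y l ih =>
        intro hy
        have hsplit : monoOf (y :: l) = Finsupp.single y.1 (y.2 : ℕ) + monoOf l := by
          simp [monoOf]
        rw [hsplit, Finsupp.add_apply]
        rcases List.mem_cons.1 hy with rfl | hy
        · simp
        · have := ih hy
          omega
    exact hle l hx h0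
  have hcat : cat n (monoOf l) (monoOf m) =
      monoOf (l ++ m.map fun x => (n + x.1, x.2)) := by
    have happ : monoOf (l ++ m.map fun x => (n + x.1, x.2)) =
        monoOf l + (monoOf m).mapDomain (fun i => n + i) := by
      have hmap : monoOf (m.map fun x => (n + x.1, x.2)) =
          (monoOf m).mapDomain (fun i => n + i) := by
        clear hm
        induction m with
        | nil => simp [monoOf]
        | cons y m ih =>
          have h1 : monoOf (y :: m) = Finsupp.single y.1 (y.2 : ℕ) + monoOf m := by
            simp [monoOf]
          rw [h1, Finsupp.mapDomain_add, ← ih, Finsupp.mapDomain_single]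
          simp [monoOf]
      rw [← hmap]
      simp [monoOf]
    ext i
    rw [happ, cat_apply, Finsupp.add_apply]
    have hinj : Function.Injective fun i : ℕ => n + i := fun a b h => by simpa using h
    split_ifs with h
    · rw [Finsupp.mapDomain_of_notMem_range _ _ (by simp; omega), add_zero]
    · rw [hu i (by omega), zero_add]
      conv_rhs => rw [show i = n + (i - n) by omega]
      exact (Finsupp.mapDomain_apply hinj _ _).symm
  rw [hcat, flat_monoOf, flat_monoOf l hl, flat_monoOf m hm, List.map_append, List.map_map]
  · rfl
  · rw [List.pairwise_append]
    refine ⟨hl, ?_, ?_⟩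
    · rw [List.pairwise_map]
      exact hm.imp fun h => by simpa using h
    · intro x hx y hy
      obtain ⟨z, -, rfl⟩ := List.mem_map.1 hy
      have := hlt x hx
      simp only
      omega

theorem sum_antidiagonal_cat {M : Type*} [AddCommMonoid M] (n : ℕ) (u v : ℕ →₀ ℕ)
    (hu : ∀ i, n ≤ i → u i = 0) (F : (ℕ →₀ ℕ) → (ℕ →₀ ℕ) → M) :
    ∑ x ∈ Finset.HasAntidiagonal.antidiagonal (cat n u v), F x.1 x.2 =
      ∑ x ∈ Finset.HasAntidiagonal.antidiagonal u, ∑ y ∈ Finset.HasAntidiagonal.antidiagonal v,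
        F (cat n x.1 y.1) (cat n x.2 y.2) := by
  have hinj : Function.Injective fun i : ℕ => n + i := fun a b h => by simpa using h
  rw [← Finset.sum_product']
  symm
  refine Finset.sum_bij' (fun z _ => (cat n z.1.1 z.2.1, cat n z.1.2 z.2.2))
    (fun z _ => ((z.1.filter (· < n), z.2.filter (· < n)),
      (z.1.comapDomain (fun i => n + i) hinj.injOn, z.2.comapDomain (fun i => n + i) hinj.injOn)))
    ?_ ?_ ?_ ?_ ?_
  · rintro ⟨⟨a, b⟩, ⟨c, d⟩⟩ h
    simp only [Finset.mem_product, Finset.HasAntidiagonal.mem_antidiagonal] at h ⊢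
    obtain ⟨rfl, rfl⟩ := h
    ext i
    simp only [Finsupp.add_apply, cat_apply]
    split_ifs <;> rfl
  · rintro ⟨a, b⟩ h
    simp only [Finset.mem_product, Finset.HasAntidiagonal.mem_antidiagonal] at h ⊢
    constructor
    · ext i
      have := DFunLike.congr_fun h i
      rw [Finsupp.add_apply, cat_apply] at this
      rw [Finsupp.add_apply, Finsupp.filter_apply, Finsupp.filter_apply]
      by_cases hi : i < n
      · simpa [hi] using this
      · simp [hi, hu i (by omega)]
    · ext i
      have := DFunLike.congr_fun h (n + i)
      rw [Finsupp.add_apply, cat_apply] at this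
      simpa using this
  · rintro ⟨⟨a, b⟩, ⟨c, d⟩⟩ h
    simp only [Finset.mem_product, Finset.HasAntidiagonal.mem_antidiagonal] at h
    have hab : ∀ i, n ≤ i → a i = 0 ∧ b i = 0 := by
      intro i hi
      have := hu i hi
      rw [← h.1, Finsupp.add_apply] at this
      omega
    simp only [Prod.mk.injEq]
    refine ⟨⟨?_, ?_⟩, ?_, ?_⟩
    · ext i
      rw [Finsupp.filter_apply, cat_apply]
      split_ifs with hi
      · rfl
      · exact (hab i (by omega)).1.symm
    · ext i
      rw [Finsupp.filter_apply, cat_apply]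
      split_ifs with hi
      · rfl
      · exact (hab i (by omega)).2.symm
    · ext i
      simp [cat_apply]
    · ext i
      simp [cat_apply]
  · rintro ⟨a, b⟩ h
    simp only [Prod.mk.injEq]
    constructor
    · ext i
      rw [cat_apply, Finsupp.filter_apply]
      split_ifs with hi
      · rfl
      · simp [show n + (i - n) = i by omega]
    · ext i
      rw [cat_apply, Finsupp.filter_apply]
      split_ifs with hi
      · rfl
      · simp [show n + (i - n) = i by omega]
  · rintro ⟨⟨a, b⟩, ⟨c, d⟩⟩ h
    rfl

/-- The coefficient at `t^u ⊗ t^v`. -/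
def cf2 (u v : ℕ →₀ ℕ) : (QSym R) ⊗[R] (QSym R) →ₗ[R] R :=
  LinearMap.mul' R R ∘ₗ TensorProduct.map (cf R u) (cf R v)

@[simp] theorem cf2_tmul (u v : ℕ →₀ ℕ) (p q : QSym R) :
    cf2 R u v (p ⊗ₜ q) = cf R u p * cf R v q := rfl

theorem ext_cf2 {x y : (QSym R) ⊗[R] QSym R}
    (h : ∀ α β : List ℕ+, cf2 R (packed α) (packed β) x = cf2 R (packed α) (packed β) y) :
    x = y := by
  have key : ∀ (z : (QSym R) ⊗[R] QSym R) (α β : List ℕ+),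
      ((monomialBasis R).tensorProduct (monomialBasis R)).repr z (α, β) =
        cf2 R (packed α) (packed β) z := by
    intro z α β
    induction z using TensorProduct.induction_on with
    | zero => simp
    | tmul p q =>
      rw [Module.Basis.tensorProduct_repr_tmul_apply, monomialBasis_repr, monomialBasis_repr,
        cf2_tmul, smul_eq_mul, mul_comm]
    | add a b ha hb => rw [map_add, map_add, Finsupp.add_apply, ha, hb]
  refine ((monomialBasis R).tensorProduct (monomialBasis R)).ext_elem ?_
  rintro ⟨α, β⟩
  rw [key, key, h]

theorem cf_mul (d : ℕ →₀ ℕ) (p q : QSym R) :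
    cf R d (p * q) = ∑ x ∈ Finset.HasAntidiagonal.antidiagonal d, cf R x.1 p * cf R x.2 q :=
  MvPowerSeries.coeff_mul d p.1 q.1

theorem cf2_mul (u v : ℕ →₀ ℕ) (x y : (QSym R) ⊗[R] QSym R) :
    cf2 R u v (x * y) = ∑ a ∈ Finset.HasAntidiagonal.antidiagonal u,
      ∑ b ∈ Finset.HasAntidiagonal.antidiagonal v, cf2 R a.1 b.1 x * cf2 R a.2 b.2 y := by
  induction x using TensorProduct.induction_on with
  | zero => simp
  | add x x' hx hx' => simp only [add_mul, map_add, hx, hx', Finset.sum_add_distrib]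
  | tmul p q =>
    induction y using TensorProduct.induction_on with
    | zero => simp
    | add x x' hx hx' => simp only [mul_add, map_add, hx, hx', Finset.sum_add_distrib]
    | tmul p' q' =>
      rw [Algebra.TensorProduct.tmul_mul_tmul, cf2_tmul, cf_mul, cf_mul, Finset.sum_mul_sum]
      simp only [cf2_tmul]
      exact Finset.sum_congr rfl fun a _ => Finset.sum_congr rfl fun b _ => by ring

theorem cf2_comulQ (n : ℕ) (u v : ℕ →₀ ℕ) (hu : ∀ i, n ≤ i → u i = 0) (p : QSym R) :
    cf2 R u v (comulQ R p) = cf R (cat n u v) p := by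
  suffices h : cf2 R u v ∘ₗ comulQ R = cf R (cat n u v) from LinearMap.congr_fun h p
  refine linearMap_ext R fun γ => ?_
  rw [LinearMap.comp_apply, comulQ_monomialQ, splits, map_sum, cf_monomialQ, flat_cat n u v hu]
  simp only [cf2_tmul, cf_monomialQ]
  split_ifs with h
  · subst h
    rw [Finset.sum_eq_single (flat u).length]
    · simp
    · intro i hi h0
      rw [if_neg, zero_mul]
      intro h
      have := congrArg List.length h
      simp at this hi
      omega
    · simp
  · refine Finset.sum_eq_zero fun i _ => ?_
    by_cases h1 : flat u = γ.take i
    · have h2 : flat v ≠ γ.drop i := fun h2 => h (by rw [h1, h2, List.take_append_drop])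
      rw [if_neg h2, mul_zero]
    · rw [if_neg h1, zero_mul]

theorem comulQ_mul (p q : QSym R) : comulQ R (p * q) = comulQ R p * comulQ R q := by
  refine ext_cf2 R fun α β => ?_
  have hα := packed_apply_of_le α
  rw [cf2_comulQ R _ _ _ hα, cf_mul, cf2_mul,
    sum_antidiagonal_cat _ _ _ hα (fun a b => cf R a p * cf R b q)]
  refine Finset.sum_congr rfl fun a ha => Finset.sum_congr rfl fun b _ => ?_
  rw [Finset.HasAntidiagonal.mem_antidiagonal] at ha
  have h0 : ∀ i, α.length ≤ i → a.1 i = 0 ∧ a.2 i = 0 := by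
    intro i hi
    have := hα i hi
    rw [← ha, Finsupp.add_apply] at this
    omega
  rw [cf2_comulQ R _ _ _ fun i hi => (h0 i hi).1, cf2_comulQ R _ _ _ fun i hi => (h0 i hi).2]

theorem comulQ_one : comulQ R 1 = 1 := by
  rw [← monomialQ_nil, comulQ_monomialQ, splits]
  simp [monomialQ_nil, Algebra.TensorProduct.one_def]

theorem counitQ_mul (p q : QSym R) : counitQ R (p * q) = counitQ R p * counitQ R q := by
  rw [counitQ, cf_mul]
  simp

theorem counitQ_one : counitQ R 1 = 1 := by
  rw [← monomialQ_nil, counitQ_monomialQ, if_pos rfl]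

instance : Bialgebra R (QSym R) :=
  Bialgebra.mk' R (QSym R) (counitQ_one R) (fun {p q} => counitQ_mul R p q) (comulQ_one R)
    (fun {p q} => comulQ_mul R p q)

/-- Values at `M_γ` of the left convolution inverse of the identity, by recursion on the length. -/
def leftWord (γ : List ℕ+) : QSym R :=
  if γ = [] then 1
  else -∑ i : Fin γ.length, leftWord (γ.take i) * monomialQ R (γ.drop i)
  termination_by γ.length
  decreasing_by simp

/-- Values at `M_γ` of the right convolution inverse of the identity. -/
def rightWord (γ : List ℕ+) : QSym R :=
  if γ = [] then 1
  else -∑ i : Fin γ.length, monomialQ R (γ.take (i + 1)) * rightWord (γ.drop (i + 1))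
  termination_by γ.length
  decreasing_by
    have := i.2
    rw [List.length_drop]
    omega

/-- The antipode: the convolution inverse of the identity. -/
def antipodeQ : QSym R →ₗ[R] QSym R := (monomialBasis R).constr R (leftWord R)

/-- The right convolution inverse of the identity. -/
def coantipodeQ : QSym R →ₗ[R] QSym R := (monomialBasis R).constr R (rightWord R)

theorem antipodeQ_monomialQ (γ : List ℕ+) : antipodeQ R (monomialQ R γ) = leftWord R γ := by
  rw [← monomialBasis_apply, antipodeQ, Module.Basis.constr_basis]

theorem coantipodeQ_monomialQ (γ : List ℕ+) : coantipodeQ R (monomialQ R γ) = rightWord R γ := by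
  rw [← monomialBasis_apply, coantipodeQ, Module.Basis.constr_basis]

theorem antipodeQ_left : LinearMap.mul' R (QSym R) ∘ₗ
    TensorProduct.map (antipodeQ R) LinearMap.id ∘ₗ comulQ R =
      Algebra.linearMap R (QSym R) ∘ₗ counitQ R := by
  refine linearMap_ext R fun γ => ?_
  simp only [LinearMap.comp_apply, comulQ_monomialQ, counitQ_monomialQ, splits, map_sum,
    TensorProduct.map_tmul, LinearMap.mul'_apply, antipodeQ_monomialQ, LinearMap.id_apply]
  rw [Finset.sum_range_succ, ← Fin.sum_univ_eq_sum_range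
    (fun i => leftWord R (γ.take i) * monomialQ R (γ.drop i))]
  by_cases h : γ = []
  · subst h
    rw [leftWord]
    simp [monomialQ_nil]
  · rw [if_neg h, List.take_length, List.drop_length, monomialQ_nil, mul_one, map_zero]
    have := leftWord.eq_1 R γ
    rw [if_neg h] at this
    rw [this]
    exact add_neg_cancel _

theorem coantipodeQ_right : LinearMap.mul' R (QSym R) ∘ₗ
    TensorProduct.map LinearMap.id (coantipodeQ R) ∘ₗ comulQ R =
      Algebra.linearMap R (QSym R) ∘ₗ counitQ R := by
  refine linearMap_ext R fun γ => ?_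
  simp only [LinearMap.comp_apply, comulQ_monomialQ, counitQ_monomialQ, splits, map_sum,
    TensorProduct.map_tmul, LinearMap.mul'_apply, coantipodeQ_monomialQ, LinearMap.id_apply]
  rw [Finset.sum_range_succ', ← Fin.sum_univ_eq_sum_range
    (fun i => monomialQ R (γ.take (i + 1)) * rightWord R (γ.drop (i + 1)))]
  by_cases h : γ = []
  · subst h
    rw [rightWord]
    simp [monomialQ_nil]
  · rw [if_neg h, List.take_zero, List.drop_zero, monomialQ_nil, one_mul, map_zero]
    have := rightWord.eq_1 R γ
    rw [if_neg h] at this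
    rw [this]
    exact add_neg_cancel _

theorem antipodeQ_eq : antipodeQ R = coantipodeQ R := by
  have h1 : WithConv.toConv (antipodeQ R) * WithConv.toConv LinearMap.id = 1 :=
    congrArg WithConv.toConv (antipodeQ_left R)
  have h2 : WithConv.toConv LinearMap.id * WithConv.toConv (coantipodeQ R) = 1 :=
    congrArg WithConv.toConv (coantipodeQ_right R)
  exact WithConv.toConv_injective (left_inv_eq_right_inv h1 h2)

instance : HopfAlgebra R (QSym R) where
  antipode := antipodeQ R
  mul_antipode_rTensor_comul := antipodeQ_left R
  mul_antipode_lTensor_comul := by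
    rw [antipodeQ_eq]
    exact coantipodeQ_right R


/-- A skew Young diagram `λ/μ`, with `outer = λ` and `inner = μ`. As in Mathlib, boxes are pairs
`(i, j)` (row, column) counted from `0`. -/
structure SkewDiagram where
  outer : YoungDiagram
  inner : YoungDiagram
  le : inner ≤ outer

namespace SkewDiagram

variable (ν : SkewDiagram)

/-- The set of boxes `D(λ/μ)`. -/
def cells : Finset (ℕ × ℕ) := ν.outer.cells \ ν.inner.cells

/-- The weight `|λ/μ|`. -/
def size : ℕ := ν.cells.card

/-- The boxes of `λ/μ`, as a type. -/
abbrev Box : Type := {u : ℕ × ℕ // u ∈ ν.cells}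

/-- `T(λ/μ, X)`: fillings of the boxes of `λ/μ` by elements of `X`. -/
abbrev Tableau (X : Type*) : Type _ := ν.Box → X

variable {ν}

/-- `T^diag(λ/μ, X)`: tableaux that are constant on every diagonal `j - i = const`. -/
def IsDiagonal {X : Type*} (T : ν.Tableau X) : Prop :=
  ∀ u v : ν.Box, (u.1.2 : ℤ) - u.1.1 = (v.1.2 : ℤ) - v.1.1 → T u = T v

/-- Semi-standard: rows weakly increase from left to right, columns strictly increase from top to
bottom. -/
def IsSemistandard (T : ν.Tableau ℕ) : Prop :=
  (∀ u v : ν.Box, u.1.1 = v.1.1 → u.1.2 < v.1.2 → T u ≤ T v) ∧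
    ∀ u v : ν.Box, u.1.2 = v.1.2 → u.1.1 < v.1.1 → T u < T v

theorem orderInvariant_isSemistandard :
    OrderInvariant (fun T : ν.Box → ℕ => IsSemistandard T) := by
  intro f g h
  have hlt : ∀ i j, f i < f j ↔ g i < g j := fun i j => by
    rw [← not_le, ← not_le, h]
  simp only [IsSemistandard, h, hlt]

variable (ν)

/-- The number `r` of rows of `λ`. -/
def numRows : ℕ := ν.outer.colLen 0

/-- The number `s` of columns of `λ`. -/
def numCols : ℕ := ν.outer.rowLen 0

/-- Reflection in the anti-diagonal of the `r × s` rectangle around `λ`, read as a map from the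
boxes of the `s × r` rectangle to those of the `r × s` rectangle. -/
def reflect (u : ℕ × ℕ) : ℕ × ℕ := (ν.numRows - 1 - u.2, ν.numCols - 1 - u.1)

/-- The boxes of the `s × r` rectangle whose reflections lie outside `κ`. -/
def reflectCompl (κ : YoungDiagram) : YoungDiagram where
  cells := {u ∈ Finset.range ν.numCols ×ˢ Finset.range ν.numRows | ν.reflect u ∉ κ.cells}
  isLowerSet := by
    rintro ⟨a, b⟩ ⟨c, d⟩ hle h
    obtain ⟨hca, hdb⟩ : c ≤ a ∧ d ≤ b := hle
    rw [Finset.mem_coe, Finset.mem_filter, Finset.mem_product, Finset.mem_range,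
      Finset.mem_range] at h ⊢
    obtain ⟨⟨h1, h2⟩, h3⟩ := h
    refine ⟨⟨lt_of_le_of_lt hca h1, lt_of_le_of_lt hdb h2⟩, fun hm => h3 ?_⟩
    exact κ.isLowerSet (Prod.mk_le_mk.2 ⟨Nat.sub_le_sub_left hdb _, Nat.sub_le_sub_left hca _⟩) hm

theorem mem_reflectCompl {κ : YoungDiagram} {u : ℕ × ℕ} : u ∈ (ν.reflectCompl κ).cells ↔
    (u.1 < ν.numCols ∧ u.2 < ν.numRows) ∧ ν.reflect u ∉ κ.cells := by
  rw [reflectCompl, Finset.mem_filter, Finset.mem_product, Finset.mem_range, Finset.mem_range]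

/-- The anti-diagonal transpose `ν^#`. -/
def antiTranspose : SkewDiagram where
  outer := ν.reflectCompl ν.inner
  inner := ν.reflectCompl ν.outer
  le := by
    intro u hu
    rw [← YoungDiagram.mem_cells, mem_reflectCompl] at hu ⊢
    exact ⟨hu.1, fun h => hu.2 (ν.le h)⟩

theorem reflect_mem {u : ℕ × ℕ} (hu : u ∈ ν.antiTranspose.cells) : ν.reflect u ∈ ν.cells := by
  simp only [cells, antiTranspose, Finset.mem_sdiff, mem_reflectCompl] at hu ⊢
  tauto

variable {ν}

/-- The anti-diagonal transpose `T^# ∈ T(ν^#, X)` of a tableau `T ∈ T(ν, X)`. -/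
def Tableau.antiTranspose {X : Type*} (T : ν.Tableau X) : ν.antiTranspose.Tableau X :=
  fun u => T ⟨ν.reflect u.1, ν.reflect_mem u.2⟩

/-- The boxes in the plane of a set of boxes of `ν`. -/
def boxes (θ : Finset ν.Box) : Finset (ℕ × ℕ) := θ.map (Function.Embedding.subtype _)

/-- Two boxes of the plane share an edge. -/
def Adjacent (u v : ℕ × ℕ) : Prop :=
  (u.1 = v.1 ∧ (u.2 + 1 = v.2 ∨ v.2 + 1 = u.2)) ∨ (u.2 = v.2 ∧ (u.1 + 1 = v.1 ∨ v.1 + 1 = u.1))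

/-- A (non-empty) ribbon: a connected skew Young diagram without `2 × 2` block of boxes. -/
structure IsRibbon (θ : Finset (ℕ × ℕ)) : Prop where
  isSkew : ∃ κ : SkewDiagram, κ.cells = θ
  nonempty : θ.Nonempty
  connected : ∀ u ∈ θ, ∀ v ∈ θ,
    Relation.ReflTransGen (fun a b => Adjacent a b ∧ a ∈ θ ∧ b ∈ θ) u v
  no_block : ∀ i j : ℕ, ¬ ((i, j) ∈ θ ∧ (i + 1, j) ∈ θ ∧ (i, j + 1) ∈ θ ∧ (i + 1, j + 1) ∈ θ)

/-- A rim decomposition `Θ = (θ_1, …, θ_t)` of `ν = λ/μ`, where `θ_k = ∅` is permitted: every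
non-empty `θ_k` is a ribbon, the `θ_k` are disjoint with union `ν`, and gluing
`θ_1, …, θ_k` to `μ` gives a Young diagram for every `k`. -/
structure IsRimDecomposition {t : ℕ} (Θ : Fin t → Finset ν.Box) : Prop where
  ribbon : ∀ k, (Θ k).Nonempty → IsRibbon (boxes (Θ k))
  disjoint : ∀ k l, k ≠ l → Disjoint (Θ k) (Θ l)
  cover : ∀ u : ν.Box, ∃ k, u ∈ Θ k
  partition : ∀ k : Fin t, IsLowerSet
    {u : ℕ × ℕ | u ∈ ν.inner.cells ∨ ∃ l ≤ k, u ∈ boxes (Θ l)}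

/-- `u` is the bottom left box of `θ`. -/
def IsBottomLeft (θ : Finset (ℕ × ℕ)) (u : ℕ × ℕ) : Prop :=
  u ∈ θ ∧ ∀ v ∈ θ, v.1 ≤ u.1 ∧ u.2 ≤ v.2

/-- `u` is the top right box of `θ`. -/
def IsTopRight (θ : Finset (ℕ × ℕ)) (u : ℕ × ℕ) : Prop :=
  u ∈ θ ∧ ∀ v ∈ θ, u.1 ≤ v.1 ∧ v.2 ≤ u.2

variable (ν)

open Classical in
/-- `Rim_H^ν`: rim decompositions `(θ_1, …, θ_r)`, one ribbon for each row of `λ`, such that every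
non-empty `θ_i` starts (at its bottom left end) from the leftmost box `(i, μ_i + 1)` of `λ/μ` in
row `i`, which is `(i, μ_i)` when counting from `0`. -/
def rimH : Finset (Fin ν.numRows → Finset ν.Box) :=
  {Θ | IsRimDecomposition Θ ∧
    ∀ i, (Θ i).Nonempty → IsBottomLeft (boxes (Θ i)) (i, ν.inner.rowLen i)}

open Classical in
/-- `Rim_E^ν`: rim decompositions `(θ_1, …, θ_s)`, one ribbon for each column of `λ`, such that
every non-empty `θ_i` starts (at its top right end) from the topmost box `(μ'_i + 1, i)` of `λ/μ`
in column `i`. -/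
def rimE : Finset (Fin ν.numCols → Finset ν.Box) :=
  {Θ | IsRimDecomposition Θ ∧
    ∀ i, (Θ i).Nonempty → IsTopRight (boxes (Θ i)) (ν.inner.colLen i, i)}

variable {ν}

/-- `σ` is the type of the `H`-patterns attached to `Θ`. The `i`-th path of such a pattern of type
`σ` runs from abscissa `r + 1 - i + μ_i` to abscissa `r + 1 - σ(i) + λ_{σ(i)}` by unit steps to the
right or up, and it has `|θ_i|` steps to the right. -/
def IsTypeH (Θ : Fin ν.numRows → Finset ν.Box) (σ : Equiv.Perm (Fin ν.numRows)) : Prop :=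
  ∀ i : Fin ν.numRows, ((ν.numRows : ℤ) - i + ν.inner.rowLen i) + (Θ i).card =
    (ν.numRows : ℤ) - σ i + ν.outer.rowLen (σ i)

/-- `σ` is the type of the `E`-patterns attached to `Θ`. The `i`-th path of such a pattern of type
`σ` runs from abscissa `s + 1 - i + μ'_i` to abscissa `s + 1 - σ(i) + λ'_{σ(i)}` by unit steps to
the northeast or up, and it has `|θ_i|` steps to the northeast. -/
def IsTypeE (Θ : Fin ν.numCols → Finset ν.Box) (σ : Equiv.Perm (Fin ν.numCols)) : Prop :=
  ∀ i : Fin ν.numCols, ((ν.numCols : ℤ) - i + ν.inner.colLen i) + (Θ i).card =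
    (ν.numCols : ℤ) - σ i + ν.outer.colLen (σ i)

theorem IsTypeH.unique {Θ : Fin ν.numRows → Finset ν.Box} {σ τ : Equiv.Perm (Fin ν.numRows)}
    (hσ : IsTypeH Θ σ) (hτ : IsTypeH Θ τ) : σ = τ := by
  ext i
  have h1 := hσ i
  have h2 := hτ i
  rcases lt_trichotomy (σ i : ℕ) (τ i) with h | h | h
  · have := ν.outer.rowLen_anti _ _ h.le
    omega
  · exact h
  · have := ν.outer.rowLen_anti _ _ h.le
    omega

theorem IsTypeE.unique {Θ : Fin ν.numCols → Finset ν.Box} {σ τ : Equiv.Perm (Fin ν.numCols)}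
    (hσ : IsTypeE Θ σ) (hτ : IsTypeE Θ τ) : σ = τ := by
  ext i
  have h1 := hσ i
  have h2 := hτ i
  rcases lt_trichotomy (σ i : ℕ) (τ i) with h | h | h
  · have := ν.outer.colLen_anti _ _ h.le
    omega
  · exact h
  · have := ν.outer.colLen_anti _ _ h.le
    omega

/-- `ε_H(Θ)`: the signature of the (unique) type `τ_H(Θ)` of `Θ`. -/
def signH (Θ : Fin ν.numRows → Finset ν.Box) : ℤ :=
  Equiv.Perm.sign (Classical.epsilon (IsTypeH Θ))

/-- `ε_E(Θ)`: the signature of the (unique) type `τ_E(Θ)` of `Θ`. -/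
def signE (Θ : Fin ν.numCols → Finset ν.Box) : ℤ :=
  Equiv.Perm.sign (Classical.epsilon (IsTypeE Θ))

/-- The reading order: from the bottom row to the top row, and from left to right in each row. On a
ribbon this goes along the ribbon from its bottom left end to its top right end. -/
def readLE (u v : ν.Box) : Prop := v.1.1 < u.1.1 ∨ (u.1.1 = v.1.1 ∧ u.1.2 ≤ v.1.2)

instance : DecidableRel (readLE (ν := ν)) := fun _ _ => inferInstanceAs (Decidable (_ ∨ _))

instance : IsTrans ν.Box readLE := ⟨fun a b c h h' => by unfold readLE at *; omega⟩

instance : Std.Antisymm (readLE (ν := ν)) :=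
  ⟨fun a b h h' => Subtype.ext (Prod.ext (by unfold readLE at *; omega)
    (by unfold readLE at *; omega))⟩

instance : Std.Total (readLE (ν := ν)) := ⟨fun a b => by unfold readLE; omega⟩

/-- The word `θ(γ)` read from the bottom left to the top right (used for `H`-rim decompositions). -/
def wordH (θ : Finset ν.Box) (γ : ν.Tableau ℕ+) : List ℕ+ := (θ.sort readLE).map γ

/-- The word `θ(γ)` read from the top right to the bottom left (used for `E`-rim decompositions). -/
def wordE (θ : Finset ν.Box) (γ : ν.Tableau ℕ+) : List ℕ+ := (wordH θ γ).reverse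

/-- The Schur type quasi-symmetric function `S_{λ/μ}(γ)`, the sum of `∏ t_{m_{ij}}^{γ_{ij}}` over
all semi-standard tableaux `(m_{ij})` of shape `λ/μ`. -/
def schurQ (γ : ν.Tableau ℕ+) : QSym R :=
  ⟨genFun R (fun T : ν.Box → ℕ => IsSemistandard T) γ,
    genFun_mem R _ orderInvariant_isSemistandard γ⟩

end SkewDiagram


end SchurQSym

end

open SchurQSym SkewDiagram

/-! Antipode. Semi-standard tableaux are fillings of a finite set K that increase weakly along a
relation W (to the right in a row) and strictly along a relation S (downwards in a column). Let P_K
be their generating function. Cutting the alphabet into small and large variables cuts a filling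
along an ideal J of K, so Δ(P_K) is the sum of P_J ⊗ P_{K∖J} (`comulQ_posetQ`). Let P*_J be the
series for the relations with W and S reversed and their roles exchanged. For non-empty K the sum of
(-1)^|J| P*_J P_{K∖J} over the ideals J vanishes: once the values on K are fixed, the place of least
value, ties being broken by a labelling that rises along W and falls along S, can be moved into or
out of J. The antipode satisfies the same recursion, whence S(P_K) = (-1)^|K| P*_K
(`antipode_posetQ`). On a skew diagram the content j - i is such a labelling, and P* is the series
of the anti-diagonal transpose.

Ribbon expansions. These are Jacobi–Trudi identities, valid for any skew diagram λ/μ whose filling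
is constant on diagonals. The exponent of a box then depends on its content alone, and row i is a
word on the contents from a_i = μ_i - i up to, but excluding, b_i = λ_i - i. In the signed sum over
σ of families of row words from a_i to b_{σ(i)}, exchanging the tails of two neighbouring rows at
the first violation of the column condition keeps the monomial and changes the sign; only tableaux
survive (`sum_sign_smul_fillingSeries`).

The surviving task is to index the terms by rim decompositions. A partition is encoded by beads at
the positions λ_i - i, and adding a ribbon moves one bead to the right. Hence H-rim decompositions
correspond to the permutations σ with a_i ≤ b_{σ(i)} for all i, the ribbon θ_i having the contents
from a_i to b_{σ(i)} - 1 (`IsRimByRows.exists_rowType`, `IsRimByRows.eq_of_rowType`,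
`exists_isRimByRows`). Both expansions are cases of `genFun_isChainTableau`, where rows are chains
for r and columns are chains for the negated converse of r: r = (≤) on the diagram itself yields the
E's, and r = (<) on the conjugate diagram yields the M's. -/

noncomputable section

namespace SchurQSym

/-! ### Generating functions of fillings of finite sets -/

section Fillings

variable {α : Type*}

/-- The fillings of `K` by variables that satisfy `P` and have monomial `t^d`, extended by `0`. -/
def fillings (K : Finset α) (P : (α → ℕ) → Prop) (w : α → ℕ+) (d : ℕ →₀ ℕ) : Set (α → ℕ) :=
  {f | (∀ x, x ∉ K → f x = 0) ∧ P f ∧ ∑ x ∈ K, Finsupp.single (f x) (w x : ℕ) = d}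

theorem apply_ne_zero_of_sum_single {K : Finset α} {w : α → ℕ+} {d : ℕ →₀ ℕ} {f : α → ℕ}
    (h : ∑ x ∈ K, Finsupp.single (f x) (w x : ℕ) = d) {x : α} (hx : x ∈ K) : d (f x) ≠ 0 := by
  subst h
  rw [Finsupp.finsetSum_apply]
  intro h0
  rw [Finset.sum_eq_zero_iff] at h0
  simpa using h0 x hx

/-- Since all weights are positive, the values on K lie in the finite support of d; off K the
filling is fixed to be 0. -/
theorem finite_fillings (K : Finset α) (P : (α → ℕ) → Prop) (w : α → ℕ+) (d : ℕ →₀ ℕ) :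
    (fillings K P w d).Finite := by
  have : Function.Injective (fun (f : fillings K P w d) (x : K) =>
      (⟨f.1 x, Finsupp.mem_support_iff.2 (apply_ne_zero_of_sum_single f.2.2.2 x.2)⟩ :
        d.support)) := by
    rintro ⟨f, hf⟩ ⟨g, hg⟩ h
    ext x
    by_cases hx : x ∈ K
    · simpa using congrFun h ⟨x, hx⟩
    · exact (hf.1 x hx).trans (hg.1 x hx).symm
  exact Set.finite_coe_iff.1 (Finite.of_injective _ this)

variable (R : Type*) [CommRing R]

/-- The generating function of the fillings of a finite set `K` that satisfy `P`. -/
def fillingSeries (K : Finset α) (P : (α → ℕ) → Prop) (w : α → ℕ+) : MvPowerSeries ℕ R :=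
  fun d => ((fillings K P w d).ncard : R)

theorem coeff_fillingSeries (K : Finset α) (P : (α → ℕ) → Prop) (w : α → ℕ+) (d : ℕ →₀ ℕ) :
    MvPowerSeries.coeff d (fillingSeries R K P w) = ((fillings K P w d).ncard : R) := rfl

/-- This moves a generating function from its own index type to a subset of an ambient type, where
fillings of different subsets can be restricted, glued and compared. -/
theorem genFun_eq_fillingSeries {ι : Type*} [Fintype ι] {K : Finset α} (e : ι ≃ K)
    {P : (ι → ℕ) → Prop} {Q : (α → ℕ) → Prop} (hQ : ∀ f, Q f ↔ P fun i => f (e i))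
    {v : ι → ℕ+} {w : α → ℕ+} (hw : ∀ i, v i = w (e i)) :
    genFun R P v = fillingSeries R K Q w := by
  classical
  ext d
  change ((Nat.card _ : ℕ) : R) = ((Nat.card _ : ℕ) : R)
  congr 1
  have hsum : ∀ f : α → ℕ, ∑ i, Finsupp.single (f (e i)) (v i : ℕ) =
      ∑ x ∈ K, Finsupp.single (f x) (w x : ℕ) := by
    intro f
    rw [← Finset.sum_coe_sort K]
    exact Fintype.sum_equiv e _ _ fun i => by rw [hw]
  symm
  refine Nat.card_congr (Equiv.ofBijective (fun f => ⟨fun i => f.1 (e i), (hQ _).1 f.2.2.1, ?_⟩)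
    ⟨?_, ?_⟩)
  · rw [hsum, f.2.2.2]
  · rintro ⟨f, hf⟩ ⟨g, hg⟩ h
    ext x
    by_cases hx : x ∈ K
    · have := congrFun (congrArg Subtype.val h) (e.symm ⟨x, hx⟩)
      simpa using this
    · exact (hf.1 x hx).trans (hg.1 x hx).symm
  · rintro ⟨f, hf, hd⟩
    let g : α → ℕ := fun x => if hx : x ∈ K then f (e.symm ⟨x, hx⟩) else 0
    have hg : (fun i => g (e i)) = f := by
      funext i
      simp [g]
    refine ⟨⟨g, fun x hx => by simp [g, hx], (hQ g).2 (hg ▸ hf), ?_⟩, Subtype.ext hg⟩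
    rw [← hsum, ← hd]
    exact Finset.sum_congr rfl fun i _ => by rw [← congrFun hg i]

theorem fillingSeries_congr (K : Finset α) {P Q : (α → ℕ) → Prop} (w : α → ℕ+)
    (h : ∀ f, (∀ x, x ∉ K → f x = 0) → (P f ↔ Q f)) :
    fillingSeries R K P w = fillingSeries R K Q w := by
  ext d
  rw [coeff_fillingSeries, coeff_fillingSeries]
  congr 2
  ext f
  exact and_congr_right fun h0 => and_congr_left fun _ => h f h0

/-- A pair of fillings of disjoint sets is one filling of the union. The hypotheses on P and Q say
that each condition sees only its own set, so restricting and gluing preserve it. -/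
theorem fillingSeries_mul [DecidableEq α] {K L : Finset α} (hKL : Disjoint K L)
    {P Q : (α → ℕ) → Prop} (hP : ∀ f g, (∀ x ∈ K, f x = g x) → (P f ↔ P g))
    (hQ : ∀ f g, (∀ x ∈ L, f x = g x) → (Q f ↔ Q g)) (w : α → ℕ+) :
    fillingSeries R K P w * fillingSeries R L Q w =
      fillingSeries R (K ∪ L) (fun f => P f ∧ Q f) w := by
  classical
  ext d
  rw [MvPowerSeries.coeff_mul]
  simp only [coeff_fillingSeries]
  rw [Set.ncard_eq_toFinset_card _ (finite_fillings _ _ w d),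
    Finset.card_eq_sum_card_fiberwise (t := Finset.HasAntidiagonal.antidiagonal d)
      (f := fun f => (∑ x ∈ K, Finsupp.single (f x) (w x : ℕ),
        ∑ x ∈ L, Finsupp.single (f x) (w x : ℕ)))]
  · push_cast
    refine Finset.sum_congr rfl fun p hp => ?_
    rw [Set.ncard_eq_toFinset_card _ (finite_fillings K P w p.1),
      Set.ncard_eq_toFinset_card _ (finite_fillings L Q w p.2), ← Nat.cast_mul,
      ← Finset.card_product]
    congr 1
    have hd : ∀ x, x ∈ K → x ∉ L := fun x h1 h2 => Finset.disjoint_left.1 hKL h1 h2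
    refine Finset.card_nbij' (fun f x => if x ∈ K then f.1 x else f.2 x)
      (fun f => (fun x => if x ∈ K then f x else 0, fun x => if x ∈ L then f x else 0))
      ?_ ?_ ?_ ?_
    · rintro ⟨f, g⟩ h
      simp only [Finset.coe_product, Set.mem_prod, Finset.mem_coe, Set.Finite.mem_toFinset] at h
      obtain ⟨⟨hf0, hf, hfd⟩, hg0, hg, hgd⟩ := h
      have h1 : ∑ x ∈ K, Finsupp.single (if x ∈ K then f x else g x) (w x : ℕ) = p.1 := by
        rw [← hfd]
        exact Finset.sum_congr rfl fun x hx => by rw [if_pos hx]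
      have h2 : ∑ x ∈ L, Finsupp.single (if x ∈ K then f x else g x) (w x : ℕ) = p.2 := by
        rw [← hgd]
        exact Finset.sum_congr rfl fun x hx => by rw [if_neg fun h => hd x h hx]
      simp only [Finset.coe_filter, Set.Finite.mem_toFinset, Set.mem_ofPred_eq]
      refine ⟨⟨?_, ⟨?_, ?_⟩, ?_⟩, by rw [h1, h2]⟩
      · intro x hx
        rw [Finset.mem_union, not_or] at hx
        simp only [if_neg hx.1, hg0 x hx.2]
      · exact (hP f _ fun x hx => by rw [if_pos hx]).1 hf
      · exact (hQ g _ fun x hx => by rw [if_neg fun h => hd x h hx]).1 hg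
      · rw [Finset.sum_union hKL, h1, h2]
        exact Finset.HasAntidiagonal.mem_antidiagonal.1 hp
    · intro f h
      simp only [Finset.coe_filter, Set.Finite.mem_toFinset, Set.mem_ofPred_eq] at h
      obtain ⟨⟨h0, ⟨hPf, hQf⟩, -⟩, rfl⟩ := h
      simp only [Finset.coe_product, Set.mem_prod, Finset.mem_coe, Set.Finite.mem_toFinset]
      refine ⟨⟨fun x hx => if_neg hx, (hP f _ fun x hx => by rw [if_pos hx]).1 hPf, ?_⟩,
        ⟨fun x hx => if_neg hx, (hQ f _ fun x hx => by rw [if_pos hx]).1 hQf, ?_⟩⟩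
      · exact Finset.sum_congr rfl fun x hx => by simp only [if_pos hx]
      · exact Finset.sum_congr rfl fun x hx => by simp only [if_pos hx]
    · rintro ⟨f, g⟩ h
      simp only [Finset.coe_product, Set.mem_prod, Finset.mem_coe, Set.Finite.mem_toFinset] at h
      obtain ⟨⟨hf0, -⟩, hg0, -⟩ := h
      simp only [Prod.mk.injEq]
      constructor <;> funext x
      · by_cases hx : x ∈ K
        · simp [hx]
        · simp [hx, hf0 x hx]
      · by_cases hx : x ∈ L
        · have : x ∉ K := fun h => hd x h hx
          simp [hx, this]
        · simp [hx, hg0 x hx]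
    · intro f h
      simp only [Finset.coe_filter, Set.Finite.mem_toFinset, Set.mem_ofPred_eq] at h
      obtain ⟨⟨h0, -⟩, -⟩ := h
      funext x
      by_cases hx : x ∈ K
      · simp [hx]
      · by_cases hx' : x ∈ L
        · simp [hx, hx']
        · simp [hx, hx', h0 x (by simp [hx, hx'])]
  · intro f h
    simp only [Finset.mem_coe, Set.Finite.mem_toFinset] at h
    rw [Finset.mem_coe, Finset.HasAntidiagonal.mem_antidiagonal, ← h.2.2,
      Finset.sum_union hKL]

theorem fillingSeries_empty {P : (α → ℕ) → Prop} (hP : P fun _ => 0) (w : α → ℕ+) :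
    fillingSeries R ∅ P w = 1 := by
  classical
  ext d
  rw [coeff_fillingSeries, MvPowerSeries.coeff_one]
  split_ifs with h
  · have : fillings (∅ : Finset α) P w d = {fun _ => 0} := by
      ext f
      simp only [fillings, Finset.notMem_empty, not_false_eq_true, true_imp_iff,
        Finset.sum_empty, Set.mem_ofPred_eq, Set.mem_singleton_iff, h, and_true]
      constructor
      · exact fun h => funext h.1
      · rintro rfl
        exact ⟨fun _ => rfl, hP⟩
    rw [this, Set.ncard_singleton, Nat.cast_one]
  · have : fillings (∅ : Finset α) P w d = ∅ := by
      ext f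
      simp [fillings, Ne.symm h]
    rw [this, Set.ncard_empty, Nat.cast_zero]

theorem prod_fillingSeries [DecidableEq α] {ι : Type*} (s : Finset ι) {K : ι → Finset α}
    (hK : ∀ i j, i ≠ j → Disjoint (K i) (K j)) {P : ι → (α → ℕ) → Prop}
    (hP : ∀ i f g, (∀ x ∈ K i, f x = g x) → (P i f ↔ P i g)) (w : α → ℕ+) :
    ∏ i ∈ s, fillingSeries R (K i) (P i) w =
      fillingSeries R (s.biUnion K) (fun f => ∀ i ∈ s, P i f) w := by
  classical
  induction s using Finset.induction_on with
  | empty =>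
    rw [Finset.prod_empty, Finset.biUnion_empty, fillingSeries_empty]
    simp
  | insert i s hi ih =>
    rw [Finset.prod_insert hi, ih, fillingSeries_mul, Finset.biUnion_insert]
    · simp
    · rw [Finset.disjoint_biUnion_right]
      exact fun j hj => hK i j fun h => hi (h ▸ hj)
    · exact hP i
    · exact fun f g h => forall₂_congr fun j hj =>
        hP j f g fun x hx => h x (Finset.mem_biUnion.2 ⟨j, hj, hx⟩)

end Fillings

/-! ### Coproduct and antipode for weak and strict relations -/

section PosetFillings

variable {α : Type*} (W S : α → α → Prop)

/-- `f` weakly increases on `K` along `W` and strictly along `S`. -/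
def IsPosetFilling (K : Finset α) (f : α → ℕ) : Prop :=
  ∀ u ∈ K, ∀ v ∈ K, (W u v → f u ≤ f v) ∧ (S u v → f u < f v)

variable {W S} in
theorem IsPosetFilling.congr {K : Finset α} {f g : α → ℕ} (h : ∀ x ∈ K, f x = g x) :
    IsPosetFilling W S K f ↔ IsPosetFilling W S K g :=
  forall₂_congr fun u hu => forall₂_congr fun v hv => by rw [h u hu, h v hv]

/-- `J` is closed in `K` under the predecessors for `W` and `S`. -/
def IsIdealIn (J K : Finset α) : Prop := ∀ u ∈ K, ∀ v ∈ J, W u v ∨ S u v → u ∈ J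

variable (R : Type*) [CommRing R]

/-- The generating function of the fillings of `K` that weakly increase along `W` and strictly
along `S`. -/
def posetQ (K : Finset α) (w : α → ℕ+) : QSym R :=
  ⟨fillingSeries R K (IsPosetFilling W S K) w, by
    have hinv : OrderInvariant (fun f : K → ℕ =>
        ∀ u v : K, (W u v → f u ≤ f v) ∧ (S u v → f u < f v)) := by
      intro f g h
      have hlt : ∀ i j, f i < f j ↔ g i < g j := fun i j => by rw [← not_le, ← not_le, h]
      simp only [h, hlt]
    rw [← genFun_eq_fillingSeries R (Equiv.refl K) (P := fun f =>
      ∀ u v : K, (W u v → f u ≤ f v) ∧ (S u v → f u < f v)) (v := fun x => w x) ?_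
      fun _ => rfl]
    · exact genFun_mem R _ hinv _
    · simp [IsPosetFilling]⟩

theorem cf_posetQ (K : Finset α) (w : α → ℕ+) (d : ℕ →₀ ℕ) :
    cf R d (posetQ W S R K w) = ((fillings K (IsPosetFilling W S K) w d).ncard : R) := rfl

theorem posetQ_empty (w : α → ℕ+) : posetQ W S R ∅ w = 1 :=
  Subtype.ext (fillingSeries_empty R (by simp [IsPosetFilling]) w)

theorem counitQ_posetQ {K : Finset α} (hK : K.Nonempty) (w : α → ℕ+) :
    counitQ R (posetQ W S R K w) = 0 := by
  rw [counitQ, cf_posetQ]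
  have : fillings K (IsPosetFilling W S K) w 0 = ∅ := by
    obtain ⟨x, hx⟩ := hK
    refine Set.eq_empty_of_forall_notMem fun f hf => ?_
    exact apply_ne_zero_of_sum_single hf.2.2 hx rfl
  rw [this, Set.ncard_empty, Nat.cast_zero]

theorem sum_single_eq_cat [DecidableEq α] {K J : Finset α} (hJ : J ⊆ K) (w : α → ℕ+) (n : ℕ)
    {f : α → ℕ} (h1 : ∀ x ∈ J, f x < n) (h2 : ∀ x ∈ K \ J, n ≤ f x) :
    ∑ x ∈ K, Finsupp.single (f x) (w x : ℕ) = cat n (∑ x ∈ J, Finsupp.single (f x) (w x : ℕ))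
      (∑ x ∈ K \ J, Finsupp.single (f x - n) (w x : ℕ)) := by
  ext i
  rw [← Finset.sum_sdiff hJ, Finsupp.add_apply, cat_apply]
  simp only [Finsupp.finsetSum_apply]
  split_ifs with hi
  · rw [Finset.sum_eq_zero, zero_add]
    intro x hx
    have := h2 x hx
    exact Finsupp.single_eq_of_ne (by omega)
  · rw [Finset.sum_eq_zero (s := J), add_zero]
    · refine Finset.sum_congr rfl fun x hx => ?_
      have := h2 x hx
      simp only [Finsupp.single_apply]
      congr 1
      rw [eq_iff_iff]
      omega
    · intro x hx
      have := h1 x hx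
      exact Finsupp.single_eq_of_ne (by omega)

theorem cat_inj {n : ℕ} {u v u' v' : ℕ →₀ ℕ} (hu : ∀ i, n ≤ i → u i = 0)
    (hu' : ∀ i, n ≤ i → u' i = 0) (h : cat n u v = cat n u' v') : u = u' ∧ v = v' := by
  constructor
  · ext i
    by_cases hi : i < n
    · simpa [cat_apply, hi] using DFunLike.congr_fun h i
    · rw [hu i (by omega), hu' i (by omega)]
  · ext i
    simpa [cat_apply] using DFunLike.congr_fun h (n + i)

theorem sum_single_apply_eq_zero {K : Finset α} {w : α → ℕ+} {f : α → ℕ} {n : ℕ}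
    (h : ∀ x ∈ K, f x < n) (i : ℕ) (hi : n ≤ i) :
    (∑ x ∈ K, Finsupp.single (f x) (w x : ℕ)) i = 0 := by
  rw [Finsupp.finsetSum_apply]
  refine Finset.sum_eq_zero fun x hx => Finsupp.single_eq_of_ne ?_
  have := h x hx
  omega

-- The coefficient of Δ(p) at t^u ⊗ t^v is the coefficient of p at u followed by v. In a filling
-- with that monomial, the places carrying one of the first n variables form an ideal, and the rest,
-- shifted down by n, is a filling of the complement.
open Classical in
theorem comulQ_posetQ (K : Finset α) (w : α → ℕ+) :
    comulQ R (posetQ W S R K w) = ∑ J ∈ K.powerset with IsIdealIn W S J K,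
      posetQ W S R J w ⊗ₜ[R] posetQ W S R (K \ J) w := by
  -- The cut n is the length of the first word, so that the packed exponent u uses only variables
  -- below n.
  refine ext_cf2 R fun a b => ?_
  set n := a.length
  have hu := packed_apply_of_le a
  generalize packed a = u at hu
  generalize packed b = v
  rw [cf2_comulQ R n u v hu, map_sum]
  simp only [cf2_tmul, cf_posetQ]
  rw [Set.ncard_eq_toFinset_card _ (finite_fillings _ _ w _),
    Finset.card_eq_sum_card_fiberwise (t := {J ∈ K.powerset | IsIdealIn W S J K})
      (f := fun f => K.filter fun x => f x < n)]
  · push_cast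
    refine Finset.sum_congr rfl fun J hJ => ?_
    obtain ⟨hJK, hJ⟩ := Finset.mem_filter.1 hJ
    rw [Finset.mem_powerset] at hJK
    rw [Set.ncard_eq_toFinset_card _ (finite_fillings J _ w u),
      Set.ncard_eq_toFinset_card _ (finite_fillings (K \ J) _ w v), ← Nat.cast_mul,
      ← Finset.card_product]
    congr 1
    refine Finset.card_nbij' (fun f => (fun x => if x ∈ J then f x else 0,
        fun x => if x ∈ K \ J then f x - n else 0))
      (fun f x => if x ∈ J then f.1 x else if x ∈ K \ J then n + f.2 x else 0) ?_ ?_ ?_ ?_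
    · intro f h
      simp only [Finset.coe_filter, Set.Finite.mem_toFinset, Set.mem_ofPred_eq] at h
      obtain ⟨⟨h0, hf, hd⟩, hfJ⟩ := h
      have h1 : ∀ x ∈ J, f x < n := fun x hx => by
        rw [← hfJ] at hx
        exact (Finset.mem_filter.1 hx).2
      have h2 : ∀ x ∈ K \ J, n ≤ f x := fun x hx => by
        rw [← hfJ] at hx
        simp only [Finset.mem_sdiff, Finset.mem_filter, not_and, not_lt] at hx
        exact hx.2 hx.1
      rw [sum_single_eq_cat hJK w n h1 h2] at hd
      obtain ⟨e1, e2⟩ := cat_inj (sum_single_apply_eq_zero h1) hu hd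
      simp only [Finset.coe_product, Set.mem_prod, Finset.mem_coe, Set.Finite.mem_toFinset]
      refine ⟨⟨fun x hx => if_neg hx, fun x hx y hy => ?_, ?_⟩,
        ⟨fun x hx => if_neg hx, fun x hx y hy => ?_, ?_⟩⟩
      · simp only [if_pos hx, if_pos hy]
        exact hf x (hJK hx) y (hJK hy)
      · rw [← e1]
        exact Finset.sum_congr rfl fun x hx => by simp only [if_pos hx]
      · simp only [if_pos hx, if_pos hy]
        have := hf x (Finset.mem_sdiff.1 hx).1 y (Finset.mem_sdiff.1 hy).1
        have hx' := h2 x hx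
        exact ⟨fun h => by have := this.1 h; omega, fun h => by have := this.2 h; omega⟩
      · rw [← e2]
        exact Finset.sum_congr rfl fun x hx => by simp only [if_pos hx]
    · rintro ⟨g, h⟩ hgh
      simp only [Finset.coe_product, Set.mem_prod, Finset.mem_coe, Set.Finite.mem_toFinset] at hgh
      obtain ⟨⟨hg0, hg, hgd⟩, hh0, hh, hhd⟩ := hgh
      have hgn : ∀ x ∈ J, g x < n := fun x hx => by
        by_contra hn
        exact apply_ne_zero_of_sum_single hgd hx (hu _ (by omega))
      set F : α → ℕ := fun x => if x ∈ J then g x else if x ∈ K \ J then n + h x else 0 with hF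
      have e1 : ∀ x ∈ J, F x = g x := fun x hx => if_pos hx
      have e2 : ∀ x ∈ K \ J, F x = n + h x := fun x hx => by
        rw [hF]
        simp only [if_neg (Finset.mem_sdiff.1 hx).2, if_pos hx]
      have h1 : ∀ x ∈ J, F x < n := fun x hx => by rw [e1 x hx]; exact hgn x hx
      have h2 : ∀ x ∈ K \ J, n ≤ F x := fun x hx => by rw [e2 x hx]; omega
      simp only [Finset.coe_filter, Set.Finite.mem_toFinset, Set.mem_ofPred_eq]
      change ((∀ x, x ∉ K → F x = 0) ∧ IsPosetFilling W S K F ∧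
        ∑ x ∈ K, Finsupp.single (F x) (w x : ℕ) = cat n u v) ∧ K.filter (fun x => F x < n) = J
      refine ⟨⟨?_, fun x hx y hy => ?_, ?_⟩, ?_⟩
      · intro x hx
        rw [hF]
        simp only [if_neg fun h => hx (hJK h), if_neg fun h => hx (Finset.mem_sdiff.1 h).1]
      · by_cases hxJ : x ∈ J <;> by_cases hyJ : y ∈ J
        · rw [e1 x hxJ, e1 y hyJ]
          exact hg x hxJ y hyJ
        · have a1 := h1 x hxJ
          have a2 := h2 y (Finset.mem_sdiff.2 ⟨hy, hyJ⟩)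
          exact ⟨fun _ => by omega, fun _ => by omega⟩
        -- No relation leads from outside the ideal into it, so the large values outside J never
        -- have to lie below the small ones in J.
        · exact ⟨fun h => absurd (hJ x hx y hyJ (Or.inl h)) hxJ,
            fun h => absurd (hJ x hx y hyJ (Or.inr h)) hxJ⟩
        · rw [e2 x (Finset.mem_sdiff.2 ⟨hx, hxJ⟩), e2 y (Finset.mem_sdiff.2 ⟨hy, hyJ⟩)]
          simpa using hh x (Finset.mem_sdiff.2 ⟨hx, hxJ⟩) y (Finset.mem_sdiff.2 ⟨hy, hyJ⟩)
      · rw [sum_single_eq_cat hJK w n h1 h2, ← hgd, ← hhd]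
        congr 1
        · exact Finset.sum_congr rfl fun x hx => by rw [e1 x hx]
        · exact Finset.sum_congr rfl fun x hx => by rw [e2 x hx, Nat.add_sub_cancel_left]
      · ext x
        rw [Finset.mem_filter]
        constructor
        · rintro ⟨hx, hxn⟩
          by_contra hxJ
          have := h2 x (Finset.mem_sdiff.2 ⟨hx, hxJ⟩)
          omega
        · exact fun hx => ⟨hJK hx, h1 x hx⟩
    · intro f h
      simp only [Finset.coe_filter, Set.Finite.mem_toFinset, Set.mem_ofPred_eq] at h
      obtain ⟨⟨h0, -⟩, hfJ⟩ := h
      funext x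
      by_cases hx : x ∈ J
      · simp [hx]
      · by_cases hxK : x ∈ K
        · have : n ≤ f x := by
            by_contra hn
            exact hx (hfJ ▸ Finset.mem_filter.2 ⟨hxK, by omega⟩)
          simp [hx, hxK, this]
        · simp [hx, hxK, h0 x hxK]
    · rintro ⟨g, h⟩ hgh
      simp only [Finset.coe_product, Set.mem_prod, Finset.mem_coe, Set.Finite.mem_toFinset] at hgh
      obtain ⟨⟨hg0, -⟩, hh0, -⟩ := hgh
      simp only [Prod.mk.injEq]
      constructor <;> funext x
      · by_cases hx : x ∈ J
        · simp [hx]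
        · simp [hx, hg0 x hx]
      · by_cases hx : x ∈ K \ J
        · simp [hx, (Finset.mem_sdiff.1 hx).2]
        · rw [if_neg hx, hh0 x hx]
  · intro f hf
    simp only [Finset.mem_coe, Set.Finite.mem_toFinset] at hf
    rw [Finset.mem_coe, Finset.mem_filter, Finset.mem_powerset]
    refine ⟨Finset.filter_subset _ _, fun x hx y hy hxy => ?_⟩
    rw [Finset.mem_filter] at hy ⊢
    have := hf.2.1 x hx y hy.1
    refine ⟨hx, ?_⟩
    rcases hxy with h | h
    · exact (this.1 h).trans_lt hy.2
    · exact (this.2 h).trans hy.2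

variable {W S}

open Classical in
/-- For a fixed filling, the ideals on which it is a filling of the dual type, and off which it is a
filling of the given type, cancel in pairs. -/
theorem sum_ideals_neg_one_pow {ω : α → ℤ} (hW : ∀ u v, W u v → ω u < ω v)
    (hS : ∀ u v, S u v → ω v < ω u) {K : Finset α} (hK : K.Nonempty) (f : α → ℕ) :
    ∑ J ∈ K.powerset with IsIdealIn W S J K ∧
      IsPosetFilling (fun u v => S v u) (fun u v => W v u) J f ∧ IsPosetFilling W S (K \ J) f,
      (-1 : R) ^ J.card = 0 := by
  -- The pivot is the place of least value and, among those, of least label. It depends on f and K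
  -- but not on J, so toggling its membership in J is an involution.
  obtain ⟨x, hx, hmin⟩ := K.exists_min_image (fun u => toLex (f u, ω u)) hK
  have hmin : ∀ u ∈ K, f x < f u ∨ f x = f u ∧ ω x ≤ ω u := fun u hu => by
    simpa [Prod.Lex.toLex_le_toLex] using hmin u hu
  -- Equality of values is excluded because a W-predecessor of x has a smaller label, against the
  -- choice of x; likewise S-successors of x have smaller labels.
  have a1 : ∀ u ∈ K, W u x → f x < f u := fun u hu h => by
    have := hmin u hu
    have := hW u x h
    omega
  have a2 : ∀ u ∈ K, S u x → f x ≤ f u := fun u hu h => by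
    have := hmin u hu
    omega
  have b1 : ∀ v ∈ K, W x v → f x ≤ f v := fun v hv h => by
    have := hmin v hv
    omega
  have b2 : ∀ v ∈ K, S x v → f x < f v := fun v hv h => by
    have := hmin v hv
    have := hS x v h
    omega
  have irrefl : ¬ (W x x ∨ S x x) := by
    rintro (h | h)
    · exact lt_irrefl _ (hW x x h)
    · exact lt_irrefl _ (hS x x h)
  have mem : ∀ (J : Finset α) (u : α), u ≠ x → (u ∈ symmDiff J {x} ↔ u ∈ J) := by
    intro J u hu
    simp [Finset.mem_symmDiff, hu]
  have memx : ∀ J : Finset α, x ∈ symmDiff J {x} ↔ x ∉ J := by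
    intro J
    simp [Finset.mem_symmDiff]
  refine Finset.sum_involution (fun J _ => symmDiff J {x}) ?_ ?_ ?_ ?_
  · intro J hJ
    by_cases hxJ : x ∈ J
    · have e : symmDiff J {x} = J.erase x := by
        ext u
        by_cases hu : u = x
        · subst hu
          simp [memx, hxJ]
        · simp [mem _ _ hu, hu]
      rw [e, ← Finset.card_erase_add_one hxJ, pow_succ]
      ring
    · have e : symmDiff J {x} = insert x J := by
        ext u
        by_cases hu : u = x
        · subst hu
          simp [memx, hxJ]
        · simp [mem _ _ hu, hu]
      rw [e, Finset.card_insert_of_notMem hxJ, pow_succ]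
      ring
  · intro J _ _ h
    have := memx J
    rw [h] at this
    tauto
  · intro J hJ
    rw [Finset.mem_filter, Finset.mem_powerset] at hJ ⊢
    obtain ⟨hJK, h1, h2, h3⟩ := hJ
    -- If u were outside J, then so would x be, as J is an ideal; the values would then increase
    -- from u to x, against minimality. Thus all predecessors of x are in J, and dually all its
    -- successors are outside, so x itself may be on either side.
    have c1 : ∀ u ∈ K, W u x ∨ S u x → u ∈ J := by
      intro u hu h
      by_contra huJ
      have hxJ : x ∉ J := fun hxJ => huJ (h1 u hu x hxJ h)
      have := h3 u (Finset.mem_sdiff.2 ⟨hu, huJ⟩) x (Finset.mem_sdiff.2 ⟨hx, hxJ⟩)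
      rcases h with h | h
      · exact (a1 u hu h).not_ge (this.1 h)
      · exact (a2 u hu h).not_gt (this.2 h)
    have c2 : ∀ v ∈ K, W x v ∨ S x v → v ∉ J := by
      intro v hv h hvJ
      have := h2 v hvJ x (h1 x hx v hvJ h)
      rcases h with h | h
      · exact (b1 v hv h).not_gt (this.2 h)
      · exact (b2 v hv h).not_ge (this.1 h)
    have hJK' : symmDiff J {x} ⊆ K := by
      intro u hu
      by_cases hux : u = x
      · exact hux ▸ hx
      · exact hJK ((mem J u hux).1 hu)
    refine ⟨hJK', ?_, ?_, ?_⟩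
    · intro u hu v hv h
      by_cases hvx : v = x
      · subst hvx
        have hux : u ≠ v := by
          rintro rfl
          exact irrefl h
        exact (mem J u hux).2 (c1 u hu h)
      · rw [mem J v hvx] at hv
        by_cases hux : u = x
        · subst hux
          exact absurd hv (c2 v (hJK hv) h)
        · exact (mem J u hux).2 (h1 u hu v hv h)
    · intro u hu v hv
      by_cases hux : u = x
      · subst hux
        exact ⟨a2 v (hJK' hv), a1 v (hJK' hv)⟩
      · rw [mem J u hux] at hu
        by_cases hvx : v = x
        · subst hvx
          exact ⟨fun h => absurd hu (c2 u (hJK hu) (Or.inr h)),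
            fun h => absurd hu (c2 u (hJK hu) (Or.inl h))⟩
        · exact h2 u hu v ((mem J v hvx).1 hv)
    · intro u hu v hv
      rw [Finset.mem_sdiff] at hu hv
      by_cases hux : u = x
      · subst hux
        exact ⟨b1 v hv.1, b2 v hv.1⟩
      · rw [mem J u hux] at hu
        by_cases hvx : v = x
        · subst hvx
          exact ⟨fun h => absurd (c1 u hu.1 (Or.inl h)) hu.2,
            fun h => absurd (c1 u hu.1 (Or.inr h)) hu.2⟩
        · rw [mem J v hvx] at hv
          exact h3 u (Finset.mem_sdiff.2 hu) v (Finset.mem_sdiff.2 hv)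
  · intro J _
    simp

-- Multiplying series on complementary sets glues fillings, so the coefficient at t^d counts pairs
-- of an ideal and a filling of K. Summing over the ideals first, `sum_ideals_neg_one_pow` makes
-- every filling contribute zero.
open Classical in
theorem sum_ideals_posetQ_mul {ω : α → ℤ} (hW : ∀ u v, W u v → ω u < ω v)
    (hS : ∀ u v, S u v → ω v < ω u) {K : Finset α} (hK : K.Nonempty) (w : α → ℕ+) :
    ∑ J ∈ K.powerset with IsIdealIn W S J K, (-1 : QSym R) ^ J.card *
      posetQ (fun u v => S v u) (fun u v => W v u) R J w * posetQ W S R (K \ J) w = 0 := by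
  refine ext_cf R fun d => ?_
  rw [map_sum, map_zero]
  have hfin := finite_fillings K (fun _ => True) w d
  have key : ∀ J ∈ ({J ∈ K.powerset | IsIdealIn W S J K} : Finset (Finset α)),
      cf R d ((-1 : QSym R) ^ J.card *
        posetQ (fun u v => S v u) (fun u v => W v u) R J w * posetQ W S R (K \ J) w) =
      ∑ f ∈ hfin.toFinset, if IsPosetFilling (fun u v => S v u) (fun u v => W v u) J f ∧
        IsPosetFilling W S (K \ J) f then (-1 : R) ^ J.card else 0 := by
    intro J hJ
    rw [Finset.mem_filter, Finset.mem_powerset] at hJ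
    have hsign : (-1 : QSym R) ^ J.card = algebraMap R (QSym R) ((-1) ^ J.card) := by simp
    rw [mul_assoc, hsign, ← Algebra.smul_def, map_smul, smul_eq_mul]
    have hmul : cf R d (posetQ (fun u v => S v u) (fun u v => W v u) R J w *
        posetQ W S R (K \ J) w) = ((fillings K (fun f =>
          IsPosetFilling (fun u v => S v u) (fun u v => W v u) J f ∧
            IsPosetFilling W S (K \ J) f) w d).ncard : R) := by
      have := congrArg (MvPowerSeries.coeff d) (fillingSeries_mul R (K := J) (L := K \ J)
        Finset.disjoint_sdiff (fun f g h => IsPosetFilling.congr h)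
        (fun f g h => IsPosetFilling.congr h) w (P := IsPosetFilling (fun u v => S v u)
          (fun u v => W v u) J) (Q := IsPosetFilling W S (K \ J)))
      rw [Finset.union_sdiff_of_subset hJ.1] at this
      exact this
    rw [hmul, ← Finset.sum_filter, Finset.sum_const, nsmul_eq_mul, mul_comm,
      Set.ncard_eq_toFinset_card _ (finite_fillings K _ w d)]
    congr 3
    ext f
    simp only [Set.Finite.mem_toFinset, Finset.mem_filter, fillings, Set.mem_ofPred_eq]
    tauto
  rw [Finset.sum_congr rfl key, Finset.sum_comm]
  refine Finset.sum_eq_zero fun f _ => ?_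
  rw [← Finset.sum_filter, Finset.filter_filter]
  exact sum_ideals_neg_one_pow R hW hS hK f

/-- The antipode exchanges weak and strict relations and reverses them, up to sign. -/
theorem antipode_posetQ {ω : α → ℤ} (hW : ∀ u v, W u v → ω u < ω v)
    (hS : ∀ u v, S u v → ω v < ω u) (K : Finset α) (w : α → ℕ+) :
    HopfAlgebra.antipode R (posetQ W S R K w) =
      (-1) ^ K.card * posetQ (fun u v => S v u) (fun u v => W v u) R K w := by
  classical
  induction K using Finset.strongInduction with
  | H K ih =>
  rcases K.eq_empty_or_nonempty with rfl | hK
  · rw [posetQ_empty, posetQ_empty]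
    simp
  -- The left convolution identity at P_K and the cancellation of ideals are two vanishing sums over
  -- the same ideals. By induction they agree in every term with J ≠ K, so their terms at J = K
  -- agree too.
  have h := LinearMap.congr_fun (antipodeQ_left R) (posetQ W S R K w)
  simp only [LinearMap.comp_apply, comulQ_posetQ, counitQ_posetQ W S R hK, map_sum,
    TensorProduct.map_tmul, LinearMap.mul'_apply, LinearMap.id_apply, map_zero] at h
  have h' := sum_ideals_posetQ_mul R hW hS hK w
  have hmem : K ∈ ({J ∈ K.powerset | IsIdealIn W S J K} : Finset (Finset α)) := by
    simp only [Finset.mem_filter, Finset.mem_powerset, subset_rfl, true_and]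
    exact fun u hu _ _ _ => hu
  rw [← Finset.add_sum_erase _ _ hmem] at h h'
  rw [Finset.sdiff_self, posetQ_empty, mul_one] at h h'
  have hrest : ∀ J ∈ ({J ∈ K.powerset | IsIdealIn W S J K} : Finset (Finset α)).erase K,
      antipodeQ R (posetQ W S R J w) * posetQ W S R (K \ J) w = (-1) ^ J.card *
        posetQ (fun u v => S v u) (fun u v => W v u) R J w * posetQ W S R (K \ J) w := by
    intro J hJ
    rw [Finset.mem_erase, Finset.mem_filter, Finset.mem_powerset] at hJ
    exact congrArg (· * posetQ W S R (K \ J) w)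
      (ih J (Finset.ssubset_iff_subset_ne.2 ⟨hJ.2.1, hJ.1⟩))
  change antipodeQ R _ = _
  rw [Finset.sum_congr rfl hrest] at h
  exact add_right_cancel (h.trans h'.symm)

end PosetFillings

/-! ### The antipode of the Schur type functions -/

namespace SkewDiagram

variable {ν : SkewDiagram}

theorem mem_cells {u : ℕ × ℕ} : u ∈ ν.cells ↔ u ∈ ν.outer ∧ u ∉ ν.inner := by
  rw [cells, Finset.mem_sdiff, YoungDiagram.mem_cells, YoungDiagram.mem_cells]

theorem lt_of_mem_outer {u : ℕ × ℕ} (hu : u ∈ ν.outer) : u.1 < ν.numRows ∧ u.2 < ν.numCols :=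
  ⟨YoungDiagram.mem_iff_lt_colLen.1 (ν.outer.isLowerSet (Prod.mk_le_mk.2 ⟨le_rfl, zero_le⟩) hu),
    YoungDiagram.mem_iff_lt_rowLen.1 (ν.outer.isLowerSet (Prod.mk_le_mk.2 ⟨zero_le, le_rfl⟩) hu)⟩

/-- The reflection of the boxes of `ν^#` to those of `ν`. -/
def reflectEquiv (ν : SkewDiagram) : ν.antiTranspose.Box ≃ ν.Box where
  toFun u := ⟨ν.reflect u.1, ν.reflect_mem u.2⟩
  invFun u := ⟨(ν.numCols - 1 - u.1.2, ν.numRows - 1 - u.1.1), by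
    have hu := mem_cells.1 u.2
    have hlt := lt_of_mem_outer hu.1
    have e : ν.reflect (ν.numCols - 1 - u.1.2, ν.numRows - 1 - u.1.1) = u.1 := by
      ext <;> simp only [reflect] <;> omega
    rw [cells, Finset.mem_sdiff]
    refine ⟨ν.mem_reflectCompl.2 ⟨⟨?_, ?_⟩, by rw [e]; exact hu.2⟩, fun h =>
      (ν.mem_reflectCompl.1 h).2 (by rw [e]; exact hu.1)⟩ <;> simp only <;> omega⟩
  left_inv u := by
    have hu := u.2
    simp only [cells, Finset.mem_sdiff, antiTranspose, mem_reflectCompl] at hu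
    ext <;> simp only [reflect] <;> omega
  right_inv u := by
    have hlt := lt_of_mem_outer (mem_cells.1 u.2).1
    ext <;> simp only [reflect] <;> omega

theorem lt_of_mem_antiTranspose (u : ν.antiTranspose.Box) :
    u.1.1 < ν.numCols ∧ u.1.2 < ν.numRows := by
  have hu := u.2
  simp only [cells, Finset.mem_sdiff, antiTranspose, mem_reflectCompl] at hu
  exact hu.1.1

theorem schurQ_eq_posetQ (R : Type*) [CommRing R] (γ : ν.Tableau ℕ+) :
    schurQ R γ = posetQ (fun u v : ν.Box => u.1.1 = v.1.1 ∧ u.1.2 < v.1.2)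
      (fun u v => u.1.2 = v.1.2 ∧ u.1.1 < v.1.1) R Finset.univ γ := by
  refine Subtype.ext (genFun_eq_fillingSeries R
    ((Equiv.subtypeUnivEquiv Finset.mem_univ).symm) (fun f => ?_) fun _ => rfl)
  simp only [IsPosetFilling, IsSemistandard, Finset.mem_univ, true_imp_iff]
  exact ⟨fun h => ⟨fun u v h1 h2 => (h u v).1 ⟨h1, h2⟩, fun u v h1 h2 => (h u v).2 ⟨h1, h2⟩⟩,
    fun h u v => ⟨fun h' => h.1 u v h'.1 h'.2, fun h' => h.2 u v h'.1 h'.2⟩⟩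

/-- Reflection in the anti-diagonal turns rows into columns and reverses both directions. Pulled
back to ν, rightward in a row of ν^# means upward in a column, and downward in a column of ν^# means
leftward in a row. -/
theorem schurQ_antiTranspose_eq_posetQ (R : Type*) [CommRing R] (γ : ν.Tableau ℕ+) :
    schurQ R γ.antiTranspose = posetQ (fun u v : ν.Box => v.1.2 = u.1.2 ∧ v.1.1 < u.1.1)
      (fun u v => v.1.1 = u.1.1 ∧ v.1.2 < u.1.2) R Finset.univ γ := by
  refine Subtype.ext (genFun_eq_fillingSeries R
    (ν.reflectEquiv.trans (Equiv.subtypeUnivEquiv Finset.mem_univ).symm) (fun f => ?_)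
      fun _ => rfl)
  simp only [IsPosetFilling, IsSemistandard, Finset.mem_univ, true_imp_iff]
  rw [ν.reflectEquiv.surjective.forall]
  simp only [ν.reflectEquiv.surjective.forall]
  have e1 : ∀ u v : ν.antiTranspose.Box, (ν.reflectEquiv v).1.2 = (ν.reflectEquiv u).1.2 ∧
      (ν.reflectEquiv v).1.1 < (ν.reflectEquiv u).1.1 ↔ u.1.1 = v.1.1 ∧ u.1.2 < v.1.2 := by
    intro u v
    have hu := lt_of_mem_antiTranspose u
    have hv := lt_of_mem_antiTranspose v
    simp only [reflectEquiv, reflect, Equiv.coe_fn_mk]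
    omega
  have e2 : ∀ u v : ν.antiTranspose.Box, (ν.reflectEquiv v).1.1 = (ν.reflectEquiv u).1.1 ∧
      (ν.reflectEquiv v).1.2 < (ν.reflectEquiv u).1.2 ↔ u.1.2 = v.1.2 ∧ u.1.1 < v.1.1 := by
    intro u v
    have hu := lt_of_mem_antiTranspose u
    have hv := lt_of_mem_antiTranspose v
    simp only [reflectEquiv, reflect, Equiv.coe_fn_mk]
    omega
  simp only [e1, e2]
  exact ⟨fun h => ⟨fun u v h1 h2 => (h u v).1 ⟨h1, h2⟩, fun u v h1 h2 => (h u v).2 ⟨h1, h2⟩⟩,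
    fun h u v => ⟨fun h' => h.1 u v h'.1 h'.2, fun h' => h.2 u v h'.1 h'.2⟩⟩

/-- The content serves as labelling: it increases to the right along rows and decreases downwards
along columns. -/
theorem antipode_schurQ (R : Type*) [CommRing R] (γ : ν.Tableau ℕ+) :
    HopfAlgebra.antipode R (schurQ R γ) = (-1) ^ ν.size * schurQ R γ.antiTranspose := by
  rw [schurQ_eq_posetQ, schurQ_antiTranspose_eq_posetQ,
    antipode_posetQ R (ω := fun u => (u.1.2 : ℤ) - u.1.1), Finset.card_univ, Fintype.card_coe, size]
  · intro u v h
    omega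
  · intro u v h
    omega

end SkewDiagram

/-! ### The sign-reversing exchange of row tails -/

section TailSwap

variable {n : ℕ}

/-- The places `(i, c)` with `a i ≤ c < e i`. -/
def rowPlaces (a e : Fin n → ℤ) : Finset (Fin n × ℤ) :=
  Finset.univ.biUnion fun i => {i} ×ˢ Finset.Ico (a i) (e i)

theorem mem_rowPlaces {a e : Fin n → ℤ} {x : Fin n × ℤ} :
    x ∈ rowPlaces a e ↔ a x.1 ≤ x.2 ∧ x.2 < e x.1 := by
  simp only [rowPlaces, Finset.mem_biUnion, Finset.mem_univ, true_and, Finset.mem_product,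
    Finset.mem_singleton, Finset.mem_Ico]
  grind

variable (r : ℕ → ℕ → Prop)

/-- Row `i` of `f` is a chain for `r` between `a i` and `e i`. -/
def IsRowChain (a e : Fin n → ℤ) (i : Fin n) (f : Fin n × ℤ → ℕ) : Prop :=
  ∀ c, a i ≤ c → c + 1 < e i → r (f (i, c)) (f (i, c + 1))

/-- The rows `i` and `j = i + 1` meet at `c`. -/
def Crossing (a e : Fin n → ℤ) (f : Fin n × ℤ → ℕ) (c : ℤ) (i j : Fin n) : Prop :=
  (j : ℕ) = i + 1 ∧ a i ≤ c ∧ c ≤ e i ∧ c ≤ e j ∧ (c = e i ∨ r (f (j, c - 1)) (f (i, c)))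

/-- The crossing with the least `c` and, among those, the least `i`. -/
def FirstCrossing (a e : Fin n → ℤ) (f : Fin n × ℤ → ℕ) (c : ℤ) (i j : Fin n) : Prop :=
  Crossing r a e f c i j ∧ ∀ c' i' j', Crossing r a e f c' i' j' → c < c' ∨ c = c' ∧ i ≤ i'

/-- Exchange of the rows `i` and `j` from `c` on. -/
def tailSwap (c : ℤ) (i j : Fin n) (x : Fin n × ℤ) : Fin n × ℤ :=
  if c ≤ x.2 then (Equiv.swap i j x.1, x.2) else x

theorem tailSwap_tailSwap (c : ℤ) (i j : Fin n) (x : Fin n × ℤ) :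
    tailSwap c i j (tailSwap c i j x) = x := by
  unfold tailSwap
  split_ifs <;> simp_all

theorem tailSwap_snd (c : ℤ) (i j : Fin n) (x : Fin n × ℤ) : (tailSwap c i j x).2 = x.2 := by
  unfold tailSwap
  split_ifs <;> rfl

variable {r}

theorem exists_firstCrossing {a e : Fin n → ℤ} {f : Fin n × ℤ → ℕ}
    (h : ∃ c i j, Crossing r a e f c i j) : ∃ c i j, FirstCrossing r a e f c i j := by
  classical
  let s : Finset (ℤ × Fin n × Fin n) := (Finset.univ.biUnion fun p : Fin n × Fin n =>
    (Finset.Icc (a p.1) (e p.1)).image fun c => (c, p)).filter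
      fun x => Crossing r a e f x.1 x.2.1 x.2.2
  have hs : ∀ x, x ∈ s ↔ Crossing r a e f x.1 x.2.1 x.2.2 := by
    rintro ⟨c, i, j⟩
    simp only [s, Finset.mem_filter, Finset.mem_biUnion, Finset.mem_univ, true_and,
      Finset.mem_image, Finset.mem_Icc, and_iff_right_iff_imp]
    exact fun h => ⟨(i, j), c, ⟨h.2.1, h.2.2.1⟩, rfl⟩
  obtain ⟨c, i, j, h⟩ := h
  obtain ⟨⟨c, i, j⟩, hx, hmin⟩ := s.exists_min_image (fun x => toLex (x.1, x.2.1))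
    ⟨(c, i, j), (hs _).2 h⟩
  refine ⟨c, i, j, (hs _).1 hx, fun c' i' j' h' => ?_⟩
  simpa [Prod.Lex.toLex_le_toLex] using hmin (c', i', j') ((hs _).2 h')

theorem FirstCrossing.unique {a e : Fin n → ℤ} {f : Fin n × ℤ → ℕ} {c c' : ℤ} {i j i' j' : Fin n}
    (h : FirstCrossing r a e f c i j) (h' : FirstCrossing r a e f c' i' j') :
    c = c' ∧ i = i' ∧ j = j' := by
  have h1 := h.2 _ _ _ h'.1
  have h2 := h'.2 _ _ _ h.1
  have h3 := h.1.1
  have h4 := h'.1.1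
  have hc : c = c' := by omega
  have hi : i = i' := by
    apply le_antisymm <;> omega
  subst hi
  exact ⟨hc, rfl, Fin.ext (h3.trans h4.symm)⟩

theorem tailSwap_mem {a e : Fin n → ℤ} (ha : StrictAnti a) {c : ℤ} {i j : Fin n}
    (hij : (j : ℕ) = i + 1) (hc : a i ≤ c) (hci : c ≤ e i) (hcj : c ≤ e j) {x : Fin n × ℤ}
    (hx : x ∈ rowPlaces a e) : tailSwap c i j x ∈ rowPlaces a (fun k => e (Equiv.swap i j k)) := by
  have haij : a j < a i := ha (Fin.lt_def.2 (by omega))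
  obtain ⟨k, y⟩ := x
  rw [mem_rowPlaces] at hx ⊢
  simp only [tailSwap] at hx ⊢
  split_ifs with h
  · simp only [Equiv.swap_apply_self]
    refine ⟨?_, hx.2⟩
    by_cases h1 : k = i
    · subst h1
      simp only [Equiv.swap_apply_left]
      omega
    · by_cases h2 : k = j
      · subst h2
        simp only [Equiv.swap_apply_right]
        omega
      · rw [Equiv.swap_apply_of_ne_of_ne h1 h2]
        exact hx.1
  · refine ⟨hx.1, ?_⟩
    by_cases h1 : k = i
    · subst h1
      simp only [Equiv.swap_apply_left]
      omega
    · by_cases h2 : k = j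
      · subst h2
        simp only [Equiv.swap_apply_right]
        omega
      · rw [Equiv.swap_apply_of_ne_of_ne h1 h2]
        exact hx.2

theorem tailSwap_mem_iff {a e : Fin n → ℤ} (ha : StrictAnti a) {c : ℤ} {i j : Fin n}
    (hij : (j : ℕ) = i + 1) (hc : a i ≤ c) (hci : c ≤ e i) (hcj : c ≤ e j) {x : Fin n × ℤ} :
    tailSwap c i j x ∈ rowPlaces a e ↔ x ∈ rowPlaces a (fun k => e (Equiv.swap i j k)) := by
  constructor
  · intro h
    have := tailSwap_mem ha hij hc hci hcj h
    rwa [tailSwap_tailSwap] at this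
  · intro h
    have := tailSwap_mem ha hij hc (by simpa using hcj) (by simpa using hci) h
    simpa using this

/-- This is what makes the exchange an involution. The swapped family still crosses at c, by the
chain condition in the old row j or because that row ends at c. An earlier crossing of the swapped
family would involve only entries that the exchange leaves alone, hence would be an earlier crossing
of f. -/
theorem FirstCrossing.tailSwap {a e : Fin n → ℤ} {f : Fin n × ℤ → ℕ} (ha : StrictAnti a)
    (hf : ∀ i, IsRowChain r a e i f)
    {c : ℤ} {i j : Fin n} (h : FirstCrossing r a e f c i j) :
    FirstCrossing r a (fun k => e (Equiv.swap i j k)) (fun x => f (tailSwap c i j x)) c i j := by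
  obtain ⟨⟨hij, hc, hci, hcj, hcr⟩, hmin⟩ := h
  have haij : a j < a i := ha (Fin.lt_def.2 (by omega))
  refine ⟨⟨hij, hc, by simpa using hcj, by simpa using hci, ?_⟩, ?_⟩
  · simp only [Equiv.swap_apply_left, SchurQSym.tailSwap, le_refl, if_true]
    rw [if_neg (by omega)]
    by_cases h : c = e j
    · exact Or.inl h
    · right
      have := hf j (c - 1) (by omega) (by omega)
      simpa using this
  · rintro c' i' j' ⟨hij', hc', hci', hcj', hcr'⟩
    by_contra hn
    refine hn (hmin c' i' j' ⟨hij', hc', ?_⟩)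
    have hle : ∀ k, c' ≤ e (Equiv.swap i j k) → c' ≤ e k := by
      intro k hk
      by_cases h1 : k = i
      · subst h1
        omega
      · by_cases h2 : k = j
        · subst h2
          omega
        · rwa [Equiv.swap_apply_of_ne_of_ne h1 h2] at hk
    refine ⟨hle _ hci', hle _ hcj', ?_⟩
    simp only [SchurQSym.tailSwap] at hcr'
    rw [if_neg (by omega)] at hcr'
    by_cases h1 : i' = i ∨ i' = j
    · have hlt : c' < c := by omega
      rw [if_neg (by omega)] at hcr'
      refine Or.inr (hcr'.resolve_left ?_)
      rcases h1 with rfl | rfl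
      · simp only [Equiv.swap_apply_left]
        omega
      · simp only [Equiv.swap_apply_right]
        omega
    · rw [not_or] at h1
      rw [Equiv.swap_apply_of_ne_of_ne h1.1 h1.2, ite_self] at hcr'
      exact hcr'

/-- Only the two seams at c can break a chain. The new row j is joined by the crossing relation; the
new row i is joined because there is no crossing at c - 1. The monomial is kept since the weight
depends only on the content. -/
theorem FirstCrossing.tailSwap_mem_fillings {a e : Fin n → ℤ} {f : Fin n × ℤ → ℕ}
    (ha : StrictAnti a) (htrans : ∀ x y z, r x y → r y z → r x z)
    (hcomp : ∀ x y z, ¬ r y x → r y z → r x z) {g : ℤ → ℕ+} {d : ℕ →₀ ℕ} {c : ℤ} {i j : Fin n}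
    (h : FirstCrossing r a e f c i j)
    (hf : f ∈ fillings (rowPlaces a e) (fun f => ∀ i, IsRowChain r a e i f) (fun x => g x.2) d) :
    (fun x => f (SchurQSym.tailSwap c i j x)) ∈
      fillings (rowPlaces a fun k => e (Equiv.swap i j k))
        (fun f => ∀ l, IsRowChain r a (fun k => e (Equiv.swap i j k)) l f) (fun x => g x.2) d := by
  obtain ⟨⟨hij, hc, hci, hcj, hcr⟩, hmin⟩ := h
  obtain ⟨h0, hrow, hd⟩ := hf
  have haij : a j < a i := ha (Fin.lt_def.2 (by omega))
  have hne : i ≠ j := by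
    rintro rfl
    omega
  refine ⟨fun x hx => h0 _ fun h => hx ((tailSwap_mem_iff ha hij hc hci hcj).1 h), ?_, ?_⟩
  · intro k y hy hy'
    simp only [SchurQSym.tailSwap] at hy hy' ⊢
    by_cases h1 : k = i
    · subst h1
      rw [Equiv.swap_apply_left] at hy' ⊢
      rcases lt_trichotomy (y + 1) c with h | h | h
      · rw [if_neg (by omega), if_neg (by omega)]
        exact hrow k y hy (by omega)
      · rw [if_neg (by omega), if_pos (by omega)]
        have hno : ¬ Crossing r a e f y k j := fun hcr => by
          have := hmin _ _ _ hcr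
          omega
        have hnr : ¬ r (f (j, y - 1)) (f (k, y)) := fun h' =>
          hno ⟨hij, hy, by omega, by omega, Or.inr h'⟩
        -- With y = c - 1, row j gives r from content y - 1 to y + 1, and the missing crossing at y
        -- lets `hcomp` replace its left end by the entry of row i at y.
        refine hcomp _ _ _ hnr (htrans _ _ _ ?_ (hrow j y (by omega) hy'))
        have := hrow j (y - 1) (by omega) (by omega)
        rwa [sub_add_cancel] at this
      · rw [if_pos (by omega), if_pos (by omega)]
        exact hrow j y (by omega) hy'
    · by_cases h2 : k = j
      · subst h2
        rw [Equiv.swap_apply_right] at hy' ⊢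
        rcases lt_trichotomy (y + 1) c with h | h | h
        · rw [if_neg (by omega), if_neg (by omega)]
          exact hrow k y hy (by omega)
        · rw [if_neg (by omega), if_pos (by omega)]
          have := hcr.resolve_left (by omega)
          rw [← h, add_sub_cancel_right] at this
          exact this
        · rw [if_pos (by omega), if_pos (by omega)]
          exact hrow i y (by omega) hy'
      · rw [Equiv.swap_apply_of_ne_of_ne h1 h2] at hy' ⊢
        simpa using hrow k y hy hy'
  · rw [← hd]
    refine Finset.sum_nbij' (SchurQSym.tailSwap c i j) (SchurQSym.tailSwap c i j) ?_ ?_ ?_ ?_ ?_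
    · exact fun x hx => (tailSwap_mem_iff ha hij hc hci hcj).2 hx
    · exact fun x hx => tailSwap_mem ha hij hc hci hcj hx
    · exact fun x _ => tailSwap_tailSwap _ _ _ _
    · exact fun x _ => tailSwap_tailSwap _ _ _ _
    · exact fun x _ => by simp only [tailSwap_snd]

theorem eq_one_of_strictAnti_comp {b : Fin n → ℤ} (hb : StrictAnti b)
    {σ : Equiv.Perm (Fin n)} (h : ∀ i j : Fin n, (j : ℕ) = i + 1 → b (σ j) < b (σ i)) :
    σ = 1 := by
  have hmono : StrictMono σ := by
    cases n with
    | zero => exact fun i => i.elim0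
    | succ n =>
      rw [Fin.strictMono_iff_lt_succ]
      exact fun i => hb.lt_iff_gt.1 (h i.castSucc i.succ (by simp))
  ext i
  have := Subsingleton.elim (hmono.orderIsoOfSurjective σ σ.surjective) (OrderIso.refl _)
  exact congrArg Fin.val (DFunLike.congr_fun this i)

variable (R : Type*) [CommRing R]

/-- The left side is a Jacobi–Trudi determinant expanded over permutations, the filter discarding
those that would give a row of negative length. Families with a crossing cancel in pairs; those
without one have σ = 1 and satisfy the column condition. -/
theorem sum_sign_smul_fillingSeries {a b : Fin n → ℤ} (ha : StrictAnti a) (hb : StrictAnti b)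
    (hab : ∀ i, a i ≤ b i)
    (htrans : ∀ x y z, r x y → r y z → r x z)
    (hcomp : ∀ x y z, ¬ r y x → r y z → r x z) (g : ℤ → ℕ+) :
    ∑ σ : Equiv.Perm (Fin n) with ∀ i, a i ≤ b (σ i), (Equiv.Perm.sign σ : ℤ) •
      fillingSeries R (rowPlaces a fun i => b (σ i))
        (fun f => ∀ i, IsRowChain r a (fun i => b (σ i)) i f) (fun x => g x.2) =
    fillingSeries R (rowPlaces a b) (fun f => (∀ i, IsRowChain r a b i f) ∧
      ∀ i j : Fin n, (j : ℕ) = i + 1 → ∀ c, a i ≤ c → c ≤ b j → ¬ r (f (j, c - 1)) (f (i, c)))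
      (fun x => g x.2) := by
  classical
  ext d
  rw [map_sum]
  simp only [map_zsmul, coeff_fillingSeries]
  have hfin := fun σ : Equiv.Perm (Fin n) => finite_fillings (rowPlaces a fun i => b (σ i))
    (fun f => ∀ i, IsRowChain r a (fun i => b (σ i)) i f) (fun x => g x.2) d
  let T : Finset (Σ _ : Equiv.Perm (Fin n), Fin n × ℤ → ℕ) :=
    Finset.sigma {σ : Equiv.Perm (Fin n) | ∀ i, a i ≤ b (σ i)} fun σ => (hfin σ).toFinset
  have hT : ∀ x, x ∈ T ↔ (∀ i, a i ≤ b (x.1 i)) ∧ x.2 ∈ fillings (rowPlaces a fun i => b (x.1 i))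
    (fun f => ∀ i, IsRowChain r a (fun i => b (x.1 i)) i f) (fun x => g x.2) d := by
    intro x
    simp [T]
  have hleft : ∑ σ : Equiv.Perm (Fin n) with ∀ i, a i ≤ b (σ i), (Equiv.Perm.sign σ : ℤ) •
      ((fillings (rowPlaces a fun i => b (σ i)) (fun f => ∀ i, IsRowChain r a (fun i => b (σ i)) i f)
        (fun x => g x.2) d).ncard : R) = ∑ x ∈ T, ((Equiv.Perm.sign x.1 : ℤ) : R) := by
    rw [Finset.sum_sigma]
    refine Finset.sum_congr rfl fun σ _ => ?_
    dsimp only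
    rw [Finset.sum_const, Set.ncard_eq_toFinset_card _ (hfin σ), zsmul_eq_mul, nsmul_eq_mul,
      mul_comm]
  rw [hleft, ← Finset.sum_filter_add_sum_filter_not T fun x =>
    ∃ c i j, Crossing r a (fun i => b (x.1 i)) x.2 c i j]
  have hzero : ∑ x ∈ T with ∃ c i j, Crossing r a (fun i => b (x.1 i)) x.2 c i j,
      ((Equiv.Perm.sign x.1 : ℤ) : R) = 0 := by
    have hex : ∀ x ∈ T.filter fun x => ∃ c i j, Crossing r a (fun i => b (x.1 i)) x.2 c i j,
        ∃ c i j, FirstCrossing r a (fun i => b (x.1 i)) x.2 c i j := fun x hx =>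
      exists_firstCrossing (Finset.mem_filter.1 hx).2
    choose c i j hfirst using hex
    have hnew := fun x hx => (hfirst x hx).tailSwap ha
      ((hT x).1 (Finset.mem_filter.1 hx).1).2.2.1
    have hne : ∀ x hx, i x hx ≠ j x hx := fun x hx h => by
      have := (hfirst x hx).1.1
      rw [h] at this
      omega
    have hmem : ∀ x hx, (⟨x.1 * Equiv.swap (i x hx) (j x hx),
        fun y => x.2 (tailSwap (c x hx) (i x hx) (j x hx) y)⟩ :
          Σ _ : Equiv.Perm (Fin n), Fin n × ℤ → ℕ) ∈
        T.filter fun x => ∃ c i j, Crossing r a (fun i => b (x.1 i)) x.2 c i j := by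
      intro x hx
      rw [Finset.mem_filter, hT]
      have hxT := (hT x).1 (Finset.mem_filter.1 hx).1
      refine ⟨⟨fun k => ?_, ?_⟩, _, _, _, (hnew x hx).1⟩
      · obtain ⟨h1, h2, h3, h4, -⟩ := (hfirst x hx).1
        dsimp only at h3 h4
        have := ha (show i x hx < j x hx from Fin.lt_def.2 (by omega))
        simp only [Equiv.Perm.mul_apply]
        by_cases hki : k = i x hx
        · rw [hki, Equiv.swap_apply_left]
          exact h2.trans h4
        · by_cases hkj : k = j x hx
          · rw [hkj, Equiv.swap_apply_right]
            exact this.le.trans (h2.trans h3)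
          · rw [Equiv.swap_apply_of_ne_of_ne hki hkj]
            exact hxT.1 k
      · exact (hfirst x hx).tailSwap_mem_fillings ha htrans hcomp hxT.2
    refine Finset.sum_involution (fun x hx => ⟨x.1 * Equiv.swap (i x hx) (j x hx),
      fun y => x.2 (tailSwap (c x hx) (i x hx) (j x hx) y)⟩) ?_ ?_ hmem ?_
    · intro x hx
      simp [Equiv.Perm.sign_mul, Equiv.Perm.sign_swap (hne x hx)]
    · intro x hx _ h
      have := congrArg Sigma.fst h
      simp only [mul_eq_left] at this
      exact hne x hx (Equiv.swap_eq_one_iff.1 this)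
    · intro x hx
      obtain ⟨e1, e2, e3⟩ := (hfirst _ (hmem x hx)).unique (hnew x hx)
      simp only [e1, e2, e3, tailSwap_tailSwap, mul_assoc, Equiv.swap_mul_self, mul_one]
  rw [hzero, zero_add]
  have hone : ∀ x ∈ T.filter fun x => ¬ ∃ c i j, Crossing r a (fun i => b (x.1 i)) x.2 c i j,
      x.1 = 1 := by
    intro x hx
    obtain ⟨hxT, hx⟩ := Finset.mem_filter.1 hx
    rw [hT] at hxT
    refine eq_one_of_strictAnti_comp hb fun i j hij => ?_
    by_contra hn
    -- If row i ends no later than row i + 1, the end of row i already counts as a crossing. Without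
    -- crossings the ends therefore strictly decrease, as b does.
    exact hx ⟨b (x.1 i), i, j, hij, hxT.1 i, le_rfl, not_lt.1 hn, Or.inl rfl⟩
  rw [Finset.sum_congr rfl fun x hx => by rw [hone x hx]]
  simp only [Equiv.Perm.sign_one, Units.val_one, Int.cast_one, Finset.sum_const, nsmul_eq_mul,
    mul_one]
  rw [Set.ncard_eq_toFinset_card _ (finite_fillings _ _ _ d)]
  congr 1
  have hcols : ∀ f : Fin n × ℤ → ℕ, (¬ ∃ c i j, Crossing r a b f c i j) ↔
      ∀ i j : Fin n, (j : ℕ) = i + 1 → ∀ c, a i ≤ c → c ≤ b j →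
        ¬ r (f (j, c - 1)) (f (i, c)) := by
    intro f
    constructor
    · intro h i j hij c h1 h2 h3
      have := hb (show i < j from Fin.lt_def.2 (by omega))
      exact h ⟨c, i, j, hij, h1, by omega, h2, Or.inr h3⟩
    · rintro h ⟨c, i, j, hij, h1, h2, h3, h4⟩
      have := hb (show i < j from Fin.lt_def.2 (by omega))
      exact h i j hij c h1 h3 (h4.resolve_left (by omega))
  refine Finset.card_nbij' (fun x => x.2) (fun f => ⟨1, f⟩) ?_ ?_ ?_ ?_
  · intro x hx
    have h1 := hone x hx
    obtain ⟨σ, f⟩ := x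
    dsimp only at h1
    subst h1
    rw [Finset.mem_coe, Finset.mem_filter, hT] at hx
    rw [Finset.mem_coe, Set.Finite.mem_toFinset]
    exact ⟨hx.1.2.1, ⟨hx.1.2.2.1, (hcols f).1 hx.2⟩, hx.1.2.2.2⟩
  · intro f hf
    rw [Finset.mem_coe, Set.Finite.mem_toFinset] at hf
    rw [Finset.mem_coe, Finset.mem_filter, hT]
    exact ⟨⟨hab, hf.1, hf.2.1.1, hf.2.2⟩, (hcols f).2 hf.2.1.2⟩
  · intro x hx
    exact Sigma.ext (hone x hx).symm HEq.rfl
  · exact fun f _ => rfl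

end TailSwap

/-! ### Bead configurations -/

section BeadCount

variable {n : ℕ}

/-- The number of beads beyond `c`. -/
def beadCount (β : Fin n → ℤ) (c : ℤ) : ℕ := (Finset.univ.filter fun l => c < β l).card

theorem card_val_lt (n m : ℕ) (h : m ≤ n) :
    (Finset.univ.filter fun l : Fin n => (l : ℕ) < m).card = m := by
  rw [Fin.card_filter_val_lt, min_eq_right h]

theorem beadCount_antitone (β : Fin n → ℤ) : Antitone (beadCount β) := fun c c' h =>
  Finset.card_le_card fun l hl => by
    rw [Finset.mem_filter] at hl ⊢
    exact ⟨hl.1, h.trans_lt hl.2⟩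

theorem beadCount_le (β : Fin n → ℤ) (c : ℤ) : beadCount β c ≤ n :=
  (Finset.card_filter_le _ _).trans (by simp)

theorem beadCount_add_card (β : Fin n → ℤ) (c : ℤ) :
    beadCount β (c + 1) + (Finset.univ.filter fun l => β l = c + 1).card = beadCount β c := by
  rw [beadCount, beadCount, ← Finset.card_union_of_disjoint]
  · congr 1
    ext l
    simp only [Finset.mem_union, Finset.mem_filter, Finset.mem_univ, true_and]
    omega
  · rw [Finset.disjoint_filter]
    intro l _ h
    omega

theorem beadCount_le_succ {β : Fin n → ℤ} (hβ : Function.Injective β) (c : ℤ) :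
    beadCount β c ≤ beadCount β (c + 1) + 1 := by
  rw [← beadCount_add_card]
  refine Nat.add_le_add_left (Finset.card_le_one.2 fun l hl m hm => hβ ?_) _
  rw [Finset.mem_filter] at hl hm
  exact hl.2.trans hm.2.symm

/-- For negative c the beads with index below -c lie beyond c. The bound guarantees that the place
on diagonal c in the row numbered by the bead count has a non-negative column. -/
theorem neg_le_beadCount {β : Fin n → ℤ} (hβ : ∀ l : Fin n, -((l : ℕ) : ℤ) ≤ β l) {c : ℤ} (hc : -(n : ℤ) ≤ c) :
    -c ≤ beadCount β c := by
  rcases le_or_gt 0 c with h | h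
  · omega
  obtain ⟨m, hm⟩ : ∃ m : ℕ, c = -m := ⟨(-c).toNat, by omega⟩
  have : m ≤ beadCount β c := by
    conv_lhs => rw [← card_val_lt n m (by omega)]
    refine Finset.card_le_card fun l hl => ?_
    rw [Finset.mem_filter] at hl ⊢
    have := hβ l
    exact ⟨hl.1, by omega⟩
  omega

theorem beadCount_eq_of_lt {β : Fin n → ℤ} (hβ : ∀ l : Fin n, -((l : ℕ) : ℤ) ≤ β l) {c : ℤ} (hc : c < -(n : ℤ)) :
    beadCount β c = n := by
  rw [beadCount, Finset.filter_true_of_mem, Finset.card_univ, Fintype.card_fin]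
  intro l _
  have := hβ l
  omega

theorem lt_beadCount_iff {β : Fin n → ℤ} (hβ : StrictAnti β) (i : ℕ) (c : ℤ) :
    i < beadCount β c ↔ ∃ h : i < n, c < β ⟨i, h⟩ := by
  constructor
  · intro h
    have hi : i < n := h.trans_le (beadCount_le _ _)
    refine ⟨hi, ?_⟩
    by_contra hn
    have : beadCount β c ≤ i := by
      conv_rhs => rw [← card_val_lt n i hi.le]
      refine Finset.card_le_card fun l hl => ?_
      rw [Finset.mem_filter] at hl ⊢
      refine ⟨hl.1, ?_⟩
      by_contra hl'
      have := hβ.antitone (show (⟨i, hi⟩ : Fin n) ≤ l from Fin.le_def.2 (by simpa using hl'))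
      omega
    omega
  · rintro ⟨hi, h⟩
    have : i + 1 ≤ beadCount β c := by
      conv_lhs => rw [← card_val_lt n (i + 1) hi]
      refine Finset.card_le_card fun l hl => ?_
      rw [Finset.mem_filter] at hl ⊢
      have := hβ.antitone (show l ≤ (⟨i, hi⟩ : Fin n) from Fin.le_def.2 (by simpa using hl.2))
      exact ⟨hl.1, by omega⟩
    exact this

/-- The beads after the first `k` of them have been moved from `a` to `e`. -/
def movedBeads (a e : Fin n → ℤ) (k : ℕ) (l : Fin n) : ℤ := if (l : ℕ) < k then e l else a l

theorem movedBeads_zero (a e : Fin n → ℤ) : movedBeads a e 0 = a := by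
  funext l
  simp [movedBeads]

theorem movedBeads_self (a e : Fin n → ℤ) : movedBeads a e n = e := by
  funext l
  simp [movedBeads]

theorem le_movedBeads {a e : Fin n → ℤ} (hae : ∀ l, a l ≤ e l) (k : ℕ) (l : Fin n) :
    a l ≤ movedBeads a e k l := by
  unfold movedBeads
  split_ifs
  · exact hae l
  · exact le_rfl

theorem movedBeads_injective {a e : Fin n → ℤ} (ha : StrictAnti a) (hae : ∀ l, a l ≤ e l)
    (he : Function.Injective e) (k : ℕ) : Function.Injective (movedBeads a e k) := by
  have key : ∀ l m : Fin n, (l : ℕ) < k → ¬ (m : ℕ) < k → e l ≠ a m := by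
    intro l m hl hm
    have := ha (show l < m from Fin.lt_def.2 (by omega))
    have := hae l
    omega
  intro l m h
  unfold movedBeads at h
  split_ifs at h with h1 h2 h2
  · exact he h
  · exact absurd h (key l m h1 h2)
  · exact absurd h.symm (key m l h2 h1)
  · exact ha.injective h

/-- A moving bead passes each content from a k to e k - 1 exactly once. In terms of shapes, every
such diagonal gains one box: this is the ribbon. -/
theorem beadCount_movedBeads_succ {a e : Fin n → ℤ} (hae : ∀ l, a l ≤ e l) (k : Fin n) (c : ℤ) :
    beadCount (movedBeads a e (k + 1)) c =
      beadCount (movedBeads a e k) c + if a k ≤ c ∧ c < e k then 1 else 0 := by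
  simp only [beadCount, Finset.card_filter]
  rw [← Finset.add_sum_erase _ _ (Finset.mem_univ k), ← Finset.add_sum_erase _ _ (Finset.mem_univ k)]
  have h1 : ∀ l ∈ Finset.univ.erase k, (if c < movedBeads a e (k + 1) l then 1 else 0) =
      if c < movedBeads a e k l then 1 else 0 := by
    intro l hl
    have : (l : ℕ) ≠ k := fun h => (Finset.mem_erase.1 hl).1 (Fin.ext h)
    have e : movedBeads a e (k + 1) l = movedBeads a e k l := by
      simp only [movedBeads, show (l : ℕ) < k + 1 ↔ (l : ℕ) < k by omega]
    rw [e]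
  rw [Finset.sum_congr rfl h1]
  have := hae k
  simp only [movedBeads, lt_add_one, if_true, lt_irrefl, if_false]
  split_ifs <;> omega

theorem beadCount_movedBeads_mono {a e : Fin n → ℤ} (hae : ∀ l, a l ≤ e l) (c : ℤ) {k m : ℕ}
    (h : k ≤ m) : beadCount (movedBeads a e k) c ≤ beadCount (movedBeads a e m) c :=
  Finset.card_le_card fun l hl => by
    rw [Finset.mem_filter] at hl ⊢
    refine ⟨hl.1, hl.2.trans_le ?_⟩
    unfold movedBeads
    have := hae l
    split_ifs <;> omega

/-- The earlier beads started beyond a k and only moved further; the later ones have not moved. This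
places the first box of the k-th ribbon in row k. -/
theorem beadCount_movedBeads_start {a e : Fin n → ℤ} (ha : StrictAnti a) (hae : ∀ l, a l ≤ e l)
    (k : Fin n) : beadCount (movedBeads a e k) (a k) = k := by
  conv_rhs => rw [← card_val_lt n k k.2.le]
  rw [beadCount]
  congr 1
  ext l
  rw [Finset.mem_filter, Finset.mem_filter, movedBeads]
  simp only [Finset.mem_univ, true_and]
  split_ifs with h
  · have := ha (show l < k from Fin.lt_def.2 h)
    have := hae l
    exact iff_of_true (by omega) h
  · have := ha.antitone (show k ≤ l from Fin.le_def.2 (by omega))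
    exact iff_of_false (by omega) h

/-- Two families of beads with the same counts differ by a permutation. -/
theorem exists_perm_of_beadCount_eq {b e : Fin n → ℤ} (hb : Function.Injective b)
    (h : ∀ c, beadCount e c = beadCount b c) : ∃ σ : Equiv.Perm (Fin n), ∀ i, e i = b (σ i) := by
  -- The number of beads at x is the drop of the count between x - 1 and x.
  have hcard : ∀ x, (Finset.univ.filter fun l => e l = x).card =
      (Finset.univ.filter fun l => b l = x).card := by
    intro x
    have h1 := beadCount_add_card e (x - 1)
    have h2 := beadCount_add_card b (x - 1)
    rw [h, h, ← h2, sub_add_cancel] at h1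
    exact Nat.add_left_cancel h1
  have hex : ∀ i, ∃ j, b j = e i := by
    intro i
    have : 0 < (Finset.univ.filter fun l => e l = e i).card :=
      Finset.card_pos.2 ⟨i, by simp⟩
    rw [hcard] at this
    obtain ⟨j, hj⟩ := Finset.card_pos.1 this
    exact ⟨j, (Finset.mem_filter.1 hj).2⟩
  choose s hs using hex
  have hinj : Function.Injective s := by
    intro i j hij
    have heq : e i = e j := by rw [← hs, ← hs, hij]
    have h1 : (Finset.univ.filter fun l => e l = e i).card ≤ 1 := by
      rw [hcard, Finset.card_le_one]
      intro l hl m hm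
      rw [Finset.mem_filter] at hl hm
      exact hb (hl.2.trans hm.2.symm)
    exact Finset.card_le_one.1 h1 i (by simp) j (by simp [heq])
  exact ⟨Equiv.ofBijective s (Finite.injective_iff_bijective.1 hinj), fun i => (hs i).symm⟩

end BeadCount

/-! ### Ribbons and their contents -/

namespace SkewDiagram

/-- The content `j - i` of the box `(i, j)`. -/
def content (u : ℕ × ℕ) : ℤ := (u.2 : ℤ) - u.1

/-- A skew diagram contains the whole rectangle between two of its boxes u ≤ v; here that rectangle
would include a 2 × 2 block at u. -/
theorem IsRibbon.not_lt_lt {θ : Finset (ℕ × ℕ)} (h : IsRibbon θ) {u v : ℕ × ℕ} (hu : u ∈ θ)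
    (hv : v ∈ θ) : ¬ (u.1 < v.1 ∧ u.2 < v.2) := by
  rintro ⟨h1, h2⟩
  obtain ⟨κ, rfl⟩ := h.isSkew
  have hmem : ∀ x : ℕ × ℕ, u ≤ x → x ≤ v → x ∈ κ.cells := by
    intro x hux hxv
    rw [mem_cells] at hu hv ⊢
    exact ⟨κ.outer.isLowerSet hxv hv.1, fun hx => hu.2 (κ.inner.isLowerSet hux hx)⟩
  refine h.no_block u.1 u.2 ⟨hu, hmem _ ?_ ?_, hmem _ ?_ ?_, hmem _ ?_ ?_⟩ <;>
    rw [Prod.le_def] <;> constructor <;> simp only <;> omega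

theorem IsRibbon.content_injOn {θ : Finset (ℕ × ℕ)} (h : IsRibbon θ) :
    Set.InjOn content (θ : Set (ℕ × ℕ)) := by
  intro u hu v hv huv
  have h1 := h.not_lt_lt hu hv
  have h2 := h.not_lt_lt hv hu
  unfold content at huv
  ext <;> omega

/-- A discrete intermediate value theorem: along a path of adjacent boxes the content changes by one
at each step. -/
theorem IsRibbon.exists_content_eq {θ : Finset (ℕ × ℕ)} (h : IsRibbon θ) {u v : ℕ × ℕ}
    (hu : u ∈ θ) (hv : v ∈ θ) {y : ℤ} (h1 : content u ≤ y) (h2 : y ≤ content v) :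
    ∃ x ∈ θ, content x = y := by
  have hc := h.connected u hu v hv
  induction hc generalizing y with
  | refl => exact ⟨u, hu, le_antisymm h1 h2⟩
  | @tail b c _ hbc ih =>
    by_cases hy : y ≤ content b
    · exact ih hbc.2.1 h1 hy
    · refine ⟨c, hv, le_antisymm ?_ h2⟩
      have := hbc.1
      unfold Adjacent at this
      unfold content at *
      omega

theorem IsRibbon.image_content {θ : Finset (ℕ × ℕ)} (h : IsRibbon θ) {u : ℕ × ℕ}
    (hu : IsBottomLeft θ u) :
    θ.image content = Finset.Ico (content u) (content u + θ.card) := by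
  have hcard : (θ.image content).card = θ.card := Finset.card_image_of_injOn h.content_injOn
  obtain ⟨v, hv, hmax⟩ := θ.exists_max_image content ⟨u, hu.1⟩
  have himg : θ.image content = Finset.Icc (content u) (content v) := by
    ext y
    rw [Finset.mem_image, Finset.mem_Icc]
    constructor
    · rintro ⟨x, hx, rfl⟩
      refine ⟨?_, hmax x hx⟩
      have := hu.2 x hx
      unfold content
      omega
    · exact fun hy => h.exists_content_eq hu.1 hv hy.1 hy.2
  have hle := hmax u hu.1
  rw [← hcard, himg, Int.card_Icc]
  ext y
  rw [Finset.mem_Icc, Finset.mem_Ico]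
  omega

/-! ### Partitions as bead configurations -/

section Rows

variable {κ : SkewDiagram} {n : ℕ}

variable (κ n) in
/-- The content of the first box of `λ/μ` in row `i`. -/
def rowStart (i : Fin n) : ℤ := κ.inner.rowLen i - i

variable (κ n) in
/-- The content of the first place after row `i` of `λ`. -/
def rowEnd (i : Fin n) : ℤ := κ.outer.rowLen i - i

theorem rowStart_strictAnti : StrictAnti (κ.rowStart n) := fun i j h => by
  have := κ.inner.rowLen_anti i j (Fin.le_def.1 h.le)
  have := Fin.lt_def.1 h
  unfold rowStart
  omega

theorem rowEnd_strictAnti : StrictAnti (κ.rowEnd n) := fun i j h => by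
  have := κ.outer.rowLen_anti i j (Fin.le_def.1 h.le)
  have := Fin.lt_def.1 h
  unfold rowEnd
  omega

theorem rowLen_inner_le (κ : SkewDiagram) (i : ℕ) : κ.inner.rowLen i ≤ κ.outer.rowLen i := by
  by_contra h
  have h1 := YoungDiagram.mem_iff_lt_rowLen.2 (not_le.1 h)
  have h2 := YoungDiagram.mem_iff_lt_rowLen.1 (κ.le h1)
  exact lt_irrefl _ h2

theorem rowStart_le_rowEnd (i : Fin n) : κ.rowStart n i ≤ κ.rowEnd n i := by
  have := κ.rowLen_inner_le i
  unfold rowStart rowEnd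
  omega

theorem neg_le_rowStart (i : Fin n) : -(i : ℤ) ≤ κ.rowStart n i := by
  unfold rowStart
  omega

/-- A row contains a box of content c exactly when its bead lies beyond c, provided the column is
non-negative. Beads decrease with the row, so these rows are the first ones. Rows beyond `numRows`
are allowed and have length 0. -/
theorem mem_outer_iff (hn : κ.numRows ≤ n) (u : ℕ × ℕ) :
    u ∈ κ.outer ↔ u.1 < beadCount (κ.rowEnd n) (content u) := by
  rw [lt_beadCount_iff rowEnd_strictAnti]
  constructor
  · intro h
    have h1 := lt_of_mem_outer h
    have h2 := YoungDiagram.mem_iff_lt_rowLen.1 h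
    refine ⟨h1.1.trans_le hn, ?_⟩
    unfold rowEnd content
    simp only
    omega
  · rintro ⟨h1, h2⟩
    unfold rowEnd content at h2
    simp only at h2
    exact YoungDiagram.mem_iff_lt_rowLen.2 (by omega)

theorem mem_inner_iff (hn : κ.numRows ≤ n) (u : ℕ × ℕ) :
    u ∈ κ.inner ↔ u.1 < beadCount (κ.rowStart n) (content u) := by
  rw [lt_beadCount_iff rowStart_strictAnti]
  constructor
  · intro h
    have h1 := lt_of_mem_outer (κ.le h)
    have h2 := YoungDiagram.mem_iff_lt_rowLen.1 h
    refine ⟨h1.1.trans_le hn, ?_⟩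
    unfold rowStart content
    simp only
    omega
  · rintro ⟨h1, h2⟩
    unfold rowStart content at h2
    simp only at h2
    exact YoungDiagram.mem_iff_lt_rowLen.2 (by omega)

end Rows

end SkewDiagram

theorem beadCount_le_add {n : ℕ} {β : Fin n → ℤ} (hβ : Function.Injective β) (c : ℤ) (m : ℕ) :
    beadCount β c ≤ beadCount β (c + m) + m := by
  induction m with
  | zero => simp
  | succ m ih =>
    have := beadCount_le_succ hβ (c + m)
    push_cast
    rw [← add_assoc c]
    omega

theorem beadCount_comp_perm {n : ℕ} (β : Fin n → ℤ) (σ : Equiv.Perm (Fin n)) (c : ℤ) :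
    beadCount (fun i => β (σ i)) c = beadCount β c := by
  simp only [beadCount, Finset.card_filter]
  exact Equiv.sum_comp σ fun i => if c < β i then 1 else 0

/-! ### Rim decompositions and permutations -/

namespace SkewDiagram

variable {κ : SkewDiagram} {n : ℕ}

theorem mem_boxes {θ : Finset κ.Box} {u : ℕ × ℕ} : u ∈ boxes θ ↔ ∃ h : u ∈ κ.cells, ⟨u, h⟩ ∈ θ := by
  simp [boxes]

theorem val_mem_boxes {θ : Finset κ.Box} {u : κ.Box} : u.1 ∈ boxes θ ↔ u ∈ θ := by
  rw [mem_boxes]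
  exact ⟨fun h => h.2, fun h => ⟨u.2, h⟩⟩

theorem card_boxes (θ : Finset κ.Box) : (boxes θ).card = θ.card := Finset.card_map _

/-- Rim decompositions with `n` ribbons that start from the leftmost boxes of the rows. -/
def IsRimByRows (Θ : Fin n → Finset κ.Box) : Prop :=
  IsRimDecomposition Θ ∧
    ∀ i, (Θ i).Nonempty → IsBottomLeft (boxes (Θ i)) (i, κ.inner.rowLen i)

/-- The ribbons of `Θ` lead from the beginning of row `i` to the end of row `σ i`. -/
def IsRowType (Θ : Fin n → Finset κ.Box) (σ : Equiv.Perm (Fin n)) : Prop :=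
  ∀ i, κ.rowStart n i + (Θ i).card = κ.rowEnd n (σ i)

theorem IsRowType.unique {Θ : Fin n → Finset κ.Box} {σ τ : Equiv.Perm (Fin n)}
    (hσ : IsRowType Θ σ) (hτ : IsRowType Θ τ) : σ = τ :=
  Equiv.ext fun i => rowEnd_strictAnti.injective ((hσ i).symm.trans (hτ i))

theorem IsRimByRows.image_content {Θ : Fin n → Finset κ.Box} (h : IsRimByRows Θ) (i : Fin n) :
    (boxes (Θ i)).image content =
      Finset.Ico (κ.rowStart n i) (κ.rowStart n i + (Θ i).card) := by
  rcases (Θ i).eq_empty_or_nonempty with h0 | h0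
  · simp [h0, boxes]
  · rw [(h.1.ribbon i h0).image_content (h.2 i h0), card_boxes]
    rfl

/-- A ribbon has at most one box on each diagonal. As the enlarged shape is again a partition, that
box must be the first one on its diagonal outside the shape already built. -/
theorem IsRimByRows.mem_boxes_iff_of_shape {Θ : Fin n → Finset κ.Box} (h : IsRimByRows Θ)
    {β : Fin n → ℤ} (hβ : ∀ l : Fin n, -((l : ℕ) : ℤ) ≤ β l) {k : Fin n}
    (hk : ∀ u : ℕ × ℕ, (u ∈ κ.inner ∨ ∃ l < k, u ∈ boxes (Θ l)) ↔ u.1 < beadCount β (content u))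
    (u : ℕ × ℕ) : u ∈ boxes (Θ k) ↔ κ.rowStart n k ≤ content u ∧
      content u < κ.rowStart n k + (Θ k).card ∧ u.1 = beadCount β (content u) := by
  have himg := h.image_content k
  have key : ∀ u ∈ boxes (Θ k), κ.rowStart n k ≤ content u ∧
      content u < κ.rowStart n k + (Θ k).card ∧ u.1 = beadCount β (content u) := by
    intro u hu
    have hcu := Finset.mem_image_of_mem content hu
    rw [himg, Finset.mem_Ico] at hcu
    refine ⟨hcu.1, hcu.2, ?_⟩
    obtain ⟨hκ, huΘ⟩ := mem_boxes.1 hu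
    have hrib := h.1.ribbon k ⟨_, huΘ⟩
    have hnot : ¬ u.1 < beadCount β (content u) := by
      rw [← hk]
      rintro (hin | ⟨l, hl, hul⟩)
      · exact (mem_cells.1 hκ).2 hin
      · exact Finset.disjoint_left.1 (h.1.disjoint l k hl.ne) (mem_boxes.1 hul).2 huΘ
    by_contra hne
    -- If the row of u exceeds the bead count, this bound puts u outside the first row and the first
    -- column, so the truncated subtractions below really give its upper left neighbour on the
    -- diagonal.
    have hneg : -content u ≤ beadCount β (content u) := by
      refine neg_le_beadCount hβ ?_
      have := neg_le_rowStart (κ := κ) k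
      have := k.2
      omega
    have hu2 : content u = (u.2 : ℤ) - u.1 := rfl
    have hx : content (u.1 - 1, u.2 - 1) = content u := by
      unfold content
      simp only
      omega
    have hmem := h.1.partition k (show ((u.1 - 1, u.2 - 1) : ℕ × ℕ) ≤ u from
      Prod.le_def.2 ⟨Nat.sub_le _ _, Nat.sub_le _ _⟩) (Or.inr ⟨k, le_rfl, hu⟩)
    have hprev : ((u.1 - 1, u.2 - 1) : ℕ × ℕ) ∈ κ.inner ∨
        ∃ l < k, ((u.1 - 1, u.2 - 1) : ℕ × ℕ) ∈ boxes (Θ l) := by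
      rcases hmem with hin | ⟨l, hl, hul⟩
      · exact Or.inl hin
      · rcases hl.lt_or_eq with hl | rfl
        · exact Or.inr ⟨l, hl, hul⟩
        · have := congrArg Prod.fst (hrib.content_injOn hul hu hx)
          simp only at this
          omega
    rw [hk, hx] at hprev
    simp only at hprev
    omega
  refine ⟨key u, fun ⟨h1, h2, h3⟩ => ?_⟩
  have : content u ∈ (boxes (Θ k)).image content := by
    rw [himg, Finset.mem_Ico]
    exact ⟨h1, h2⟩
  obtain ⟨x, hx, hxu⟩ := Finset.mem_image.1 this
  have h4 := (key x hx).2.2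
  rw [hxu, ← h3] at h4
  have : x = u := by
    unfold content at hxu
    ext <;> omega
  exact this ▸ hx

theorem IsRimByRows.shape_iff (hn : κ.numRows ≤ n) {Θ : Fin n → Finset κ.Box} (h : IsRimByRows Θ)
    (k : ℕ) (hk : k ≤ n) (u : ℕ × ℕ) :
    (u ∈ κ.inner ∨ ∃ l : Fin n, (l : ℕ) < k ∧ u ∈ boxes (Θ l)) ↔ u.1 < beadCount
      (movedBeads (κ.rowStart n) (fun i => κ.rowStart n i + (Θ i).card) k) (content u) := by
  induction k generalizing u with
  | zero =>
    rw [movedBeads_zero, mem_inner_iff hn]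
    simp
  | succ k ih =>
    have hae : ∀ i, κ.rowStart n i ≤ κ.rowStart n i + (Θ i).card := fun i => by omega
    have hstep := h.mem_boxes_iff_of_shape (k := ⟨k, hk⟩)
      (fun l => (neg_le_rowStart l).trans (le_movedBeads hae k l)) (ih (by omega)) u
    rw [beadCount_movedBeads_succ hae ⟨k, hk⟩]
    have hsplit : (u ∈ κ.inner ∨ ∃ l : Fin n, (l : ℕ) < k + 1 ∧ u ∈ boxes (Θ l)) ↔
        (u ∈ κ.inner ∨ ∃ l : Fin n, (l : ℕ) < k ∧ u ∈ boxes (Θ l)) ∨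
          u ∈ boxes (Θ ⟨k, hk⟩) := by
      rw [or_assoc]
      refine or_congr_right ⟨?_, ?_⟩
      · rintro ⟨l, hl, hu⟩
        rcases Nat.lt_succ_iff_lt_or_eq.1 hl with hl | hl
        · exact Or.inl ⟨l, hl, hu⟩
        · exact Or.inr ((Fin.ext hl : l = ⟨k, hk⟩) ▸ hu)
      · rintro (⟨l, hl, hu⟩ | hu)
        · exact ⟨l, by omega, hu⟩
        · exact ⟨⟨k, hk⟩, by simp, hu⟩
    rw [hsplit, ih (by omega), hstep]
    dsimp only
    split_ifs with hc <;> omega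

theorem IsRimByRows.mem_boxes_iff (hn : κ.numRows ≤ n) {Θ : Fin n → Finset κ.Box}
    (h : IsRimByRows Θ) (k : Fin n) (u : ℕ × ℕ) :
    u ∈ boxes (Θ k) ↔ κ.rowStart n k ≤ content u ∧
      content u < κ.rowStart n k + (Θ k).card ∧ u.1 = beadCount
        (movedBeads (κ.rowStart n) (fun i => κ.rowStart n i + (Θ i).card) k) (content u) :=
  h.mem_boxes_iff_of_shape
    (fun l => (neg_le_rowStart l).trans (le_movedBeads (fun i => by omega) k l))
    (h.shape_iff hn k k.2.le) u

/-- After all the moves the beads describe λ, so their counts agree with those of the row ends of λ,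
and the two bead families differ by a permutation. -/
theorem IsRimByRows.exists_rowType (hn : κ.numRows ≤ n) {Θ : Fin n → Finset κ.Box}
    (h : IsRimByRows Θ) : ∃ σ, IsRowType Θ σ := by
  refine exists_perm_of_beadCount_eq rowEnd_strictAnti.injective fun c => ?_
  have hb : ∀ l : Fin n, -((l : ℕ) : ℤ) ≤ κ.rowEnd n l := fun l =>
    (neg_le_rowStart l).trans (rowStart_le_rowEnd l)
  have he : ∀ l : Fin n, -((l : ℕ) : ℤ) ≤ κ.rowStart n l + (Θ l).card := fun l => by
    have := neg_le_rowStart (κ := κ) l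
    omega
  rcases lt_or_ge c (-(n : ℤ)) with hc | hc
  · rw [beadCount_eq_of_lt he hc, beadCount_eq_of_lt hb hc]
  have key : ∀ u : ℕ × ℕ,
      u.1 < beadCount (fun i => κ.rowStart n i + (Θ i).card) (content u) ↔
        u.1 < beadCount (κ.rowEnd n) (content u) := by
    intro u
    rw [← mem_outer_iff hn]
    have := h.shape_iff hn n le_rfl u
    rw [movedBeads_self] at this
    rw [← this]
    constructor
    · rintro (hu | ⟨l, -, hu⟩)
      · exact κ.le hu
      · exact (mem_cells.1 (mem_boxes.1 hu).1).1
    · intro hu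
      by_cases hin : u ∈ κ.inner
      · exact Or.inl hin
      · have huκ := mem_cells.2 ⟨hu, hin⟩
        obtain ⟨k, hk⟩ := h.1.cover ⟨u, huκ⟩
        exact Or.inr ⟨k, k.2, mem_boxes.2 ⟨huκ, hk⟩⟩
  have h1 := neg_le_beadCount he hc
  have h2 := neg_le_beadCount hb hc
  set x := beadCount (fun i => κ.rowStart n i + (Θ i).card) c with hx
  set y := beadCount (κ.rowEnd n) c with hy
  have hcont : ∀ i : ℕ, -c ≤ i → content (i, (i + c).toNat) = c := by
    intro i hi
    unfold content
    simp only
    omega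
  -- On diagonal c, the box in row x lies just outside the first shape and the one in row y just
  -- outside the second; equal shapes force x = y.
  have kx := key (x, (x + c).toNat)
  have ky := key (y, (y + c).toNat)
  rw [hcont x h1] at kx
  rw [hcont y h2] at ky
  simp only at kx ky
  omega

/-- The type fixes the sizes of the ribbons, and with the starting contents these sizes determine
every bead configuration and hence every box. -/
theorem IsRimByRows.eq_of_rowType (hn : κ.numRows ≤ n) {Θ Θ' : Fin n → Finset κ.Box}
    (h : IsRimByRows Θ) (h' : IsRimByRows Θ') {σ : Equiv.Perm (Fin n)} (hσ : IsRowType Θ σ)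
    (hσ' : IsRowType Θ' σ) : Θ = Θ' := by
  have hcard : ∀ i, (Θ i).card = (Θ' i).card := fun i => by
    have h1 := hσ i
    have h2 := hσ' i
    omega
  funext k
  ext u
  rw [← val_mem_boxes, ← val_mem_boxes, h.mem_boxes_iff hn, h'.mem_boxes_iff hn]
  simp only [hcard]

/-- Beads at distinct positions describe a partition: moving left raises the count or keeps it, and
moving up a row lowers it by at most one. -/
theorem lt_beadCount_of_le {β : Fin n → ℤ} (hβ : Function.Injective β) {u v : ℕ × ℕ} (huv : u ≤ v)
    (hv : v.1 < beadCount β (content v)) : u.1 < beadCount β (content u) := by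
  obtain ⟨h1, h2⟩ := Prod.le_def.1 huv
  have h3 := beadCount_antitone β (show (u.2 : ℤ) - v.1 ≤ content v by unfold content; omega)
  have h4 := beadCount_le_add hβ ((u.2 : ℤ) - v.1) (v.1 - u.1)
  have h5 : (u.2 : ℤ) - v.1 + (v.1 - u.1 : ℕ) = content u := by
    unfold content
    omega
  rw [h5] at h4
  omega

/-- The beads are moved one after another from a_i to b_{σ(i)}. All intermediate positions are
distinct, so each stage is a partition, and the boxes gained at stage k form the k-th ribbon. -/
theorem exists_isRimByRows (hn : κ.numRows ≤ n) {σ : Equiv.Perm (Fin n)}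
    (hσ : ∀ i, κ.rowStart n i ≤ κ.rowEnd n (σ i)) :
    ∃ Θ : Fin n → Finset κ.Box, IsRimByRows Θ ∧ IsRowType Θ σ := by
  classical
  set a := κ.rowStart n with ha
  set e : Fin n → ℤ := fun i => κ.rowEnd n (σ i) with he
  have hinj : ∀ k, Function.Injective (movedBeads a e k) := movedBeads_injective
    rowStart_strictAnti hσ (rowEnd_strictAnti.injective.comp σ.injective)
  set G : ℕ → ℤ → ℕ := fun k c => beadCount (movedBeads a e k) c with hG
  have hG0 : ∀ u, u ∈ κ.inner ↔ u.1 < G 0 (content u) := fun u => by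
    simp only [hG, movedBeads_zero]
    exact mem_inner_iff hn u
  have hGn : ∀ u, u ∈ κ.outer ↔ u.1 < G n (content u) := fun u => by
    simp only [hG, movedBeads_self]
    rw [he, beadCount_comp_perm]
    exact mem_outer_iff hn u
  have hGs : ∀ (k : Fin n) c, G (k + 1) c = G k c + if a k ≤ c ∧ c < e k then 1 else 0 :=
    beadCount_movedBeads_succ hσ
  have hGmono : ∀ c {k m : ℕ}, k ≤ m → G k c ≤ G m c := fun c _ _ h =>
    beadCount_movedBeads_mono hσ c h
  have hGanti : ∀ k, Antitone (G k) := fun k => beadCount_antitone _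
  have hGsucc : ∀ k c, G k c ≤ G k (c + 1) + 1 := fun k c => beadCount_le_succ (hinj k) c
  have hGneg : ∀ (k : Fin n) c, a k ≤ c → -c ≤ G k c := fun k c hc => by
    refine neg_le_beadCount (fun l => (neg_le_rowStart l).trans (le_movedBeads hσ k l)) ?_
    have h1 : -((k : ℕ) : ℤ) ≤ a k := neg_le_rowStart k
    have := k.2
    omega
  have hlower : ∀ k {u v : ℕ × ℕ}, u ≤ v → v.1 < G k (content v) → u.1 < G k (content u) :=
    fun k _ _ h1 h2 => lt_beadCount_of_le (hinj k) h1 h2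
  -- Every box of the m-th shape outside μ was added at some stage before m. This yields both the
  -- covering and the shapes of the partial unions.
  have hexists : ∀ (m : ℕ), m ≤ n → ∀ u : ℕ × ℕ, u.1 < G m (content u) → u ∈ κ.inner ∨
      ∃ l : Fin n, (l : ℕ) < m ∧ a l ≤ content u ∧ content u < e l ∧
        u.1 = G l (content u) := by
    intro m
    induction m with
    | zero => exact fun _ u hu => Or.inl ((hG0 u).2 hu)
    | succ m ih =>
      intro hm u hu
      by_cases hu' : u.1 < G m (content u)
      · obtain h | ⟨l, hl, h⟩ := ih (by omega) u hu'
        · exact Or.inl h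
        · exact Or.inr ⟨l, by omega, h⟩
      · have := hGs ⟨m, hm⟩ (content u)
        simp only at this
        refine Or.inr ⟨⟨m, hm⟩, by simp, ?_⟩
        simp only
        split_ifs at this with hc
        · exact ⟨hc.1, hc.2, by omega⟩
        · omega
  let Θ : Fin n → Finset κ.Box := fun k => Finset.univ.filter fun u =>
    a k ≤ content u.1 ∧ content u.1 < e k ∧ u.1.1 = G k (content u.1)
  have hlt : ∀ (k : Fin n) (u : ℕ × ℕ), a k ≤ content u → content u < e k →
      u.1 = G k (content u) → u.1 < G (k + 1) (content u) := by
    intro k u h1 h2 h3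
    rw [hGs, if_pos ⟨h1, h2⟩]
    omega
  have hΘ : ∀ (k : Fin n) (u : ℕ × ℕ), u ∈ boxes (Θ k) ↔
      a k ≤ content u ∧ content u < e k ∧ u.1 = G k (content u) := by
    intro k u
    rw [mem_boxes]
    simp only [Θ, Finset.mem_filter, Finset.mem_univ, true_and]
    refine ⟨fun h => h.2, fun h => ⟨mem_cells.2 ⟨?_, ?_⟩, h⟩⟩
    · rw [hGn]
      exact (hlt k u h.1 h.2.1 h.2.2).trans_le (hGmono _ k.2)
    · rw [hG0, h.2.2, not_lt]
      exact hGmono _ (Nat.zero_le _)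
  -- The first place on diagonal c outside the k-th shape; it parametrizes the k-th ribbon by
  -- content.
  let p : Fin n → ℤ → ℕ × ℕ := fun k c => (G k c, (G k c + c).toNat)
  have hpc : ∀ k c, a k ≤ c → content (p k c) = c := by
    intro k c hc
    have := hGneg k c hc
    simp only [content, p]
    omega
  have hp : ∀ k c, a k ≤ c → c < e k → p k c ∈ boxes (Θ k) := by
    intro k c h1 h2
    rw [hΘ, hpc k c h1]
    exact ⟨h1, h2, rfl⟩
  have hup : ∀ k, ∀ u ∈ boxes (Θ k), u = p k (content u) := by
    intro k u hu
    obtain ⟨h1, h2, h3⟩ := (hΘ k u).1 hu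
    have h4 := hpc k _ h1
    have h5 : (p k (content u)).1 = u.1 := h3.symm
    generalize p k (content u) = x at h4 h5
    unfold content at h4
    ext <;> omega
  have hcard : ∀ k, a k + (Θ k).card = e k := by
    intro k
    have himg : (boxes (Θ k)).image content = Finset.Ico (a k) (e k) := by
      ext c
      rw [Finset.mem_image, Finset.mem_Ico]
      constructor
      · rintro ⟨u, hu, rfl⟩
        have := (hΘ k u).1 hu
        exact ⟨this.1, this.2.1⟩
      · exact fun hc => ⟨p k c, hp k c hc.1 hc.2, hpc k c hc.1⟩
    have := congrArg Finset.card himg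
    rw [Finset.card_image_of_injOn, card_boxes, Int.card_Ico] at this
    · have h3 : a k ≤ e k := hσ k
      omega
    · intro u hu v hv huv
      rw [hup k u hu, hup k v hv, huv]
  let shape : ℕ → YoungDiagram := fun k =>
    ⟨κ.outer.cells.filter fun u => u.1 < G k (content u), fun u v hvu hu => by
      rw [Finset.mem_coe, Finset.mem_filter] at hu ⊢
      exact ⟨κ.outer.isLowerSet hvu hu.1, hlower k hvu hu.2⟩⟩
  have hshape : ∀ k u, u ∈ shape k ↔ u ∈ κ.outer ∧ u.1 < G k (content u) := fun k u =>
    Finset.mem_filter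
  have hbl : ∀ i, (Θ i).Nonempty → IsBottomLeft (boxes (Θ i)) (i, κ.inner.rowLen i) := by
    rintro i ⟨u, hu⟩
    have hstart : G i (a i) = i := beadCount_movedBeads_start rowStart_strictAnti hσ i
    have hai : a i = (κ.inner.rowLen i : ℤ) - i := rfl
    have hu' := (hΘ i u).1 (val_mem_boxes.2 hu)
    refine ⟨?_, fun v hv => ?_⟩
    · have : ((i : ℕ), κ.inner.rowLen i) = p i (a i) := by
        simp only [p, hstart]
        ext <;> simp only <;> omega
      rw [this]
      exact hp i _ le_rfl (by omega)
    · obtain ⟨h1, h2, h3⟩ := (hΘ i v).1 hv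
      have h4 := hGanti i h1
      -- Antitonicity bounds the row of v by i; this lower bound on the row, combined with the
      -- content of v, keeps its column from dropping below μ_i.
      have h5 : ∀ m : ℕ, G i (a i) ≤ G i (a i + m) + m := beadCount_le_add (hinj i) _
      have h5 := h5 (content v - a i).toNat
      rw [show a i + ((content v - a i).toNat : ℤ) = content v by omega] at h5
      have hv2 : content v = (v.2 : ℤ) - v.1 := rfl
      simp only
      omega
  refine ⟨Θ, ⟨⟨fun k hk => ?_, fun k l hkl => ?_, fun u => ?_, fun k => ?_⟩, hbl⟩, hcard⟩
  · refine ⟨⟨⟨shape (k + 1), shape k, fun u hu => ?_⟩, ?_⟩, ?_, fun u hu v hv => ?_, ?_⟩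
    · have hu := (hshape _ _).1 hu
      exact (hshape _ _).2 ⟨hu.1, hu.2.trans_le (hGmono _ (Nat.le_succ _))⟩
    · ext u
      rw [mem_cells, hshape, hshape, hΘ]
      have := hGs k (content u)
      constructor
      · rintro ⟨⟨h1, h2⟩, h3⟩
        have h3 : ¬ u.1 < G k (content u) := fun h => h3 ⟨h1, h⟩
        split_ifs at this with hc
        · exact ⟨hc.1, hc.2, by omega⟩
        · omega
      · rintro ⟨h1, h2, h3⟩
        have h4 := hlt k u h1 h2 h3
        exact ⟨⟨(hGn u).2 (h4.trans_le (hGmono _ k.2)), h4⟩, fun h => by omega⟩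
    · obtain ⟨u, hu⟩ := hk
      exact ⟨u.1, val_mem_boxes.2 hu⟩
    · have chain : ∀ c c', c ≤ c' → a k ≤ c → c' < e k → Relation.ReflTransGen
          (fun x y => Adjacent x y ∧ x ∈ boxes (Θ k) ∧ y ∈ boxes (Θ k)) (p k c) (p k c') := by
        intro c c' hcc'
        induction c', hcc' using Int.leInduction with
        | base => exact fun _ _ => Relation.ReflTransGen.refl
        | succ d hd ih =>
          intro h1 h2
          -- From one content to the next the count stays or drops by one, which is a step to the
          -- right or a step up.
          refine (ih h1 (by omega)).tail ⟨?_, hp k d (by omega) (by omega),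
            hp k (d + 1) (by omega) h2⟩
          have e1 := hGneg k d (by omega)
          have e2 := hGneg k (d + 1) (by omega)
          have e3 := hGsucc k d
          have e4 := hGanti k (show d ≤ d + 1 by omega)
          simp only [Adjacent, p]
          omega
      have symm : Std.Symm
          (fun x y => Adjacent x y ∧ x ∈ boxes (Θ k) ∧ y ∈ boxes (Θ k)) := by
        constructor
        rintro x y ⟨h1, h2, h3⟩
        refine ⟨?_, h3, h2⟩
        unfold Adjacent at *
        omega
      have hu' := (hΘ k u).1 hu
      have hv' := (hΘ k v).1 hv
      rw [hup k u hu, hup k v hv]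
      rcases le_total (content u) (content v) with h | h
      · exact chain _ _ h hu'.1 hv'.2.1
      · exact Relation.ReflTransGen.stdSymm.symm _ _ (chain _ _ h hv'.1 hu'.2.1)
    · rintro i j ⟨h1, -, -, h2⟩
      have h1 := ((hΘ k _).1 h1).2.2
      have h2 := ((hΘ k _).1 h2).2.2
      have : content (i + 1, j + 1) = content (i, j) := by
        unfold content
        simp only
        omega
      rw [this] at h2
      simp only at h1 h2
      omega
  · have key : ∀ {k l : Fin n}, k < l → Disjoint (Θ k) (Θ l) := by
      intro k l hkl
      rw [Finset.disjoint_left]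
      intro u hk hl
      obtain ⟨h1, h2, h3⟩ := (hΘ k u).1 (val_mem_boxes.2 hk)
      have h4 := ((hΘ l u).1 (val_mem_boxes.2 hl)).2.2
      have h5 := hlt k u h1 h2 h3
      have h6 := hGmono (content u.1) (Nat.succ_le_of_lt (Fin.lt_def.1 hkl))
      simp only [Nat.succ_eq_add_one] at h6
      omega
    rcases lt_or_gt_of_ne hkl with h | h
    · exact key h
    · exact (key h).symm
  · have hu := mem_cells.1 u.2
    obtain h | ⟨l, -, h⟩ := hexists n le_rfl u.1 ((hGn u).1 hu.1)
    · exact absurd h hu.2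
    · exact ⟨l, val_mem_boxes.1 ((hΘ l u).2 h)⟩
  · have hset : {u : ℕ × ℕ | u ∈ κ.inner.cells ∨ ∃ l ≤ k, u ∈ boxes (Θ l)} =
        {u | u.1 < G (k + 1) (content u)} := by
      ext u
      simp only [Set.mem_ofPred_eq]
      constructor
      · rintro (h | ⟨l, hl, h⟩)
        · exact ((hG0 u).1 h).trans_le (hGmono _ (Nat.zero_le _))
        · obtain ⟨h1, h2, h3⟩ := (hΘ l u).1 h
          exact (hlt l u h1 h2 h3).trans_le (hGmono _ (by simpa using Fin.le_def.1 hl))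
      · intro h
        obtain h | ⟨l, hl, h⟩ := hexists (k + 1) k.2 u h
        · exact Or.inl h
        · exact Or.inr ⟨l, Fin.le_def.2 (by omega), (hΘ l u).2 h⟩
    rw [hset]
    exact fun u v hvu hu => hlower _ hvu hu

/-- No box lies strictly below and to the right of another, so contents strictly increase in reading
order. A diagonal filling is therefore read off along the interval of contents, with no further
dependence on the shape of the ribbon. -/
theorem wordH_eq_of_image_content {θ : Finset κ.Box} {s : ℤ}
    (hθ : ∀ u ∈ boxes θ, ∀ v ∈ boxes θ, ¬ (u.1 < v.1 ∧ u.2 < v.2))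
    (himg : (boxes θ).image content = Finset.Ico s (s + θ.card)) {γ : κ.Tableau ℕ+}
    {g : ℤ → ℕ+} (hg : ∀ u, γ u = g (content u.1)) :
    wordH θ γ = (List.range θ.card).map fun k : ℕ => g (s + k) := by
  have hcont : (θ.sort readLE).map (fun u => content u.1) =
      (List.range θ.card).map fun k : ℕ => s + k := by
    have hpair : ((θ.sort readLE).map fun u => content u.1).Pairwise (· < ·) := by
      rw [List.pairwise_map]
      have hnd := θ.sort_nodup readLE
      refine ((Finset.pairwise_sort θ readLE).and hnd).imp_of_mem ?_
      intro u v hu hv huv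
      rw [Finset.mem_sort] at hu hv
      have h1 := hθ _ (val_mem_boxes.2 hv) _ (val_mem_boxes.2 hu)
      obtain ⟨h2, h3⟩ := huv
      have h3 : u.1 ≠ v.1 := fun h => h3 (Subtype.ext h)
      unfold readLE at h2
      unfold content
      rcases h2 with h2 | ⟨h2, h4⟩
      · omega
      · have : u.1.2 ≠ v.1.2 := fun h => h3 (Prod.ext h2 h)
        omega
    have hpair' : ((List.range θ.card).map fun k : ℕ => s + k).Pairwise
        (· < ·) := by
      rw [List.pairwise_map]
      exact List.pairwise_lt_range.imp fun h => by omega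
    refine List.Perm.eq_of_pairwise (fun a b _ _ h1 h2 => absurd h1 h2.not_gt) hpair hpair' ?_
    rw [List.perm_ext_iff_of_nodup (hpair.imp fun h => h.ne) (hpair'.imp fun h => h.ne)]
    intro c
    have hc := Finset.ext_iff.1 himg c
    rw [Finset.mem_image, Finset.mem_Ico] at hc
    simp only [List.mem_map, Finset.mem_sort, List.mem_range]
    constructor
    · rintro ⟨u, hu, rfl⟩
      have := hc.1 ⟨u.1, val_mem_boxes.2 hu, rfl⟩
      exact ⟨(content u.1 - s).toNat, by omega, by omega⟩
    · rintro ⟨k, hk, rfl⟩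
      obtain ⟨u, hu, huc⟩ := hc.2 ⟨by omega, by omega⟩
      obtain ⟨h1, h2⟩ := mem_boxes.1 hu
      exact ⟨_, h2, huc⟩
  have := congrArg (List.map g) hcont
  rw [List.map_map, List.map_map] at this
  rw [wordH, show γ = g ∘ fun u => content u.1 from funext hg, this]
  rfl

theorem IsRimByRows.not_lt_lt {Θ : Fin n → Finset κ.Box} (h : IsRimByRows Θ) (i : Fin n) :
    ∀ u ∈ boxes (Θ i), ∀ v ∈ boxes (Θ i), ¬ (u.1 < v.1 ∧ u.2 < v.2) := fun _ hu _ hv =>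
  (h.1.ribbon i ⟨_, (mem_boxes.1 hu).2⟩).not_lt_lt hu hv

theorem IsRimByRows.wordH_eq {Θ : Fin n → Finset κ.Box} (h : IsRimByRows Θ) {γ : κ.Tableau ℕ+}
    {g : ℤ → ℕ+} (hg : ∀ u, γ u = g (content u.1)) (i : Fin n) :
    wordH (Θ i) γ = (List.range (Θ i).card).map fun k : ℕ => g (κ.rowStart n i + k) :=
  wordH_eq_of_image_content (h.not_lt_lt i) (h.image_content i) hg

end SkewDiagram

theorem forall_lt_of_forall_succ {r : ℕ → ℕ → Prop} (htrans : ∀ x y z, r x y → r y z → r x z)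
    {h : ℤ → ℕ} {a b : ℤ} (hr : ∀ c, a ≤ c → c + 1 < b → r (h c) (h (c + 1))) {c c' : ℤ}
    (hc : a ≤ c) (hcc' : c < c') (hc' : c' < b) : r (h c) (h c') := by
  replace hcc' : c + 1 ≤ c' := hcc'
  induction c', hcc' using Int.leInduction with
  | base => exact hr c hc hc'
  | succ d hd ih => exact htrans _ _ _ (ih (by omega)) (hr d (by omega) hc')

/-- The generating function of the words with consecutive letters of given contents. -/
theorem genFun_chain_eq_fillingSeries (R : Type*) [CommRing R] {n : ℕ} {r : ℕ → ℕ → Prop}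
    (htrans : ∀ x y z, r x y → r y z → r x z) (g : ℤ → ℕ+) {a e : Fin n → ℤ} (i : Fin n) (m : ℕ)
    (hm : a i + m = e i) {l : List ℕ+} (hl : l = (List.range m).map fun k : ℕ => g (a i + k)) :
    genFun R (fun f : Fin l.length → ℕ => ∀ x y, x < y → r (f x) (f y)) l.get =
      fillingSeries R ({i} ×ˢ Finset.Ico (a i) (e i)) (IsRowChain r a e i) (fun x => g x.2) := by
  subst hl
  have hlen : ((List.range m).map fun k : ℕ => g (a i + k)).length = m := by simp
  let E : Fin ((List.range m).map fun k : ℕ => g (a i + k)).length ≃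
      ({i} ×ˢ Finset.Ico (a i) (e i) : Finset (Fin n × ℤ)) :=
    { toFun := fun k => ⟨(i, a i + (k : ℕ)), by
        have := k.2.trans_eq hlen
        simp only [Finset.mem_product, Finset.mem_singleton, Finset.mem_Ico, true_and]
        exact ⟨by omega, by omega⟩⟩
      invFun := fun x => ⟨(x.1.2 - a i).toNat, by
        have := x.2
        simp only [Finset.mem_product, Finset.mem_singleton, Finset.mem_Ico] at this
        rw [hlen]
        omega⟩
      left_inv := fun k => by simp
      right_inv := fun x => by
        have := x.2
        simp only [Finset.mem_product, Finset.mem_singleton, Finset.mem_Ico] at this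
        ext
        · exact congrArg Fin.val this.1.symm
        · simp only
          omega }
  refine genFun_eq_fillingSeries R E (fun f => ?_) fun k => ?_
  · constructor
    · intro h x y hxy
      have hy := y.2.trans_eq hlen
      exact forall_lt_of_forall_succ htrans (h := fun c => f (i, c)) h (by omega)
        (by have := Fin.lt_def.1 hxy; omega) (by omega)
    · intro h c hc hc'
      have := h ⟨(c - a i).toNat, by rw [hlen]; omega⟩ ⟨(c + 1 - a i).toNat, by rw [hlen]; omega⟩
        (Fin.lt_def.2 (by simp only; omega))
      simp only [E, Equiv.coe_fn_mk] at this
      rwa [show a i + ((c - a i).toNat : ℤ) = c by omega,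
        show a i + ((c + 1 - a i).toNat : ℤ) = c + 1 by omega] at this
  · simp [E]

/-! ### Expansion of chain tableaux over rim decompositions -/

namespace SkewDiagram

variable {κ : SkewDiagram} {n : ℕ}

/-- The rows are chains for `r`, and the columns are chains for its negated converse. -/
def IsChainTableau (r : ℕ → ℕ → Prop) (T : κ.Tableau ℕ) : Prop :=
  (∀ u v : κ.Box, u.1.1 = v.1.1 → u.1.2 < v.1.2 → r (T u) (T v)) ∧
    ∀ u v : κ.Box, u.1.2 = v.1.2 → u.1.1 < v.1.1 → ¬ r (T v) (T u)

theorem mem_cells_iff {i j : ℕ} :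
    (i, j) ∈ κ.cells ↔ κ.inner.rowLen i ≤ j ∧ j < κ.outer.rowLen i := by
  rw [mem_cells, YoungDiagram.mem_iff_lt_rowLen, YoungDiagram.mem_iff_lt_rowLen, not_lt, and_comm]

theorem Box.bounds (u : κ.Box) : κ.inner.rowLen u.1.1 ≤ u.1.2 ∧ u.1.2 < κ.outer.rowLen u.1.1 :=
  mem_cells_iff.1 u.2

/-- Boxes as pairs of a row and a content. -/
def boxEquiv (κ : SkewDiagram) (hn : κ.numRows ≤ n) :
    κ.Box ≃ rowPlaces (κ.rowStart n) (κ.rowEnd n) where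
  toFun u := ⟨(⟨u.1.1, (lt_of_mem_outer (mem_cells.1 u.2).1).1.trans_le hn⟩, content u.1), by
    have := u.bounds
    rw [mem_rowPlaces]
    simp only [rowStart, rowEnd, content]
    omega⟩
  invFun x := ⟨(x.1.1, (x.1.2 + x.1.1).toNat), by
    have := mem_rowPlaces.1 x.2
    simp only [rowStart, rowEnd] at this
    rw [mem_cells_iff]
    omega⟩
  left_inv u := by
    ext
    · rfl
    · simp only [content]
      omega
  right_inv x := by
    have := mem_rowPlaces.1 x.2
    simp only [rowStart, rowEnd] at this
    ext
    · rfl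
    · simp only [content]
      omega

/-- Conditions between neighbours suffice: `htrans` propagates them along rows and `hcomp` down
columns, whose intermediate boxes lie in the diagram by convexity. In row and content coordinates,
the box below content c has content c - 1. -/
theorem isChainTableau_iff {r : ℕ → ℕ → Prop} (htrans : ∀ x y z, r x y → r y z → r x z)
    (hcomp : ∀ x y z, ¬ r y x → r y z → r x z) (hn : κ.numRows ≤ n) (f : Fin n × ℤ → ℕ) :
    ((∀ i, IsRowChain r (κ.rowStart n) (κ.rowEnd n) i f) ∧
      ∀ i j : Fin n, (j : ℕ) = i + 1 → ∀ c, κ.rowStart n i ≤ c → c ≤ κ.rowEnd n j →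
        ¬ r (f (j, c - 1)) (f (i, c))) ↔
      IsChainTableau r fun u => f (κ.boxEquiv hn u) := by
  have hlt : ∀ u : κ.Box, u.1.1 < n := fun u =>
    (lt_of_mem_outer (mem_cells.1 u.2).1).1.trans_le hn
  constructor
  · rintro ⟨hrow, hcol⟩
    refine ⟨fun u v h1 h2 => ?_, ?_⟩
    · have hu := u.bounds
      have hv := v.bounds
      have := forall_lt_of_forall_succ htrans (h := fun c => f (⟨u.1.1, hlt u⟩, c))
        (hrow ⟨u.1.1, hlt u⟩) (c := content u.1) (c' := content v.1)
        (by simp only [rowStart, content]; omega) (by simp only [content]; omega)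
        (by simp only [rowEnd, content, h1]; omega)
      simpa only [boxEquiv, Equiv.coe_fn_mk, h1] using this
    · have key : ∀ i i' j : ℕ, i + 1 ≤ i' → ∀ (h : (i, j) ∈ κ.cells) (h' : (i', j) ∈ κ.cells),
          ¬ r (f (κ.boxEquiv hn ⟨_, h'⟩)) (f (κ.boxEquiv hn ⟨_, h⟩)) := by
        intro i i' j hi
        induction i', hi using Nat.le_induction with
        | base =>
          intro h h'
          have h1 := mem_cells_iff.1 h
          have h2 := mem_cells_iff.1 h'
          have := hcol ⟨i, hlt ⟨_, h⟩⟩ ⟨i + 1, hlt ⟨_, h'⟩⟩ rfl (content (i, j))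
            (by simp only [rowStart, content]; omega) (by simp only [rowEnd, content]; omega)
          rw [show content (i, j) - 1 = content (i + 1, j) by
            simp only [content]; omega] at this
          exact this
        | succ d hd ih =>
          intro h h'
          have hm : (d, j) ∈ κ.cells := by
            rw [mem_cells] at h h' ⊢
            refine ⟨κ.outer.isLowerSet (Prod.mk_le_mk.2 ⟨Nat.le_succ d, le_rfl⟩) h'.1,
              fun hin => h.2 (κ.inner.isLowerSet (Prod.mk_le_mk.2 ⟨by omega, le_rfl⟩) hin)⟩
          have h1 := mem_cells_iff.1 hm
          have h2 := mem_cells_iff.1 h'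
          have := hcol ⟨d, hlt ⟨_, hm⟩⟩ ⟨d + 1, hlt ⟨_, h'⟩⟩ rfl (content (d, j))
            (by simp only [rowStart, content]; omega) (by simp only [rowEnd, content]; omega)
          rw [show content (d, j) - 1 = content (d + 1, j) by
            simp only [content]; omega] at this
          exact fun h3 => ih h hm (hcomp _ _ _ this h3)
      rintro ⟨⟨i, j⟩, hu⟩ ⟨⟨i', j'⟩, hv⟩ h1 h2
      simp only at h1 h2
      subst h1
      exact key i i' j h2 hu hv
  · rintro ⟨hrow, hcol⟩
    have hval : ∀ x (hx : x ∈ rowPlaces (κ.rowStart n) (κ.rowEnd n)),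
        f (κ.boxEquiv hn ((κ.boxEquiv hn).symm ⟨x, hx⟩)) = f x := fun x hx => by
      rw [Equiv.apply_symm_apply]
    refine ⟨fun i c hc hc' => ?_, fun i j hij c hc hc' => ?_⟩
    · have h1 : (i, c) ∈ rowPlaces (κ.rowStart n) (κ.rowEnd n) :=
        mem_rowPlaces.2 ⟨hc, by simp only; omega⟩
      have h2 : (i, c + 1) ∈ rowPlaces (κ.rowStart n) (κ.rowEnd n) :=
        mem_rowPlaces.2 ⟨by simp only; omega, hc'⟩
      rw [← hval _ h1, ← hval _ h2]
      refine hrow _ _ rfl ?_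
      unfold rowStart at hc
      simp only [boxEquiv, Equiv.coe_fn_symm_mk]
      omega
    · have hlt := Fin.lt_def.2 (show (i : ℕ) < j by omega)
      have hs := rowStart_strictAnti (κ := κ) hlt
      have he := rowEnd_strictAnti (κ := κ) hlt
      have h1 : (i, c) ∈ rowPlaces (κ.rowStart n) (κ.rowEnd n) :=
        mem_rowPlaces.2 ⟨hc, by simp only; omega⟩
      have h2 : (j, c - 1) ∈ rowPlaces (κ.rowStart n) (κ.rowEnd n) :=
        mem_rowPlaces.2 ⟨by simp only; omega, by simp only; omega⟩
      rw [← hval _ h1, ← hval _ h2]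
      refine hcol _ _ ?_ ?_
      · simp only [boxEquiv, Equiv.coe_fn_symm_mk]
        congr 1
        omega
      · simp only [boxEquiv, Equiv.coe_fn_symm_mk]
        omega

/-- The sign of the row type. -/
def rowSign (Θ : Fin n → Finset κ.Box) : ℤ :=
  Equiv.Perm.sign (Classical.epsilon (IsRowType Θ))

-- Tail exchange turns the tableaux into a signed sum over permutations, and the row type is a
-- bijection from rim decompositions onto the permutations that occur. Ribbon θ_i and the i-th row
-- word have the same contents, hence the same series. Leaving n free avoids transport along the
-- equality between the rows of a conjugate diagram and the columns of the original.
open Classical in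
theorem genFun_isChainTableau (R : Type*) [CommRing R] {r : ℕ → ℕ → Prop}
    (htrans : ∀ x y z, r x y → r y z → r x z) (hcomp : ∀ x y z, ¬ r y x → r y z → r x z)
    (hn : κ.numRows ≤ n) {γ : κ.Tableau ℕ+} {g : ℤ → ℕ+} (hg : ∀ u, γ u = g (content u.1)) :
    genFun R (fun T : κ.Box → ℕ => IsChainTableau r T) γ =
      ∑ Θ : Fin n → Finset κ.Box with IsRimByRows Θ, rowSign Θ •
        ∏ i, genFun R (fun f : Fin (wordH (Θ i) γ).length → ℕ => ∀ x y, x < y → r (f x) (f y))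
          (wordH (Θ i) γ).get := by
  rw [genFun_eq_fillingSeries R (κ.boxEquiv hn)
    (fun f => isChainTableau_iff htrans hcomp hn f) (w := fun x => g x.2) hg,
    ← sum_sign_smul_fillingSeries R rowStart_strictAnti rowEnd_strictAnti rowStart_le_rowEnd
      htrans hcomp g]
  symm
  have htype : ∀ Θ : Fin n → Finset κ.Box, IsRimByRows Θ →
      IsRowType Θ (Classical.epsilon (IsRowType Θ)) := fun Θ h =>
    Classical.epsilon_spec (h.exists_rowType hn)
  refine Finset.sum_bij (fun Θ _ => Classical.epsilon (IsRowType Θ)) ?_ ?_ ?_ ?_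
  · intro Θ hΘ
    rw [Finset.mem_filter] at hΘ ⊢
    refine ⟨Finset.mem_univ _, fun i => ?_⟩
    rw [← htype Θ hΘ.2 i]
    omega
  · intro Θ hΘ Θ' hΘ' h
    rw [Finset.mem_filter] at hΘ hΘ'
    exact hΘ.2.eq_of_rowType hn hΘ'.2 (htype Θ hΘ.2) (h ▸ htype Θ' hΘ'.2)
  · intro σ hσ
    rw [Finset.mem_filter] at hσ
    obtain ⟨Θ, hΘ, hΘσ⟩ := exists_isRimByRows hn hσ.2
    exact ⟨Θ, Finset.mem_filter.2 ⟨Finset.mem_univ _, hΘ⟩, (htype Θ hΘ).unique hΘσ⟩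
  · intro Θ hΘ
    rw [Finset.mem_filter] at hΘ
    have h := htype Θ hΘ.2
    rw [rowSign]
    congr 1
    rw [Finset.prod_congr rfl fun i _ => genFun_chain_eq_fillingSeries R htrans g
      (e := fun i => κ.rowEnd n (Classical.epsilon (IsRowType Θ) i)) i _ (h i)
      (hΘ.2.wordH_eq hg i), prod_fillingSeries]
    · rw [rowPlaces]
      exact fillingSeries_congr R _ _ fun f _ => by simp
    · intro i j hij
      rw [Finset.disjoint_left]
      intro x hx hx'
      simp only [Finset.mem_product, Finset.mem_singleton] at hx hx'
      exact hij (hx.1.symm.trans hx'.1)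
    · intro i f f' hff'
      refine forall₃_congr fun c hc hc' => ?_
      dsimp only at hc'
      rw [hff' (i, c), hff' (i, c + 1)] <;>
        simp only [Finset.mem_product, Finset.mem_singleton, Finset.mem_Ico, true_and] <;>
        exact ⟨by omega, by omega⟩

theorem IsDiagonal.exists_eq_content {X : Type*} [Inhabited X] {γ : κ.Tableau X}
    (h : IsDiagonal γ) : ∃ g : ℤ → X, ∀ u, γ u = g (content u.1) := by
  classical
  -- Contents met by no box get an irrelevant default value, so that g is defined on all integers.
  refine ⟨fun c => if hc : ∃ u : κ.Box, content u.1 = c then γ hc.choose else default,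
    fun u => ?_⟩
  have hu : ∃ v : κ.Box, content v.1 = content u.1 := ⟨u, rfl⟩
  simp only [dif_pos hu]
  exact h _ _ hu.choose_spec.symm

theorem coe_sum_sign_mul_prod (R : Type*) [CommRing R] {ι τ : Type*} [Fintype τ] (s : Finset ι)
    (c : ι → ℤ) (F : ι → τ → QSym R) :
    ((∑ i ∈ s, (c i : QSym R) * ∏ j, F i j : QSym R) : MvPowerSeries ℕ R) =
      ∑ i ∈ s, c i • ∏ j, (F i j : MvPowerSeries ℕ R) := by
  change (QSym R).val _ = _
  simp only [map_sum, map_mul, map_prod, map_intCast, zsmul_eq_mul]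
  rfl

/-- The case r = (≤): the negated converse is strict increase down columns, and chains for (≤) are
the monotone words counted by E. -/
theorem schurQ_eq_sum_rimH (R : Type*) [CommRing R] {γ : κ.Tableau ℕ+} (hγ : IsDiagonal γ) :
    schurQ R γ = ∑ Θ ∈ κ.rimH, (signH Θ : QSym R) * ∏ i, essentialQ R (wordH (Θ i) γ) := by
  classical
  obtain ⟨g, hg⟩ := hγ.exists_eq_content
  refine Subtype.ext ?_
  rw [coe_sum_sign_mul_prod]
  have h := genFun_isChainTableau R (r := (· ≤ ·)) (fun _ _ _ => le_trans)
    (fun _ _ _ h1 h2 => (not_le.1 h1).le.trans h2) le_rfl hg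
  have hsign : ∀ Θ : Fin κ.numRows → Finset κ.Box, signH Θ = rowSign Θ := by
    intro Θ
    have : IsTypeH Θ = IsRowType Θ := by
      funext σ
      refine propext (forall_congr' fun i => ?_)
      unfold rowStart rowEnd
      omega
    rw [signH, rowSign, this]
  have hmono : ∀ (l : List ℕ+), (essentialQ R l : MvPowerSeries ℕ R) =
      genFun R (fun f : Fin l.length → ℕ => ∀ x y, x < y → f x ≤ f y) l.get := by
    intro l
    change genFun R _ _ = _
    congr 1
    funext f
    exact propext monotone_iff_forall_lt
  have hschur : (schurQ R γ : MvPowerSeries ℕ R) =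
      genFun R (fun T : κ.Box → ℕ => IsChainTableau (· ≤ ·) T) γ := by
    change genFun R _ _ = _
    congr 1
    funext T
    simp only [IsSemistandard, IsChainTableau, not_le]
  rw [hschur, h]
  simp only [hsign, hmono]
  refine Finset.sum_congr ?_ fun _ _ => rfl
  ext Θ
  simp only [rimH, Finset.mem_filter]
  rfl

/-! ### Conjugation of diagrams and rim decompositions -/

section Transpose

/-- The conjugate skew diagram. -/
def transpose (κ : SkewDiagram) : SkewDiagram :=
  ⟨κ.outer.transpose, κ.inner.transpose, YoungDiagram.transpose_mono κ.le⟩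

theorem mem_cells_transpose {u : ℕ × ℕ} : u ∈ κ.transpose.cells ↔ u.swap ∈ κ.cells := by
  rw [mem_cells, mem_cells]
  simp only [transpose, YoungDiagram.mem_transpose]

/-- The boxes of a skew diagram and those of its conjugate. -/
def transposeBox (κ : SkewDiagram) : κ.Box ≃ κ.transpose.Box where
  toFun u := ⟨u.1.swap, mem_cells_transpose.2 (by simp [u.2])⟩
  invFun u := ⟨u.1.swap, mem_cells_transpose.1 u.2⟩
  left_inv u := by simp
  right_inv u := by simp

theorem IsRibbon.of_swap {θ θ' : Finset (ℕ × ℕ)} (h : ∀ u, u ∈ θ' ↔ u.swap ∈ θ)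
    (hθ : IsRibbon θ) : IsRibbon θ' where
  isSkew := by
    obtain ⟨κ, rfl⟩ := hθ.isSkew
    refine ⟨κ.transpose, ?_⟩
    ext u
    rw [h, mem_cells_transpose]
  nonempty := by
    obtain ⟨u, hu⟩ := hθ.nonempty
    exact ⟨u.swap, (h _).2 (by simpa using hu)⟩
  connected u hu v hv := by
    have := (hθ.connected _ ((h u).1 hu) _ ((h v).1 hv)).lift Prod.swap (p := fun a b =>
      Adjacent a b ∧ a ∈ θ' ∧ b ∈ θ') fun a b hab => by
        refine ⟨?_, (h _).2 (by simpa using hab.2.1), (h _).2 (by simpa using hab.2.2)⟩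
        have := hab.1
        simp only [Adjacent, Prod.fst_swap, Prod.snd_swap] at this ⊢
        omega
    exact this
  no_block i j := by
    rintro ⟨h1, h2, h3, h4⟩
    exact hθ.no_block j i ⟨(h _).1 h1, (h _).1 h3, (h _).1 h2, (h _).1 h4⟩

/-- The second diagram is characterized only by its boxes, so the same lemma serves to pass to the
conjugate and back without identifying a double conjugate with the original. -/
theorem IsRimDecomposition.of_swap {κ' : SkewDiagram} (hcells : ∀ u, u ∈ κ'.cells ↔ u.swap ∈ κ.cells)
    (hinner : ∀ u, u ∈ κ'.inner ↔ u.swap ∈ κ.inner) {Θ : Fin n → Finset κ.Box}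
    {Θ' : Fin n → Finset κ'.Box} (h : ∀ k u, u ∈ boxes (Θ' k) ↔ u.swap ∈ boxes (Θ k))
    (hΘ : IsRimDecomposition Θ) : IsRimDecomposition Θ' where
  ribbon k hk := by
    obtain ⟨u, hu⟩ := hk
    have hu := (h k u.1).1 (val_mem_boxes.2 hu)
    exact (hΘ.ribbon k ⟨_, (mem_boxes.1 hu).2⟩).of_swap (h k)
  disjoint k l hkl := by
    rw [Finset.disjoint_left]
    intro u hk hl
    have hk := (h k u.1).1 (val_mem_boxes.2 hk)
    have hl := (h l u.1).1 (val_mem_boxes.2 hl)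
    exact Finset.disjoint_left.1 (hΘ.disjoint k l hkl) (mem_boxes.1 hk).2 (mem_boxes.1 hl).2
  cover u := by
    obtain ⟨k, hk⟩ := hΘ.cover ⟨u.1.swap, (hcells u.1).1 u.2⟩
    exact ⟨k, val_mem_boxes.1 ((h k u.1).2 (val_mem_boxes.2 hk))⟩
  partition k u v hvu hu := by
    have := hΘ.partition k (show v.swap ≤ u.swap from Prod.swap_le_swap.2 hvu) (by
      rcases hu with hu | ⟨l, hl, hu⟩
      · exact Or.inl ((hinner u).1 hu)
      · exact Or.inr ⟨l, hl, (h l u).1 hu⟩)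
    rcases this with hv | ⟨l, hl, hv⟩
    · exact Or.inl ((hinner v).2 hv)
    · exact Or.inr ⟨l, hl, (h l v).2 hv⟩

/-- The conjugates of the members of a family of sets of boxes. -/
def transposeFamily (κ : SkewDiagram) (n : ℕ) :
    (Fin n → Finset κ.Box) ≃ (Fin n → Finset κ.transpose.Box) :=
  Equiv.arrowCongr (Equiv.refl _) κ.transposeBox.finsetCongr

theorem mem_boxes_transposeFamily (Θ : Fin n → Finset κ.Box) (k : Fin n) (u : ℕ × ℕ) :
    u ∈ boxes (κ.transposeFamily n Θ k) ↔ u.swap ∈ boxes (Θ k) := by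
  rw [mem_boxes, mem_boxes]
  simp only [transposeFamily, Equiv.arrowCongr_apply, Equiv.coe_refl, Equiv.refl_symm,
    Function.comp_apply, id_eq, Equiv.finsetCongr_apply, Finset.mem_map_equiv]
  exact ⟨fun ⟨h, h'⟩ => ⟨mem_cells_transpose.1 h, h'⟩, fun ⟨h, h'⟩ => ⟨mem_cells_transpose.2 h, h'⟩⟩

theorem card_transposeFamily (Θ : Fin n → Finset κ.Box) (k : Fin n) :
    (κ.transposeFamily n Θ k).card = (Θ k).card := Finset.card_map _

theorem mem_rimE_iff (Θ : Fin κ.numCols → Finset κ.Box) :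
    Θ ∈ κ.rimE ↔ IsRimByRows (κ.transposeFamily κ.numCols Θ) := by
  classical
  have h := mem_boxes_transposeFamily Θ
  have h' : ∀ k u, u ∈ boxes (Θ k) ↔ u.swap ∈ boxes (κ.transposeFamily _ Θ k) := fun k u => by
    rw [h, Prod.swap_swap]
  have hinner : ∀ u, u ∈ κ.transpose.inner ↔ u.swap ∈ κ.inner := fun _ =>
    YoungDiagram.mem_transpose
  rw [rimE, Finset.mem_filter, IsRimByRows]
  simp only [Finset.mem_univ, true_and]
  refine and_congr ⟨fun hΘ => hΘ.of_swap (fun _ => mem_cells_transpose) hinner h,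
    fun hΘ => hΘ.of_swap (fun u => ?_) (fun u => ?_) h'⟩ (forall_congr' fun i => ?_)
  · rw [mem_cells_transpose, Prod.swap_swap]
  · rw [hinner, Prod.swap_swap]
  · rw [← Finset.card_pos, ← Finset.card_pos, card_transposeFamily]
    refine imp_congr_right fun _ => and_congr ?_ ⟨fun hv v hv' => ?_, fun hv v hv' => ?_⟩
    · rw [h]
      simp [transpose]
    · exact (hv _ ((h i v).1 hv')).symm.imp_left id |>.imp_right fun h => by
        simpa [transpose] using h
    · have := hv _ ((h' i v).1 hv')
      simp [transpose] at this ⊢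
      omega

/-- Conjugation exchanges the bottom left and top right ends of a ribbon and negates contents, so
the reversed reading of a ribbon is the ordinary reading of its conjugate. -/
theorem wordE_eq_wordH_transposeFamily {Θ : Fin n → Finset κ.Box}
    (h : IsRimByRows (κ.transposeFamily n Θ)) {γ : κ.Tableau ℕ+} {g : ℤ → ℕ+}
    (hg : ∀ u, γ u = g (content u.1)) (i : Fin n) :
    wordE (Θ i) γ = wordH (κ.transposeFamily n Θ i) fun u => γ (κ.transposeBox.symm u) := by
  have hswap : ∀ u : ℕ × ℕ, content u.swap = -content u := fun u => by
    simp [content]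
  have hmem := mem_boxes_transposeFamily Θ i
  have himg := h.image_content i
  rw [h.wordH_eq (g := fun c => g (-c)) (fun u => by
    rw [hg, ← hswap]
    -- Negating the contents a, …, a + m - 1 of the conjugate ribbon gives an interval that starts
    -- at -a - m + 1.
    rfl) i, wordE, wordH_eq_of_image_content (s := -κ.transpose.rowStart n i - (Θ i).card + 1)
      (g := g) ?_ ?_ hg, card_transposeFamily]
  · refine List.ext_getElem (by simp) fun k h1 h2 => ?_
    simp only [List.length_reverse, List.length_map, List.length_range] at h1
    simp only [List.getElem_reverse, List.getElem_map, List.getElem_range, List.length_map,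
      List.length_range]
    congr 1
    omega
  · intro u hu v hv huv
    exact h.not_lt_lt i u.swap ((hmem _).2 (by simpa using hu)) v.swap
      ((hmem _).2 (by simpa using hv)) huv.symm
  · rw [card_transposeFamily] at himg
    ext c
    have := Finset.ext_iff.1 himg (-c)
    rw [Finset.mem_image, Finset.mem_Ico] at this ⊢
    have hex : (∃ u ∈ boxes (Θ i), content u = c) ↔
        ∃ u ∈ boxes (κ.transposeFamily n Θ i), content u = -c := by
      constructor
      · rintro ⟨u, hu, rfl⟩
        exact ⟨u.swap, (hmem _).2 (by simpa using hu), hswap u⟩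
      · rintro ⟨u, hu, huc⟩
        exact ⟨u.swap, (hmem _).1 hu, by rw [hswap, huc, neg_neg]⟩
    rw [hex, this]
    omega

end Transpose

/-- The case r = (<) on the conjugate diagram: its rows are the strictly increasing columns, the
negated converse is weak increase along the original rows, and chains for (<) are the words counted
by M. -/
theorem schurQ_eq_sum_rimE (R : Type*) [CommRing R] {γ : κ.Tableau ℕ+} (hγ : IsDiagonal γ) :
    schurQ R γ = ∑ Θ ∈ κ.rimE, (signE Θ : QSym R) * ∏ i, monomialQ R (wordE (Θ i) γ) := by
  classical
  obtain ⟨g, hg⟩ := hγ.exists_eq_content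
  refine Subtype.ext ?_
  rw [coe_sum_sign_mul_prod]
  have hg' : ∀ u : κ.transpose.Box, γ (κ.transposeBox.symm u) = g (-content u.1) := fun u => by
    rw [hg]
    congr 1
    simp [content, transposeBox]
  have h := genFun_isChainTableau R (n := κ.numCols) (r := (· < ·)) (fun _ _ _ => lt_trans)
    (fun _ _ _ h1 h2 => (not_lt.1 h1).trans_lt h2)
    (κ := κ.transpose) (YoungDiagram.colLen_transpose _ _).le (g := fun c => g (-c)) hg'
  have hsign : ∀ Θ : Fin κ.numCols → Finset κ.Box,
      signE Θ = rowSign (κ.transposeFamily _ Θ) := by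
    intro Θ
    have : IsTypeE Θ = IsRowType (κ.transposeFamily _ Θ) := by
      funext σ
      refine propext (forall_congr' fun i => ?_)
      rw [card_transposeFamily]
      simp only [rowStart, rowEnd, transpose, YoungDiagram.rowLen_transpose]
      omega
    rw [signE, rowSign, this]
  have hschur : (schurQ R γ : MvPowerSeries ℕ R) =
      genFun R (fun T : κ.transpose.Box → ℕ => IsChainTableau (· < ·) T)
        fun u => γ (κ.transposeBox.symm u) := by
    refine (genFun_eq_fillingSeries R (Equiv.subtypeUnivEquiv Finset.mem_univ).symm
      (Q := IsSemistandard) (w := γ) (fun f => Iff.rfl) fun _ => rfl).trans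
        (genFun_eq_fillingSeries R (κ.transposeBox.symm.trans
          (Equiv.subtypeUnivEquiv Finset.mem_univ).symm) (fun f => ?_) fun _ => rfl).symm
    simp only [IsSemistandard, IsChainTableau, not_lt]
    rw [and_comm]
    refine and_congr ?_ ?_ <;> rw [κ.transposeBox.surjective.forall] <;>
      refine forall_congr' fun u => ?_ <;> rw [κ.transposeBox.surjective.forall] <;>
      refine forall_congr' fun v => ?_ <;> exact Iff.rfl
  rw [hschur, h]
  symm
  refine Finset.sum_equiv (κ.transposeFamily κ.numCols) (fun Θ => ?_) fun Θ hΘ => ?_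
  · rw [mem_rimE_iff]
    simp
  · rw [mem_rimE_iff] at hΘ
    rw [hsign]
    congr 1
    refine Finset.prod_congr rfl fun i _ => ?_
    rw [wordE_eq_wordH_transposeFamily hΘ hg i]
    rfl

/-- Inside the rectangle, the reflection shifts all contents by the same constant. -/
theorem IsDiagonal.antiTranspose {ν : SkewDiagram} {X : Type*} {γ : ν.Tableau X}
    (h : IsDiagonal γ) : IsDiagonal γ.antiTranspose := by
  intro u v huv
  have hu := lt_of_mem_antiTranspose u
  have hv := lt_of_mem_antiTranspose v
  refine h _ _ ?_
  simp only [reflect]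
  omega

end SkewDiagram

end SchurQSym

end

theorem mainTheorem8 (ν : SkewDiagram) (γ : ν.Tableau ℕ+) :
    HopfAlgebra.antipode ℤ (schurQ ℤ γ) = (-1) ^ ν.size * schurQ ℤ γ.antiTranspose ∧
    (IsDiagonal γ →
      HopfAlgebra.antipode ℤ (schurQ ℤ γ) =
          (-1) ^ ν.size * ∑ Θ ∈ ν.antiTranspose.rimH,
            (signH Θ : QSym ℤ) * ∏ i, essentialQ ℤ (wordH (Θ i) γ.antiTranspose) ∧
      HopfAlgebra.antipode ℤ (schurQ ℤ γ) =
          (-1) ^ ν.size * ∑ Θ ∈ ν.antiTranspose.rimE,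
            (signE Θ : QSym ℤ) * ∏ i, monomialQ ℤ (wordE (Θ i) γ.antiTranspose)) := by
  refine ⟨antipode_schurQ ℤ γ, fun hγ => ⟨?_, ?_⟩⟩
  · rw [antipode_schurQ, schurQ_eq_sum_rimH ℤ hγ.antiTranspose]
  · rw [antipode_schurQ, schurQ_eq_sum_rimE ℤ hγ.antiTranspose]
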